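/- Let $\sigma\in\mathbb R$ with $\sigma^2<\log 4$ (natural logarithm), and let $W=\exp(\sigma Y-\sigma^2/2)$, where $Y$ is a standard Gaussian random variable. Let $W_I$, indexed by the dyadic intervals $I=[k2^{-n},(k+1)2^{-n}]$ ($n\ge 0$, $0\le k<2^n$), be independent random variables, each with the law of $W$. For $x\in[0,1]$ let $I_j(x)$ be the dyadic interval of length $2^{-j}$ containing $x$ (the one with maximum $x$ if there are two), and let $\mu_n$ be the measure on $[0,1]$ with density $\prod_{j=0}^{n-1}W_{I_j(x)}$ with respect to Lebesgue measure. Then almost surely $\mu_n$ converges weakly to a finite measure $\mu$, and $\rho(x,y)=\rho(y,x):=\mu([x,y])$ for $0\le x\le y\le 1$ defines a metric $\rho$ on $[0,1]$. Let $K\subset[0,1]$ be a deterministic nonempty analytic (for instance Borel) set. Let $\zeta_0$ be its Hausdorff dimension with respect to the Euclidean metric, and let $\zeta$ be its Hausdorff dimension with respect to the random metric $\rho$. Then almost surely $\zeta\in[0,1]$ and the KPZ formula $$\zeta_0-\zeta=\frac{\sigma^2}{\log 4}\,\zeta\,(1-\zeta)$$ holds; moreover, $\zeta$ is the only solution of this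 equation in $[0,1]$. -/

import Mathlib

open MeasureTheory ProbabilityTheory Filter Topology

namespace Cascade

/-- Indices of the dyadic subintervals of `[0,1]`: `⟨n, k⟩` stands for the interval
`[k 2⁻ⁿ, (k + 1) 2⁻ⁿ]`, where `0 ≤ k < 2ⁿ`. -/
abbrev Dyadic : Type := (n : ℕ) × Fin (2 ^ n)

/-- The dyadic interval with a given index. -/
def Dyadic.interval (I : Dyadic) : Set unitInterval :=
  {x | (I.2 : ℝ) / 2 ^ I.1 ≤ x ∧ (x : ℝ) ≤ ((I.2 : ℝ) + 1) / 2 ^ I.1}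

theorem ceil_sub_one_lt (n : ℕ) (x : unitInterval) : ⌈2 ^ n * (x : ℝ)⌉₊ - 1 < 2 ^ n := by
  have h : ⌈2 ^ n * (x : ℝ)⌉₊ ≤ 2 ^ n := by
    refine Nat.ceil_le.2 ?_
    push_cast
    exact mul_le_of_le_one_right (by positivity) x.2.2
  have h2 : 0 < 2 ^ n := by positivity
  omega

/-- `Iₙ(x)`: the dyadic interval of length `2⁻ⁿ` that contains `x`, the one whose maximum is `x`
if there are two of them. Its left end is `(⌈2ⁿ x⌉ - 1) 2⁻ⁿ` for `x > 0`; for `x = 0` the truncated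
subtraction gives the leftmost interval. -/
noncomputable def dyadicAt (n : ℕ) (x : unitInterval) : Dyadic :=
  ⟨n, ⌈2 ^ n * (x : ℝ)⌉₊ - 1, ceil_sub_one_lt n x⟩

theorem mem_interval_dyadicAt (n : ℕ) (x : unitInterval) : x ∈ (dyadicAt n x).interval := by
  have hp : (0 : ℝ) < 2 ^ n := by positivity
  have h0 : (0 : ℝ) ≤ 2 ^ n * (x : ℝ) := mul_nonneg hp.le x.2.1
  have h1 := Nat.le_ceil (2 ^ n * (x : ℝ))
  have h2 := Nat.ceil_lt_add_one h0
  simp only [Dyadic.interval, dyadicAt, Set.mem_ofPred_eq]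
  rw [div_le_iff₀ hp, le_div_iff₀ hp]
  rcases Nat.eq_zero_or_pos ⌈2 ^ n * (x : ℝ)⌉₊ with h | h
  · rw [h] at h1 ⊢
    norm_num at h1 ⊢
    constructor <;> nlinarith
  · rw [Nat.cast_sub h]
    push_cast
    constructor <;> nlinarith

/-- The density `wₙ(x) = ∏_{j < n} W_{I_j(x)}`, for one sample `W` of the weights. -/
noncomputable def density (W : Dyadic → ℝ) (n : ℕ) (x : unitInterval) : ENNReal :=
  ∏ j ∈ Finset.range n, ENNReal.ofReal (W (dyadicAt j x))

theorem density_le (W : Dyadic → ℝ) (n : ℕ) (x : unitInterval) :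
    density W n x ≤ ∏ j ∈ Finset.range n, ∑ k : Fin (2 ^ j), ENNReal.ofReal (W ⟨j, k⟩) :=
  Finset.prod_le_prod' fun j _ =>
    Finset.single_le_sum (f := fun k : Fin (2 ^ j) => ENNReal.ofReal (W ⟨j, k⟩))
      (fun _ _ => zero_le) (Finset.mem_univ (dyadicAt j x).2)

theorem isFiniteMeasure_density (W : Dyadic → ℝ) (n : ℕ) :
    IsFiniteMeasure ((volume : Measure unitInterval).withDensity (density W n)) := by
  refine isFiniteMeasure_withDensity (ne_top_of_le_ne_top ?_ (lintegral_mono (density_le W n)))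
  rw [lintegral_const]
  refine ENNReal.mul_ne_top (ENNReal.prod_ne_top fun j _ => ?_) (measure_ne_top _ _)
  exact ENNReal.sum_ne_top.2 fun k _ => ENNReal.ofReal_ne_top

/-- The measure `μₙ = wₙ μ₀`, where `μ₀` is Lebesgue measure on `[0,1]`. -/
noncomputable def approx (W : Dyadic → ℝ) (n : ℕ) : FiniteMeasure unitInterval :=
  ⟨(volume : Measure unitInterval).withDensity (density W n), isFiniteMeasure_density W n⟩

/-- The cascade measure `μ = lim μₙ`, the limit being that of weak convergence of measures. -/
noncomputable def limitMeasure (W : Dyadic → ℝ) : FiniteMeasure unitInterval :=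
  limUnder atTop (approx W)

/-- The distance `ρ(x,y) = μ[x,y]` for `x ≤ y`, extended symmetrically. -/
noncomputable def rho (W : Dyadic → ℝ) (x y : unitInterval) : ℝ :=
  (limitMeasure W (Set.uIcc x y) : ℝ)

/-- The law of `exp(σ Y - σ² / 2)`, where `Y` is a standard Gaussian variable. -/
noncomputable def weightLaw (σ : ℝ) : Measure ℝ :=
  (gaussianReal 0 1).map fun y => Real.exp (σ * y - σ ^ 2 / 2)

end Cascade

/-! ### Combinatorics of the dyadic tree -/

namespace Cascade

/-! Put `a = σ² / 2`, `G = log W` and `φ(t) = t + a t (1 - t) / log 2` (`kpzExponent`). Then `E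
exp(θ G) = exp(a (θ² - θ))`, so `2⁻ᵗ E Wᵗ = 2^(-φ(t))`, and the claim is `φ(ζ) = ζ₀`. Since `ρ(x,
y)` is the distance between the values of the distribution function `cdf μ`, the number `ζ` is the
dimension of `cdf μ '' K` on the real line. As `φ` is continuous and, for `a < log 2`, injective on
`[0,1]`, it is enough to compare `ζ` with rational `t` (`kpzExponent_toReal_eq`,
`kpzExponent_injOn`).

The mass that `μₙ` gives to a dyadic interval is a nonnegative martingale from the level of the
interval on. It is bounded in `Lᵖ` for some `p > 1` (`IsWeight.exists_lintegral_subMass_rpow_le`),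
so the limits form a mass distribution without atoms. A Paley–Zygmund bound and the recursion along
the tree give negative moments of every order (`IsWeight.exists_lintegral_limMass_rpow_neg_le`), so
every interval has positive mass and `ρ` separates points.

Upper bound (`IsGaussianField.ae_dimH_cdf_image_le`): at level `n` one has `E μ(I)ᵗ ≤ 2^(-n φ(t))`.
If `ζ₀ < φ(t)`, then `K` has dyadic covers of small cost at exponent `φ(t)`, and these are on
average covers of small `ρ`-cost at exponent `t`.

Lower bound (`IsGaussianField.ae_le_dimH_cdf_image`): if `φ(t) < s < ζ₀`, Frostman's lemma puts on a
compact subset of `K` a mass `b` with `b(I) ≤ 2^(-n s)`. A second cascade, with the tilted weights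
`Wᵗ / E Wᵗ` built from the same variables, is run on `b`; its limit is almost surely nonzero by a
zero-one law. Its expected `t`-energy for `ρ` is finite: two points are separated by a dyadic
interval lying strictly between them, whose `μ`-mass bounds their distance from below, and along
common ancestors the powers `Wᵗ` and `W⁻ᵗ` cancel, leaving one factor `1 / E Wᵗ` per level. The sum
over the levels is geometric with ratio `2^(φ(t) - s) < 1`.

Frostman's lemma for an analytic set rests on Choquet's capacitability argument, carried out for the
dyadic net content (`exists_isCompact_subset_netContent_ne_zero`). -/

theorem Dyadic.ext_val {I J : Dyadic} (h : I.1 = J.1) (h' : (I.2 : ℕ) = J.2) : I = J := by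
  obtain ⟨n, k⟩ := I
  obtain ⟨m, l⟩ := J
  obtain rfl : n = m := h
  obtain rfl : k = l := Fin.ext h'
  rfl

/-- The position of a half of a dyadic interval. -/
def childIdx {n : ℕ} (k : Fin (2 ^ n)) (i : Fin 2) : Fin (2 ^ (n + 1)) :=
  Fin.cast (pow_succ 2 n).symm (finProdFinEquiv (k, i))

@[simp] theorem childIdx_val {n : ℕ} (k : Fin (2 ^ n)) (i : Fin 2) :
    (childIdx k i : ℕ) = 2 * k + i := by
  simp [childIdx, finProdFinEquiv, add_comm]

/-- The two halves of a dyadic interval. -/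
abbrev child (I : Dyadic) (i : Fin 2) : Dyadic := ⟨I.1 + 1, childIdx I.2 i⟩

/-- The position of the dyadic interval of length `2⁻ⁿ` that contains a point. -/
noncomputable def idx (n : ℕ) (x : unitInterval) : Fin (2 ^ n) := (dyadicAt n x).2

theorem idx_val (n : ℕ) (x : unitInterval) : (idx n x : ℕ) = ⌈2 ^ n * (x : ℝ)⌉₊ - 1 := rfl

theorem dyadicAt_eq (n : ℕ) (x : unitInterval) : dyadicAt n x = ⟨n, idx n x⟩ := rfl

theorem sum_level_succ {M : Type*} [AddCommMonoid M] (f : Dyadic → M) (n : ℕ) :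
    ∑ k : Fin (2 ^ (n + 1)), f ⟨n + 1, k⟩ = ∑ k : Fin (2 ^ n), ∑ i, f (child ⟨n, k⟩ i) := by
  rw [← Fintype.sum_prod_type' (f := fun k i => f (child ⟨n, k⟩ i))]
  exact (Equiv.sum_comp (finProdFinEquiv.trans (finCongr (pow_succ 2 n).symm))
    (fun k => f ⟨n + 1, k⟩)).symm

theorem sum_level_eq {M : Type*} [AddCommMonoid M] {f : Dyadic → M}
    (hf : ∀ I, f I = ∑ i, f (child I i)) (n : ℕ) :
    ∑ k : Fin (2 ^ n), f ⟨n, k⟩ = f ⟨0, 0⟩ := by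
  induction n with
  | zero => simp
  | succ n ih => rw [sum_level_succ, ← ih]; exact Finset.sum_congr rfl fun k _ => (hf _).symm

/-- The position of the dyadic interval containing a given one, one level up. -/
def parent {n : ℕ} (k : Fin (2 ^ (n + 1))) : Fin (2 ^ n) :=
  ⟨k / 2, by have := k.2; have := pow_succ 2 n; omega⟩

@[simp] theorem parent_val {n : ℕ} (k : Fin (2 ^ (n + 1))) : (parent k : ℕ) = k / 2 := rfl

@[simp] theorem parent_childIdx {n : ℕ} (k : Fin (2 ^ n)) (i : Fin 2) :
    parent (childIdx k i) = k := by
  apply Fin.ext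
  have := i.2
  simp only [parent_val, childIdx_val]
  omega

theorem exists_eq_childIdx {n : ℕ} (k : Fin (2 ^ (n + 1))) :
    ∃ i, k = childIdx (parent k) i :=
  ⟨⟨k % 2, Nat.mod_lt _ two_pos⟩, Fin.ext (by
    rw [childIdx_val]; simp only [parent_val]; omega)⟩

/-- The half-open version of a dyadic interval. -/
def cell (I : Dyadic) : Set unitInterval := {x | idx I.1 x = I.2}

theorem mem_cell_iff {I : Dyadic} {x : unitInterval} : x ∈ cell I ↔ idx I.1 x = I.2 := Iff.rfl

theorem mem_cell_iff_val {I : Dyadic} {x : unitInterval} :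
    x ∈ cell I ↔ (idx I.1 x : ℕ) = I.2 := Fin.ext_iff

theorem mem_cell_iff_dyadicAt {I : Dyadic} {x : unitInterval} :
    x ∈ cell I ↔ dyadicAt I.1 x = I := by
  obtain ⟨n, k⟩ := I
  rw [mem_cell_iff, dyadicAt_eq]
  constructor
  · intro h
    rw [h]
  · intro h
    simpa using h

theorem mem_cell_idx (n : ℕ) (x : unitInterval) : x ∈ cell ⟨n, idx n x⟩ := rfl

@[simp] theorem parent_idx (n : ℕ) (x : unitInterval) : parent (idx (n + 1) x) = idx n x := by
  apply Fin.ext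
  simp only [parent_val, idx_val]
  set y : ℝ := 2 ^ n * (x : ℝ) with hy
  have e : (2 : ℝ) ^ (n + 1) * x = 2 * y := by rw [hy]; ring
  have hy0 : 0 ≤ y := mul_nonneg (by positivity) x.2.1
  rw [e]
  -- Together with the next bound, `⌈2 y⌉` is `2 ⌈y⌉` or `2 ⌈y⌉ - 1`. For `y = 0` the truncated
  -- subtraction gives `0` on both sides.
  have h1 : ⌈2 * y⌉₊ ≤ 2 * ⌈y⌉₊ := by
    refine Nat.ceil_le.2 ?_
    push_cast
    linarith [Nat.le_ceil y]
  have h2 : 2 * ⌈y⌉₊ < ⌈2 * y⌉₊ + 2 := by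
    have h := Nat.ceil_lt_add_one hy0
    have h' := Nat.le_ceil (2 * y)
    have : ((2 * ⌈y⌉₊ : ℕ) : ℝ) < ((⌈2 * y⌉₊ + 2 : ℕ) : ℝ) := by push_cast; linarith
    exact_mod_cast this
  omega

theorem mem_cell_iff_child {I : Dyadic} {x : unitInterval} :
    x ∈ cell I ↔ ∃ i, x ∈ cell (child I i) := by
  simp only [mem_cell_iff]
  constructor
  · intro h
    obtain ⟨i, hi⟩ := exists_eq_childIdx (idx (I.1 + 1) x)
    rw [parent_idx, h] at hi
    exact ⟨i, hi⟩
  · rintro ⟨i, hi⟩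
    rw [← parent_idx, hi, parent_childIdx]

theorem cell_eq_iUnion_child (I : Dyadic) : cell I = ⋃ i, cell (child I i) := by
  ext x; rw [mem_cell_iff_child, Set.mem_iUnion]

theorem eq_of_mem_cell {I J : Dyadic} {x : unitInterval} (hI : x ∈ cell I) (hJ : x ∈ cell J)
    (h : I.1 = J.1) : I = J := by
  rw [mem_cell_iff_dyadicAt] at hI hJ
  rw [← hI, ← hJ, h]

theorem disjoint_cell {I J : Dyadic} (h : I.1 = J.1) (hne : I ≠ J) : Disjoint (cell I) (cell J) :=
  Set.disjoint_left.2 fun _ hI hJ => hne (eq_of_mem_cell hI hJ h)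

theorem child_ne {I : Dyadic} {i j : Fin 2} (hij : i ≠ j) : child I i ≠ child I j := by
  intro h
  have h2 := congrArg (fun J : Dyadic => (J.2 : ℕ)) h
  simp only [childIdx_val] at h2
  exact hij (Fin.ext (by omega))

theorem cell_root : cell ⟨0, 0⟩ = Set.univ :=
  Set.eq_univ_of_forall fun _ => Subsingleton.elim (α := Fin 1) _ _

theorem cell_subset_Icc {I : Dyadic} {x : unitInterval} (hx : x ∈ cell I) :
    (I.2 : ℝ) / 2 ^ I.1 ≤ x ∧ (x : ℝ) ≤ ((I.2 : ℝ) + 1) / 2 ^ I.1 := by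
  have h := mem_interval_dyadicAt I.1 x
  rwa [mem_cell_iff_dyadicAt.1 hx] at h

/-- Cells are open on the left, except that the leftmost one contains `0`; the strict inequality is
therefore sufficient but not necessary. -/
theorem mem_cell_of_lt {I : Dyadic} {x : unitInterval} (h1 : (I.2 : ℝ) / 2 ^ I.1 < x)
    (h2 : (x : ℝ) ≤ ((I.2 : ℝ) + 1) / 2 ^ I.1) : x ∈ cell I := by
  have hp : (0 : ℝ) < 2 ^ I.1 := by positivity
  rw [div_lt_iff₀ hp] at h1
  rw [le_div_iff₀ hp] at h2
  rw [mem_cell_iff_val, idx_val]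
  have : ⌈2 ^ I.1 * (x : ℝ)⌉₊ = (I.2 : ℕ) + 1 := by
    rw [Nat.ceil_eq_iff (by omega)]
    push_cast
    constructor <;> linarith
  omega

theorem idx_mono (n : ℕ) {x y : unitInterval} (h : x ≤ y) : idx n x ≤ idx n y := by
  rw [Fin.le_def, idx_val, idx_val]
  have : ⌈2 ^ n * (x : ℝ)⌉₊ ≤ ⌈2 ^ n * (y : ℝ)⌉₊ :=
    Nat.ceil_mono (mul_le_mul_of_nonneg_left h (by positivity))
  omega

theorem measurable_idx_val (n : ℕ) : Measurable fun x : unitInterval => (idx n x : ℕ) := by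
  have h : Measurable fun x : unitInterval => ⌈2 ^ n * (x : ℝ)⌉₊ :=
    Nat.measurable_ceil.comp (measurable_subtype_coe.const_mul _)
  exact (measurable_from_nat (f := fun m : ℕ => m - 1)).comp h

theorem measurableSet_cell (I : Dyadic) : MeasurableSet (cell I) := by
  have : cell I = (fun x : unitInterval => (idx I.1 x : ℕ)) ⁻¹' {(I.2 : ℕ)} := by
    ext x; rw [mem_cell_iff_val]; rfl
  rw [this]
  exact measurable_idx_val _ (measurableSet_singleton _)

/-- The product of the values of `U` over the strict ancestors of a dyadic interval. -/
def pathProd {M : Type*} [CommMonoid M] (U : Dyadic → M) : (n : ℕ) → Fin (2 ^ n) → M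
  | 0, _ => 1
  | n + 1, k => pathProd U n (parent k) * U ⟨n, parent k⟩

theorem pathProd_succ {M : Type*} [CommMonoid M] (U : Dyadic → M) (n : ℕ) (k : Fin (2 ^ (n + 1))) :
    pathProd U (n + 1) k = pathProd U n (parent k) * U ⟨n, parent k⟩ := rfl

theorem pathProd_childIdx {M : Type*} [CommMonoid M] (U : Dyadic → M) {n : ℕ} (k : Fin (2 ^ n))
    (i : Fin 2) : pathProd U (n + 1) (childIdx k i) = pathProd U n k * U ⟨n, k⟩ := by
  rw [pathProd_succ, parent_childIdx]

theorem pathProd_idx {M : Type*} [CommMonoid M] (U : Dyadic → M) (n : ℕ) (x : unitInterval) :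
    pathProd U n (idx n x) = ∏ j ∈ Finset.range n, U (dyadicAt j x) := by
  induction n with
  | zero => rfl
  | succ n ih => rw [Finset.prod_range_succ, ← ih, pathProd_succ, parent_idx, dyadicAt_eq]

/-- The dyadic subintervals of a dyadic interval, itself included. -/
def descendants (I : Dyadic) : Set Dyadic :=
  {J | I.1 ≤ J.1 ∧ (J.2 : ℕ) / 2 ^ (J.1 - I.1) = I.2}

theorem self_mem_descendants (I : Dyadic) : I ∈ descendants I := by simp [descendants]

theorem descendants_child_subset (I : Dyadic) (i : Fin 2) :
    descendants (child I i) ⊆ descendants I := by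
  rintro J ⟨h1, h2⟩
  simp only [childIdx_val] at h1 h2
  refine ⟨by omega, ?_⟩
  have e : J.1 - I.1 = (J.1 - (I.1 + 1)) + 1 := by omega
  rw [e, pow_succ, ← Nat.div_div_eq_div_mul, h2]
  omega

theorem disjoint_descendants {I J : Dyadic} (h : I.1 = J.1) (hne : I ≠ J) :
    Disjoint (descendants I) (descendants J) := by
  refine Set.disjoint_left.2 fun L hI hJ => hne (Dyadic.ext_val h ?_)
  rw [← hI.2, ← hJ.2, h]

theorem descendants_subset_level (I : Dyadic) : descendants I ⊆ {J | I.1 ≤ J.1} := fun _ h => h.1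

end Cascade

/-! ### Dyadic net content -/

namespace Cascade

open scoped ENNReal

theorem idx_val_div {m n : ℕ} (h : m ≤ n) (x : unitInterval) :
    (idx n x : ℕ) / 2 ^ (n - m) = idx m x := by
  induction n, h using Nat.le_induction with
  | base => simp
  | succ n hmn ih =>
    have e : n + 1 - m = (n - m) + 1 := by omega
    rw [← ih, ← parent_idx n x, parent_val, Nat.div_div_eq_div_mul, e, pow_succ 2 (n - m),
      mul_comm 2]

theorem mem_descendants_of_mem_cell {I J : Dyadic} (h : I.1 ≤ J.1) {x : unitInterval}
    (hI : x ∈ cell I) (hJ : x ∈ cell J) : J ∈ descendants I := by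
  refine ⟨h, ?_⟩
  rw [← mem_cell_iff_val.1 hI, ← mem_cell_iff_val.1 hJ, idx_val_div h]

theorem mem_cell_of_mem_descendants {I J : Dyadic} (h : J ∈ descendants I) {x : unitInterval}
    (hJ : x ∈ cell J) : x ∈ cell I := by
  rw [mem_cell_iff_val, ← h.2, ← mem_cell_iff_val.1 hJ, idx_val_div h.1]

/-- A family of dyadic intervals covers a set if the corresponding cells do. -/
def Covers (C : Set Dyadic) (A : Set unitInterval) : Prop := ∀ x ∈ A, ∃ I ∈ C, x ∈ cell I

/-- The cost of a family of dyadic intervals, an interval of length `2⁻ⁿ` costing `rⁿ`. -/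
noncomputable def cost (r : ℝ≥0∞) (C : Set Dyadic) : ℝ≥0∞ :=
  ∑' I, C.indicator (fun I : Dyadic => r ^ I.1) I

/-- The dyadic net content of a set: the least cost of a cover. -/
noncomputable def netContent (r : ℝ≥0∞) (A : Set unitInterval) : ℝ≥0∞ :=
  ⨅ (C : Set Dyadic) (_ : Covers C A), cost r C

variable {r : ℝ≥0∞}

theorem cost_eq_tsum_subtype (r : ℝ≥0∞) (C : Set Dyadic) : cost r C = ∑' I : C, r ^ I.1.1 :=
  (tsum_subtype C fun I : Dyadic => r ^ I.1).symm

theorem netContent_le_cost {C : Set Dyadic} {A : Set unitInterval} (h : Covers C A) :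
    netContent r A ≤ cost r C := iInf₂_le C h

theorem exists_covers_cost_lt {A : Set unitInterval} {c : ℝ≥0∞} (h : netContent r A < c) :
    ∃ C, Covers C A ∧ cost r C < c := by
  simpa [netContent, iInf_lt_iff] using h

/-- Here, unlike in a set of intervals, repetitions are allowed; lists of neighbours produce them.
-/
theorem netContent_le_tsum {ι : Type*} (J : ι → Dyadic) {A : Set unitInterval}
    (h : ∀ x ∈ A, ∃ i, x ∈ cell (J i)) : netContent r A ≤ ∑' i, r ^ (J i).1 := by
  refine (netContent_le_cost (C := ⋃ i, {J i}) ?_).trans ?_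
  · intro x hx
    obtain ⟨i, hi⟩ := h x hx
    exact ⟨J i, Set.mem_iUnion.2 ⟨i, rfl⟩, hi⟩
  · rw [cost_eq_tsum_subtype]
    refine (ENNReal.tsum_iUnion_le_tsum (fun I : Dyadic => r ^ I.1) _).trans (le_of_eq ?_)
    exact tsum_congr fun i => tsum_singleton (J i) fun I : Dyadic => r ^ I.1

theorem netContent_cell_le (A : Set unitInterval) (I : Dyadic) :
    netContent r (A ∩ cell I) ≤ r ^ I.1 := by
  refine (netContent_le_tsum (fun _ : Unit => I) fun x hx => ⟨(), hx.2⟩).trans ?_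
  simp

theorem netContent_cell_le_sum (A : Set unitInterval) (I : Dyadic) :
    netContent r (A ∩ cell I) ≤ ∑ i, netContent r (A ∩ cell (child I i)) := by
  refine ENNReal.le_of_forall_pos_le_add fun ε hε _ => ?_
  have hε' : (0 : ℝ≥0∞) < ε := by exact_mod_cast hε
  by_cases hfin : ∃ i, netContent r (A ∩ cell (child I i)) = ∞
  · obtain ⟨i, hi⟩ := hfin
    have := Finset.single_le_sum (f := fun i => netContent r (A ∩ cell (child I i)))
      (fun _ _ => zero_le) (Finset.mem_univ i)
    rw [hi, top_le_iff] at this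
    simp [this]
  push Not at hfin
  have h : ∀ i : Fin 2, ∃ C, Covers C (A ∩ cell (child I i)) ∧
      cost r C < netContent r (A ∩ cell (child I i)) + ε / 2 := fun i =>
    exists_covers_cost_lt (ENNReal.lt_add_right (hfin i) (by simpa using hε.ne'))
  choose C hC hcost using h
  have hcov : Covers (⋃ i, C i) (A ∩ cell I) := by
    rintro x ⟨hxA, hx⟩
    obtain ⟨i, hi⟩ := mem_cell_iff_child.1 hx
    obtain ⟨J, hJ, hxJ⟩ := hC i x ⟨hxA, hi⟩
    exact ⟨J, Set.mem_iUnion.2 ⟨i, hJ⟩, hxJ⟩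
  calc netContent r (A ∩ cell I) ≤ cost r (⋃ i, C i) := netContent_le_cost hcov
    _ ≤ ∑ i, cost r (C i) := by
        simp only [cost_eq_tsum_subtype]
        exact ENNReal.tsum_iUnion_le (fun I : Dyadic => r ^ I.1) C
    _ ≤ ∑ i, (netContent r (A ∩ cell (child I i)) + ε / 2) :=
        Finset.sum_le_sum fun i _ => (hcost i).le
    _ = ∑ i, netContent r (A ∩ cell (child I i)) + ε := by
        rw [Finset.sum_add_distrib]
        simp only [Fin.sum_univ_two, ENNReal.add_halves]

/-! ### Continuity of the net content along increasing sequences -/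

/-- The union of two families of dyadic intervals, without the intervals of one family that lie
inside an interval of the other. -/
def mergeMax (C D : Set Dyadic) : Set Dyadic :=
  {I | I ∈ C ∧ ∀ J ∈ D, I ∉ descendants J} ∪ {J | J ∈ D ∧ ∀ I ∈ C, J ∈ descendants I → I = J}

/-- The intervals of one of two families that lie inside an interval of the other. -/
def mergeMin (C D : Set Dyadic) : Set Dyadic :=
  {I | I ∈ C ∧ ∃ J ∈ D, I ∈ descendants J} ∪ {J | J ∈ D ∧ ∃ I ∈ C, J ∈ descendants I ∧ I ≠ J}

/-- The inequality holds interval by interval: one that belongs to a single family enters only one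
of the two merged families. Combined with the covering properties below, it is the strong
subadditivity of the net content. -/
theorem cost_mergeMax_add_cost_mergeMin_le (C D : Set Dyadic) :
    cost r (mergeMax C D) + cost r (mergeMin C D) ≤ cost r C + cost r D := by
  unfold cost
  rw [← ENNReal.tsum_add, ← ENNReal.tsum_add]
  refine ENNReal.tsum_le_tsum fun I => ?_
  have hself := self_mem_descendants I
  by_cases hC : I ∈ C <;> by_cases hD : I ∈ D
  · simp only [Set.indicator, hC, hD, if_true]
    exact add_le_add (by split_ifs <;> simp) (by split_ifs <;> simp)
  · by_cases h : ∃ J ∈ D, I ∈ descendants J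
    · have h1 : I ∉ mergeMax C D := by
        rintro (h' | h')
        · obtain ⟨J, hJ, hIJ⟩ := h
          exact h'.2 J hJ hIJ
        · exact hD h'.1
      rw [Set.indicator_of_notMem h1, zero_add, Set.indicator_of_mem hC]
      refine le_add_right ?_
      simp only [Set.indicator]
      split_ifs <;> simp
    · have h1 : I ∉ mergeMin C D := by
        rintro (h' | h')
        · exact h h'.2
        · exact hD h'.1
      rw [Set.indicator_of_notMem h1, add_zero, Set.indicator_of_mem hC]
      refine le_add_right ?_
      simp only [Set.indicator]
      split_ifs <;> simp
  · by_cases h : ∃ J ∈ C, I ∈ descendants J ∧ J ≠ I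
    · have h1 : I ∉ mergeMax C D := by
        rintro (h' | h')
        · exact hC h'.1
        · obtain ⟨J, hJ, hIJ, hne⟩ := h
          exact hne (h'.2 J hJ hIJ)
      rw [Set.indicator_of_notMem h1, zero_add, Set.indicator_of_mem hD]
      refine le_add_left ?_
      simp only [Set.indicator]
      split_ifs <;> simp
    · have h1 : I ∉ mergeMin C D := by
        rintro (h' | h')
        · exact hC h'.1
        · exact h h'.2
      rw [Set.indicator_of_notMem h1, add_zero, Set.indicator_of_mem hD]
      refine le_add_left ?_
      simp only [Set.indicator]
      split_ifs <;> simp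
  · have h1 : I ∉ mergeMax C D := by
      rintro (h' | h')
      · exact hC h'.1
      · exact hD h'.1
    have h2 : I ∉ mergeMin C D := by
      rintro (h' | h')
      · exact hC h'.1
      · exact hD h'.1
    rw [Set.indicator_of_notMem h1, Set.indicator_of_notMem h2]
    simp

/-- Among all intervals of `C ∪ D` around `x`, the coarsest survives the merging. The bound on its
level is what makes successive mergings stabilise at each point. -/
theorem exists_mem_mergeMax {C D : Set Dyadic} {x : unitInterval} {I : Dyadic} (hI : I ∈ C ∪ D)
    (hx : x ∈ cell I) : ∃ J ∈ mergeMax C D, x ∈ cell J ∧ J.1 ≤ I.1 := by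
  classical
  have hex : ∃ n, ∃ J ∈ C ∪ D, x ∈ cell J ∧ J.1 = n := ⟨I.1, I, hI, hx, rfl⟩
  obtain ⟨J, hJ, hxJ, hn⟩ := Nat.find_spec hex
  have hmin : ∀ L ∈ C ∪ D, x ∈ cell L → J.1 ≤ L.1 := fun L hL hxL =>
    hn ▸ Nat.find_min' hex ⟨L, hL, hxL, rfl⟩
  refine ⟨J, ?_, hxJ, hmin I hI hx⟩
  by_cases hD : J ∈ D
  · refine Or.inr ⟨hD, fun L hL hJL => ?_⟩
    have hxL := mem_cell_of_mem_descendants hJL hxJ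
    exact eq_of_mem_cell hxL hxJ (le_antisymm hJL.1 (hmin L (Or.inl hL) hxL))
  · refine Or.inl ⟨hJ.resolve_right hD, fun L hL hJL => hD ?_⟩
    have hxL := mem_cell_of_mem_descendants hJL hxJ
    rwa [← eq_of_mem_cell hxL hxJ (le_antisymm hJL.1 (hmin L (Or.inr hL) hxL))]

theorem covers_mergeMin {C D : Set Dyadic} {A : Set unitInterval} (hC : Covers C A)
    (hD : Covers D A) : Covers (mergeMin C D) A := by
  intro x hx
  obtain ⟨I, hI, hxI⟩ := hC x hx
  obtain ⟨J, hJ, hxJ⟩ := hD x hx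
  rcases le_or_gt J.1 I.1 with h | h
  · exact ⟨I, Or.inl ⟨hI, J, hJ, mem_descendants_of_mem_cell h hxJ hxI⟩, hxI⟩
  · exact ⟨J, Or.inr ⟨hJ, I, hI, mem_descendants_of_mem_cell h.le hxI hxJ,
      fun e => by rw [e] at h; exact lt_irrefl _ h⟩, hxJ⟩

theorem netContent_ne_top (A : Set unitInterval) : netContent r A ≠ ∞ := by
  refine ne_top_of_le_ne_top ENNReal.one_ne_top ?_
  have := netContent_cell_le (r := r) A ⟨0, 0⟩
  rwa [cell_root, Set.inter_univ, pow_zero] at this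

/-- Near-optimal covers of the sets `A n` are merged one after the other. Strong subadditivity keeps
the total loss below the sum of the individual losses, and the intervals that are eventually kept
cover the union. -/
theorem netContent_iUnion_le {A : ℕ → Set unitInterval} (hA : Monotone A) {L : ℝ≥0∞}
    (hL : ∀ n, netContent r (A n) ≤ L) : netContent r (⋃ n, A n) ≤ L := by
  refine ENNReal.le_of_forall_pos_le_add fun ε hε _ => ?_
  obtain ⟨ε', hε', hsum⟩ := ENNReal.exists_pos_sum_of_countable' (ENNReal.coe_ne_zero.2 hε.ne') ℕ
  have h : ∀ n, ∃ C, Covers C (A n) ∧ cost r C < netContent r (A n) + ε' n := fun n =>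
    exists_covers_cost_lt (ENNReal.lt_add_right (netContent_ne_top _) (hε' n).ne')
  choose C hC hcost using h
  obtain ⟨D, hD0, hDs⟩ : ∃ D : ℕ → Set Dyadic, D 0 = C 0 ∧
      ∀ n, D (n + 1) = mergeMax (D n) (C (n + 1)) :=
    ⟨fun n => Nat.rec (C 0) (fun n D => mergeMax D (C (n + 1))) n, rfl, fun n => rfl⟩
  have hDcov : ∀ n, Covers (D n) (A n) := by
    intro n
    cases n with
    | zero => rw [hD0]; exact hC 0
    | succ n =>
      intro x hx
      obtain ⟨I, hI, hxI⟩ := hC (n + 1) x hx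
      obtain ⟨J, hJ, hxJ, -⟩ := exists_mem_mergeMax (C := D n) (Or.inr hI) hxI
      exact ⟨J, hDs n ▸ hJ, hxJ⟩
  have hDcost : ∀ n, cost r (D n) ≤ netContent r (A n) + ∑ i ∈ Finset.range (n + 1), ε' i := by
    intro n
    induction n with
    | zero => simpa [hD0] using (hcost 0).le
    | succ n ih =>
      -- The `mergeMin` family still covers `A n`, so its cost is at least the content of `A n`,
      -- which then cancels from both sides.
      have h1 : netContent r (A n) ≤ cost r (mergeMin (D n) (C (n + 1))) :=
        netContent_le_cost (covers_mergeMin (hDcov n)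
          fun x hx => hC (n + 1) x (hA (Nat.le_succ n) hx))
      have h2 : cost r (D (n + 1)) + netContent r (A n) ≤
          (netContent r (A (n + 1)) + ∑ i ∈ Finset.range (n + 1 + 1), ε' i) +
            netContent r (A n) :=
        calc cost r (D (n + 1)) + netContent r (A n)
            ≤ cost r (D n) + cost r (C (n + 1)) := by
              rw [hDs]
              refine le_trans ?_ (cost_mergeMax_add_cost_mergeMin_le (D n) (C (n + 1)))
              gcongr
          _ ≤ (netContent r (A n) + ∑ i ∈ Finset.range (n + 1), ε' i) +
              (netContent r (A (n + 1)) + ε' (n + 1)) := add_le_add ih (hcost (n + 1)).le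
          _ = _ := by rw [Finset.sum_range_succ _ (n + 1)]; ring
      exact (ENNReal.add_le_add_iff_right (netContent_ne_top _)).1 h2
  have hDlim : ∀ n, cost r (D n) ≤ L + ε := fun n =>
    (hDcost n).trans (add_le_add (hL n) ((ENNReal.sum_le_tsum _).trans hsum.le))
  let E : Set Dyadic := {I | ∀ᶠ n in atTop, I ∈ D n}
  have hEcost : cost r E ≤ L + ε := by
    classical
    refine ENNReal.summable.tsum_le_of_sum_le fun s => ?_
    have : ∀ᶠ n in atTop, ∀ I ∈ s, I ∈ E → I ∈ D n := by
      refine (Filter.eventually_all_finset s).2 fun I _ => ?_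
      by_cases hI : I ∈ E
      · filter_upwards [hI] with n hn _ using hn
      · exact Eventually.of_forall fun n h => absurd h hI
    obtain ⟨n, hn⟩ := this.exists
    calc ∑ I ∈ s, E.indicator (fun I : Dyadic => r ^ I.1) I
        ≤ ∑ I ∈ s, (D n).indicator (fun I : Dyadic => r ^ I.1) I := by
          refine Finset.sum_le_sum fun I hI => ?_
          by_cases hIE : I ∈ E
          · rw [Set.indicator_of_mem hIE, Set.indicator_of_mem (hn I hI hIE)]
          · rw [Set.indicator_of_notMem hIE]; exact zero_le
      _ ≤ cost r (D n) := ENNReal.sum_le_tsum s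
      _ ≤ L + ε := hDlim n
  have hEcov : Covers E (⋃ n, A n) := by
    classical
    intro x hx
    obtain ⟨N, hN⟩ := Set.mem_iUnion.1 hx
    have hex : ∃ (l : ℕ) (n : ℕ), ∃ I ∈ D n, x ∈ cell I ∧ I.1 = l := by
      obtain ⟨I, hI, hxI⟩ := hDcov N x hN
      exact ⟨I.1, N, I, hI, hxI, rfl⟩
    have hspec := Nat.find_spec hex
    obtain ⟨n, I, hI, hxI, hl⟩ := hspec
    -- `I` is the coarsest interval around `x` that occurs in any of the families; once present, no
    -- merging can displace it.
    have hmin : ∀ n, ∀ J ∈ D n, x ∈ cell J → I.1 ≤ J.1 := fun m J hJ hxJ =>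
      hl.le.trans (Nat.find_min' hex ⟨m, J, hJ, hxJ, rfl⟩)
    refine ⟨I, ?_, hxI⟩
    refine eventually_atTop.2 ⟨n, fun m hm => ?_⟩
    induction m, hm using Nat.le_induction with
    | base => exact hI
    | succ m _ ih =>
      obtain ⟨J, hJ, hxJ, hle⟩ := exists_mem_mergeMax (D := C (m + 1)) (Or.inl ih) hxI
      have : J = I := eq_of_mem_cell hxJ hxI (le_antisymm hle (hmin (m + 1) J (hDs m ▸ hJ) hxJ))
      rw [hDs]
      exact this ▸ hJ
  exact (netContent_le_cost hEcov).trans hEcost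

/-! ### Compact subsets of analytic sets -/

/-- The neighbours of a dyadic interval (clipped at the ends of `[0,1]`). -/
def neighbour (I : Dyadic) (j : Fin 3) : Dyadic :=
  ⟨I.1, ⟨min ((I.2 : ℕ) + (j : ℕ) - 1) (2 ^ I.1 - 1), by have := Nat.two_pow_pos I.1; omega⟩⟩

theorem exists_mem_cell_neighbour {I : Dyadic} {x : unitInterval}
    (h1 : ((I.2 : ℝ) - 1) / 2 ^ I.1 < x) (h2 : (x : ℝ) ≤ ((I.2 : ℝ) + 2) / 2 ^ I.1) :
    ∃ j, x ∈ cell (neighbour I j) := by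
  have hp : (0 : ℝ) < 2 ^ I.1 := by positivity
  rw [div_lt_iff₀ hp] at h1
  rw [le_div_iff₀ hp] at h2
  have hlt := (idx I.1 x).2
  have hv := idx_val I.1 x
  have hle : ⌈2 ^ I.1 * (x : ℝ)⌉₊ ≤ (I.2 : ℕ) + 2 := by
    refine Nat.ceil_le.2 ?_; push_cast; linarith
  have hge : (I.2 : ℕ) < ⌈2 ^ I.1 * (x : ℝ)⌉₊ + 1 := by
    have := Nat.le_ceil (2 ^ I.1 * (x : ℝ))
    have h : ((I.2 : ℕ) : ℝ) < ((⌈2 ^ I.1 * (x : ℝ)⌉₊ + 1 : ℕ) : ℝ) := by push_cast; linarith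
    exact_mod_cast h
  have key : ∀ m : ℕ, m < 3 → (idx I.1 x : ℕ) = (I.2 : ℕ) + m - 1 → ∃ j, x ∈ cell (neighbour I j) := by
    intro m hm hj
    refine ⟨⟨m, hm⟩, ?_⟩
    rw [mem_cell_iff_val]
    change (idx I.1 x : ℕ) = min ((I.2 : ℕ) + m - 1) (2 ^ I.1 - 1)
    omega
  rcases Nat.lt_or_ge (idx I.1 x : ℕ) I.2 with h | h
  · exact key 0 (by omega) (by omega)
  · rcases Nat.eq_or_lt_of_le h with h' | h'
    · exact key 1 (by omega) (by omega)
    · exact key 2 (by omega) (by omega)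

/-- Cells are not open, so compactness is applied to slightly larger open intervals; passing back to
cells costs the factor `3`. -/
theorem netContent_le_three_mul_cost {C : Set Dyadic} {A : Set unitInterval}
    (h : ∀ x ∈ A, ∃ I ∈ C, ((I.2 : ℝ) - 1) / 2 ^ I.1 < x ∧ (x : ℝ) ≤ ((I.2 : ℝ) + 2) / 2 ^ I.1) :
    netContent r A ≤ 3 * cost r C := by
  refine (netContent_le_tsum (fun p : C × Fin 3 => neighbour p.1 p.2) ?_).trans (le_of_eq ?_)
  · intro x hx
    obtain ⟨I, hI, h1, h2⟩ := h x hx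
    obtain ⟨j, hj⟩ := exists_mem_cell_neighbour h1 h2
    exact ⟨(⟨I, hI⟩, j), hj⟩
  · rw [ENNReal.tsum_prod', cost_eq_tsum_subtype, ← ENNReal.tsum_mul_left]
    refine tsum_congr fun I => ?_
    simp [neighbour]

/-- Choquet's argument. Write `K` as a continuous image of `ℕ → ℕ` and bound the coordinates one at
a time; continuity of the content along increasing unions keeps it above `δ`. The points with all
coordinates bounded form a compact set, and if its image had content zero, an open neighbourhood of
small cost would contain the image of some finite stage. -/
theorem exists_isCompact_subset_netContent_ne_zero {K : Set unitInterval} (hK : AnalyticSet K)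
    (h0 : netContent r K ≠ 0) : ∃ K' ⊆ K, IsCompact K' ∧ netContent r K' ≠ 0 := by
  rw [AnalyticSet] at hK
  rcases hK with rfl | ⟨g, hg, rfl⟩
  · refine absurd (le_antisymm ?_ zero_le) h0
    exact (netContent_le_cost (C := ∅) fun x hx => absurd hx (Set.notMem_empty x)).trans
      (by simp [cost])
  obtain ⟨δ, hδ0, hδ⟩ := exists_between (pos_iff_ne_zero.2 h0)
  have step : ∀ (S : {S : Set (ℕ → ℕ) // δ < netContent r (g '' S)}) (j : ℕ),
      ∃ m : ℕ, δ < netContent r (g '' (S.1 ∩ {f | f j ≤ m})) := by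
    rintro ⟨S, hS⟩ j
    by_contra! hcon
    refine absurd hS (not_lt.2 ?_)
    have hU : g '' S = ⋃ m : ℕ, g '' (S ∩ {f | f j ≤ m}) := by
      rw [← Set.image_iUnion, ← Set.inter_iUnion]
      congr 1
      refine (Set.inter_eq_left.2 fun f _ => ?_).symm
      exact Set.mem_iUnion.2 ⟨f j, le_refl (f j)⟩
    rw [hU]
    refine netContent_iUnion_le (fun m n hmn => Set.image_mono ?_) hcon
    exact Set.inter_subset_inter_right _ fun f (hf : f j ≤ m) => hf.trans hmn
  choose m hm using step
  let T : ℕ → {S : Set (ℕ → ℕ) // δ < netContent r (g '' S)} := fun n =>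
    Nat.rec ⟨Set.univ, by rwa [Set.image_univ]⟩ (fun j S => ⟨S.1 ∩ {f | f j ≤ m S j}, hm S j⟩) n
  have hTs : ∀ j, (T (j + 1)).1 = (T j).1 ∩ {f | f j ≤ m (T j) j} := fun j => rfl
  let k : ℕ → ℕ := fun j => m (T j) j
  have hT : ∀ j, ∀ f ∈ (T j).1, ∀ i < j, f i ≤ k i := by
    intro j
    induction j with
    | zero => intro f _ i hi; omega
    | succ j ih =>
      intro f hf i hi
      rw [hTs] at hf
      rcases Nat.lt_succ_iff_lt_or_eq.1 hi with h | rfl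
      · exact ih f hf.1 i h
      · exact hf.2
  let B : Set (ℕ → ℕ) := Set.univ.pi fun i => Set.Iic (k i)
  have hB : IsCompact B := isCompact_univ_pi fun i => (Set.finite_Iic (k i)).isCompact
  refine ⟨g '' B, Set.image_subset_range g B, hB.image hg, fun hzero => ?_⟩
  -- The divisor `3` pays for the passage from cells to open neighbourhoods.
  have hpos : netContent r (g '' B) < δ / 3 := by
    rw [hzero]
    exact ENNReal.div_pos hδ0.ne' (by simp)
  obtain ⟨C, hC, hcost⟩ := exists_covers_cost_lt hpos
  let N : Dyadic → Set unitInterval := fun I =>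
    {x | ((I.2 : ℝ) - 1) / 2 ^ I.1 < x ∧ (x : ℝ) < ((I.2 : ℝ) + 2) / 2 ^ I.1}
  have hN : ∀ I, IsOpen (N I) := fun I =>
    (isOpen_lt continuous_const continuous_subtype_val).inter
      (isOpen_lt continuous_subtype_val continuous_const)
  have hV : IsOpen (g ⁻¹' ⋃ I ∈ C, N I) := (isOpen_biUnion fun I _ => hN I).preimage hg
  have hBV : B ⊆ g ⁻¹' ⋃ I ∈ C, N I := by
    intro f hf
    obtain ⟨I, hI, hx⟩ := hC (g f) ⟨f, hf, rfl⟩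
    obtain ⟨h1, h2⟩ := cell_subset_Icc hx
    refine Set.mem_iUnion₂.2 ⟨I, hI, lt_of_lt_of_le ?_ h1, lt_of_le_of_lt h2 ?_⟩ <;>
      · gcongr
        linarith
  have hsub : ∃ j, (T j).1 ⊆ g ⁻¹' ⋃ I ∈ C, N I := by
    by_contra! hcon
    choose f hfT hfV using fun j => Set.not_subset.1 (hcon j)
    -- The truncated sequences lie in the compact set `B`. As `f j` obeys the bounds `k i` for `i <
    -- j`, truncation does not change a given coordinate for large `j`, so the sequences themselves
    -- converge to `b` along `φ`.
    obtain ⟨b, hb, φ, hφ, hlim⟩ := hB.tendsto_subseq (x := fun j i => min (f j i) (k i))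
      fun j i _ => Set.mem_Iic.2 (min_le_right _ _)
    refine (hV.isClosed_compl.mem_of_tendsto (b := atTop) (f := fun j => f (φ j)) ?_
      (Eventually.of_forall fun j => hfV (φ j)) : b ∈ (g ⁻¹' ⋃ I ∈ C, N I)ᶜ) (hBV hb)
    rw [tendsto_pi_nhds] at hlim ⊢
    refine fun i => (hlim i).congr' ?_
    filter_upwards [eventually_gt_atTop i] with j hj
    exact min_eq_left (hT (φ j) _ (hfT (φ j)) i (hj.trans_le (hφ.id_le j)))
  obtain ⟨j, hj⟩ := hsub
  refine absurd (T j).2 (not_lt.2 ?_)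
  calc netContent r (g '' (T j).1) ≤ 3 * cost r C := by
        refine netContent_le_three_mul_cost ?_
        rintro _ ⟨f, hf, rfl⟩
        obtain ⟨I, hI, h1, h2⟩ := Set.mem_iUnion₂.1 (hj hf)
        exact ⟨I, hI, h1, h2.le⟩
    _ ≤ 3 * (δ / 3) := by gcongr
    _ ≤ δ := ENNReal.mul_div_le

/-! ### Frostman's lemma -/

/-- The mass of a dyadic interval when the mass of each interval is split between its two halves
proportionally to `c`. -/
noncomputable def splitMass (c : Dyadic → ℝ≥0∞) : (n : ℕ) → Fin (2 ^ n) → ℝ≥0∞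
  | 0, k => c ⟨0, k⟩
  | n + 1, k => splitMass c n (parent k) *
      (c ⟨n + 1, k⟩ / ∑ i, c (child ⟨n, parent k⟩ i))

theorem splitMass_le {c : Dyadic → ℝ≥0∞} (hc : ∀ I, c I ≤ ∑ i, c (child I i)) (n : ℕ)
    (k : Fin (2 ^ n)) : splitMass c n k ≤ c ⟨n, k⟩ := by
  induction n with
  | zero => exact le_rfl
  | succ n ih =>
    calc splitMass c (n + 1) k
        ≤ (∑ i, c (child ⟨n, parent k⟩ i)) *
          (c ⟨n + 1, k⟩ / ∑ i, c (child ⟨n, parent k⟩ i)) :=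
          mul_le_mul_left ((ih _).trans (hc _)) _
      _ ≤ c ⟨n + 1, k⟩ := ENNReal.mul_div_le

theorem splitMass_eq_sum {c : Dyadic → ℝ≥0∞} (hc : ∀ I, c I ≤ ∑ i, c (child I i))
    (hfin : ∀ I, c I ≠ ∞) (n : ℕ) (k : Fin (2 ^ n)) :
    splitMass c n k = ∑ i, splitMass c (n + 1) (childIdx k i) := by
  have h : ∀ i, splitMass c (n + 1) (childIdx k i) =
      splitMass c n k * (c (child ⟨n, k⟩ i) / ∑ i, c (child ⟨n, k⟩ i)) := by
    intro i
    rw [splitMass, parent_childIdx]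
  simp only [h]
  rw [← Finset.mul_sum]
  simp only [div_eq_mul_inv]
  rw [← Finset.sum_mul]
  -- With a zero denominator both quotients are `0 / 0 = 0`, but subadditivity then forces the
  -- interval itself to have mass zero.
  by_cases h0 : ∑ i, c (child ⟨n, k⟩ i) = 0
  · have : splitMass c n k = 0 :=
      le_antisymm ((splitMass_le hc n k).trans ((hc _).trans h0.le)) zero_le
    rw [this, zero_mul]
  · rw [ENNReal.mul_inv_cancel h0 (ENNReal.sum_ne_top.2 fun i _ => hfin _), mul_one]

/-- Frostman's lemma on the dyadic tree. -/
theorem exists_frostman (r : ℝ≥0∞) (K : Set unitInterval) : ∃ b : Dyadic → ℝ≥0∞,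
    (∀ I, b I = ∑ i, b (child I i)) ∧ (∀ I, b I ≤ r ^ I.1) ∧
    (∀ I, K ∩ cell I = ∅ → b I = 0) ∧ b ⟨0, 0⟩ = netContent r K := by
  -- The content of the part of `K` in a cell is subadditive and at most `rⁿ`; splitting the mass in
  -- proportion to it keeps the mass below it at every level.
  let c : Dyadic → ℝ≥0∞ := fun I => netContent r (K ∩ cell I)
  have hc : ∀ I, c I ≤ ∑ i, c (child I i) := fun I => netContent_cell_le_sum K I
  refine ⟨fun I => splitMass c I.1 I.2,
    fun I => splitMass_eq_sum hc (fun I => netContent_ne_top _) I.1 I.2,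
    fun I => (splitMass_le hc I.1 I.2).trans (netContent_cell_le K I), fun I hI => ?_, ?_⟩
  · refine le_antisymm ((splitMass_le hc I.1 I.2).trans ?_) zero_le
    change netContent r (K ∩ cell I) ≤ 0
    rw [hI]
    exact (netContent_le_cost (C := ∅) fun x hx => absurd hx (Set.notMem_empty x)).trans
      (by simp [cost])
  · change netContent r (K ∩ cell ⟨0, 0⟩) = _
    rw [cell_root, Set.inter_univ]

end Cascade

/-! ### Net content and Hausdorff dimension -/

namespace Cascade

open scoped ENNReal NNReal

/-- A set with covers of arbitrarily small `s`-dimensional cost has Hausdorff dimension at most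
`s`. -/
theorem dimH_le_of_covers {X ι : Type*} [EMetricSpace X] [Countable ι] {A : Set X} {s : ℝ≥0}
    (hs : 0 < s) (E : ι → Set X)
    (h : ∀ ε : ℝ≥0∞, 0 < ε → ∃ C : Set ι, A ⊆ ⋃ i ∈ C, E i ∧
      ∑' i : C, Metric.ediam (E i) ^ (s : ℝ) ≤ ε) : dimH A ≤ s := by
  borelize X
  refine dimH_le_of_hausdorffMeasure_ne_top ?_
  have hs' : (0 : ℝ) < s := hs
  have hε : ∀ n : ℕ, (0 : ℝ≥0∞) < (n : ℝ≥0∞)⁻¹ := fun n => by simp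
  choose C hC hcost using fun n : ℕ => h _ (hε n)
  have hlim : Tendsto (fun n : ℕ => (n : ℝ≥0∞)⁻¹) atTop (𝓝 0) := ENNReal.tendsto_inv_nat_nhds_zero
  have hlim' : Tendsto (fun n : ℕ => ((n : ℝ≥0∞)⁻¹) ^ (s : ℝ)⁻¹) atTop (𝓝 0) := by
    have := (ENNReal.continuous_rpow_const (y := (s : ℝ)⁻¹)).tendsto 0 |>.comp hlim
    rwa [ENNReal.zero_rpow_of_pos (inv_pos.2 hs')] at this
  -- A single term is at most the whole sum, so a cover of cost `1 / n` has diameters at most `(1 /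
  -- n)^(1 / s)`: small cost already implies fine covers.
  have key := Measure.hausdorffMeasure_le_liminf_tsum (s : ℝ) A (l := atTop)
    (fun n : ℕ => ((n : ℝ≥0∞)⁻¹) ^ (s : ℝ)⁻¹) hlim' (fun n (i : C n) => E i)
    (Eventually.of_forall fun n i => by
      have := (ENNReal.le_tsum i).trans (hcost n)
      rw [ENNReal.le_rpow_inv_iff hs']
      exact this)
    (Eventually.of_forall fun n => by
      refine (hC n).trans (Set.iUnion₂_subset fun i hi => ?_)
      exact Set.subset_iUnion (fun i : C n => E i) ⟨i, hi⟩)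
  refine ne_top_of_le_ne_top ENNReal.one_ne_top (key.trans ?_)
  refine (liminf_le_liminf (Eventually.of_forall hcost)).trans ?_
  rw [hlim.liminf_eq]
  exact zero_le_one

/-- The ratio `2⁻ˢ` between the `s`-dimensional costs of consecutive levels. -/
noncomputable def ratio (s : ℝ) : ℝ≥0∞ := (2 : ℝ≥0∞)⁻¹ ^ s

theorem ratio_pow (s : ℝ) (n : ℕ) : ratio s ^ n = ((2 : ℝ≥0∞)⁻¹ ^ n) ^ s := by
  rw [ratio, ← ENNReal.rpow_natCast, ← ENNReal.rpow_mul, mul_comm, ENNReal.rpow_mul,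
    ENNReal.rpow_natCast]

theorem ofReal_inv_two_pow (n : ℕ) : ENNReal.ofReal ((2 : ℝ)⁻¹ ^ n) = (2 : ℝ≥0∞)⁻¹ ^ n := by
  rw [ENNReal.ofReal_pow (by norm_num), ENNReal.ofReal_inv_of_pos two_pos, ENNReal.ofReal_ofNat]

theorem ediam_cell_le (I : Dyadic) : Metric.ediam (cell I) ≤ (2 : ℝ≥0∞)⁻¹ ^ I.1 := by
  refine Metric.ediam_le fun x hx y hy => ?_
  obtain ⟨h1, h2⟩ := cell_subset_Icc hx
  obtain ⟨h3, h4⟩ := cell_subset_Icc hy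
  rw [edist_dist, ← ofReal_inv_two_pow]
  refine ENNReal.ofReal_le_ofReal ?_
  rw [Subtype.dist_eq, Real.dist_eq, abs_le]
  have e : ((I.2 : ℝ) + 1) / 2 ^ I.1 = (I.2 : ℝ) / 2 ^ I.1 + (2 : ℝ)⁻¹ ^ I.1 := by
    rw [add_div, inv_pow, one_div]
  constructor <;> linarith

theorem dimH_le_of_netContent_eq_zero {K : Set unitInterval} {s : ℝ≥0} (hs : 0 < s)
    (h : netContent (ratio s) K = 0) : dimH K ≤ s := by
  refine dimH_le_of_covers hs cell fun ε hε => ?_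
  obtain ⟨C, hC, hcost⟩ := exists_covers_cost_lt (h.trans_lt hε)
  refine ⟨C, fun x hx => ?_, ?_⟩
  · obtain ⟨I, hI, hxI⟩ := hC x hx
    exact Set.mem_iUnion₂.2 ⟨I, hI, hxI⟩
  · refine le_trans (ENNReal.tsum_le_tsum fun I => ?_)
      ((cost_eq_tsum_subtype _ C).symm.le.trans hcost.le)
    rw [ratio_pow]
    exact ENNReal.rpow_le_rpow (ediam_cell_le _) s.2

/-- A set of diameter `d` is to be replaced by dyadic intervals of length at least `d` and less than
`2 d`. No such length exists for `d = 0`; the cost is then absorbed by `δ`. -/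
theorem exists_level {s : ℝ} (hs : 0 < s) {d : ℝ≥0∞} (hd : d ≤ 1) {δ : ℝ≥0∞} (hδ : 0 < δ) :
    ∃ n : ℕ, d ≤ (2 : ℝ≥0∞)⁻¹ ^ n ∧ ratio s ^ n ≤ 2 ^ s * d ^ s + δ := by
  have hlim : Tendsto (fun n : ℕ => (2 : ℝ≥0∞)⁻¹ ^ n) atTop (𝓝 0) :=
    ENNReal.tendsto_pow_atTop_nhds_zero_of_lt_one (by simp)
  rcases eq_or_ne d 0 with rfl | h0
  · have hlim' : Tendsto (fun n : ℕ => ((2 : ℝ≥0∞)⁻¹ ^ n) ^ s) atTop (𝓝 0) := by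
      have := (ENNReal.continuous_rpow_const (y := s)).tendsto 0 |>.comp hlim
      rwa [ENNReal.zero_rpow_of_pos hs] at this
    obtain ⟨n, hn⟩ := (hlim'.eventually (gt_mem_nhds hδ)).exists
    refine ⟨n, zero_le, ?_⟩
    rw [ratio_pow]
    exact hn.le.trans le_add_self
  · classical
    have hex : ∃ n : ℕ, (2 : ℝ≥0∞)⁻¹ ^ n < d :=
      (hlim.eventually (gt_mem_nhds (pos_iff_ne_zero.2 h0))).exists
    have h1 := Nat.find_spec hex
    obtain ⟨n, hn⟩ : ∃ n, Nat.find hex = n + 1 := by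
      refine Nat.exists_eq_succ_of_ne_zero fun h => ?_
      rw [h, pow_zero] at h1
      exact absurd hd (not_le.2 h1)
    refine ⟨n, not_lt.1 (Nat.find_min hex (by omega)), le_add_right ?_⟩
    rw [ratio_pow, ← ENNReal.mul_rpow_of_nonneg _ _ hs.le]
    refine ENNReal.rpow_le_rpow ?_ hs.le
    rw [hn, pow_succ] at h1
    calc (2 : ℝ≥0∞)⁻¹ ^ n = 2 * ((2 : ℝ≥0∞)⁻¹ ^ n * 2⁻¹) := by
          rw [mul_comm, mul_assoc, ENNReal.inv_mul_cancel (by simp) (by simp), mul_one]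
      _ ≤ 2 * d := by gcongr

/-- The `s`-dimensional Hausdorff measure vanishes, so there are covers by arbitrary sets with a
small sum. Each nonempty set of such a cover lies in the three dyadic intervals, of comparable
length, around one of its points. -/
theorem netContent_eq_zero_of_dimH_lt {K : Set unitInterval} {s : ℝ≥0} (h : dimH K < s) :
    netContent (ratio s) K = 0 := by
  have hs : (0 : ℝ) < s := by
    have : (0 : ℝ≥0∞) < s := lt_of_le_of_lt zero_le h
    exact_mod_cast this
  have hμ := hausdorffMeasure_of_dimH_lt h
  rw [Measure.hausdorffMeasure_apply] at hμ
  have hμ1 := le_antisymm ((le_iSup₂ (1 : ℝ≥0∞) one_pos).trans hμ.le) zero_le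
  refine le_antisymm (ENNReal.le_of_forall_pos_le_add fun ε hε _ => ?_) zero_le
  rw [zero_add]
  have hc : (3 * (2 : ℝ≥0∞) ^ (s : ℝ)) ≠ ∞ :=
    ENNReal.mul_ne_top (by simp) (ENNReal.rpow_ne_top_of_nonneg hs.le (by simp))
  -- One half of `ε` is spent on the sum of the powers of the diameters, the other on the errors of
  -- `exists_level`.
  have hpos : (0 : ℝ≥0∞) < ε / 2 / (3 * (2 : ℝ≥0∞) ^ (s : ℝ)) :=
    ENNReal.div_pos (by simpa using hε.ne') hc
  obtain ⟨t, ht⟩ := iInf_lt_iff.1 (hμ1.trans_lt hpos)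
  obtain ⟨hcov, ht⟩ := iInf_lt_iff.1 ht
  obtain ⟨hdiam, ht⟩ := iInf_lt_iff.1 ht
  obtain ⟨ε', hε', hsum⟩ := ENNReal.exists_pos_sum_of_countable'
    (ENNReal.div_pos (a := (ε : ℝ≥0∞) / 2) (b := 3) (by simpa using hε.ne') (by simp)).ne' ℕ
  let S : Set ℕ := {i | (t i).Nonempty}
  choose n hn1 hn2 using fun i => exists_level hs (hdiam i) (hε' i)
  choose e he using fun i : S => i.2
  calc netContent (ratio s) K
      ≤ ∑' p : S × Fin 3, ratio s ^ (neighbour ⟨n p.1, idx (n p.1) (e p.1)⟩ p.2).1 := by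
        refine netContent_le_tsum _ fun y hy => ?_
        obtain ⟨i, hi⟩ := Set.mem_iUnion.1 (hcov hy)
        let i' : S := ⟨i, y, hi⟩
        have hdist : |(y : ℝ) - e i'| ≤ (2 : ℝ)⁻¹ ^ n i := by
          have h1 : edist y (e i') ≤ (2 : ℝ≥0∞)⁻¹ ^ n i :=
            (Metric.edist_le_ediam_of_mem hi (he i')).trans (hn1 i)
          rw [edist_dist, ← ofReal_inv_two_pow, ENNReal.ofReal_le_ofReal_iff (by positivity),
            Subtype.dist_eq, Real.dist_eq] at h1
          exact h1
        obtain ⟨h1, h2⟩ := abs_le.1 hdist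
        obtain ⟨h3, h4⟩ := cell_subset_Icc (mem_cell_idx (n i) (e i'))
        have hp : (0 : ℝ) < (2 : ℝ)⁻¹ ^ n i := by positivity
        have hnb : ∃ j, y ∈ cell (neighbour ⟨n i, idx (n i) (e i')⟩ j) := by
          refine exists_mem_cell_neighbour ?_ ?_
          · rcases Nat.eq_zero_or_pos (idx (n i) (e i') : ℕ) with h0 | h0
            · simp only [h0, Nat.cast_zero, zero_sub]
              exact lt_of_lt_of_le (div_neg_of_neg_of_pos (by norm_num) (by positivity)) y.2.1
            · have hlt : ((idx (n i) (e i') : ℕ) : ℝ) / 2 ^ n i < (e i' : ℝ) := by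
                rw [idx_val] at h0 ⊢
                rw [div_lt_iff₀ (by positivity), mul_comm (e i' : ℝ), ← Nat.lt_ceil]
                omega
              simp only [sub_div]
              rw [inv_pow, ← one_div] at h1
              linarith
          · simp only at h4 ⊢
            rw [inv_pow, ← one_div] at h2
            rw [add_div] at h4 ⊢
            have : (2 : ℝ) / 2 ^ n i = 1 / 2 ^ n i + 1 / 2 ^ n i := by ring
            linarith
        obtain ⟨j, hj⟩ := hnb
        exact ⟨(i', j), hj⟩
    _ = ∑' i : S, 3 * ratio s ^ n i := by
        rw [ENNReal.tsum_prod']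
        exact tsum_congr fun i => by simp [neighbour]
    _ ≤ ∑' i : S, (3 * 2 ^ (s : ℝ) * (⨆ _ : (t i).Nonempty, Metric.ediam (t i) ^ (s : ℝ))
          + 3 * ε' i) := by
        refine ENNReal.tsum_le_tsum fun i => ?_
        rw [ciSup_pos (show (t i).Nonempty from i.2), mul_assoc, ← mul_add]
        gcongr
        exact hn2 i
    _ ≤ ∑' i, (3 * 2 ^ (s : ℝ) * (⨆ _ : (t i).Nonempty, Metric.ediam (t i) ^ (s : ℝ))
          + 3 * ε' i) := ENNReal.tsum_comp_le_tsum_of_injective Subtype.val_injective _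
    _ = 3 * 2 ^ (s : ℝ) * (∑' i, ⨆ _ : (t i).Nonempty, Metric.ediam (t i) ^ (s : ℝ)) +
          3 * ∑' i, ε' i := by rw [ENNReal.tsum_add, ENNReal.tsum_mul_left, ENNReal.tsum_mul_left]
    _ ≤ 3 * 2 ^ (s : ℝ) * (ε / 2 / (3 * 2 ^ (s : ℝ))) + 3 * (ε / 2 / 3) := by gcongr
    _ ≤ ε / 2 + ε / 2 := add_le_add ENNReal.mul_div_le ENNReal.mul_div_le
    _ = ε := ENNReal.add_halves _

/-- A set of dimension larger than `s` carries, inside a compact subset, a positive additive mass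
distribution whose mass on dyadic intervals of length `2⁻ⁿ` is at most `2⁻ⁿˢ`. -/
theorem exists_frostman_of_lt_dimH {K : Set unitInterval} (hK : AnalyticSet K) {s : ℝ≥0}
    (hs : 0 < s) (h : s < dimH K) : ∃ K' ⊆ K, IsCompact K' ∧ ∃ b : Dyadic → ℝ≥0∞,
    (∀ I, b I = ∑ i, b (child I i)) ∧ (∀ I, b I ≤ ratio s ^ I.1) ∧
    (∀ I, K' ∩ cell I = ∅ → b I = 0) ∧ b ⟨0, 0⟩ ≠ 0 := by
  have h0 : netContent (ratio s) K ≠ 0 := fun h0 =>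
    absurd (dimH_le_of_netContent_eq_zero hs h0) (not_le.2 h)
  obtain ⟨K', hK', hcomp, hne⟩ := exists_isCompact_subset_netContent_ne_zero hK h0
  obtain ⟨b, h1, h2, h3, h4⟩ := exists_frostman (ratio s) K'
  exact ⟨K', hK', hcomp, b, h1, h2, h3, h4 ▸ hne⟩

end Cascade

namespace Cascade

open scoped ENNReal NNReal

/-! ### Measures with prescribed masses of dyadic intervals -/

section MassDistribution

variable {m : Dyadic → ℝ}

/-- The total mass of the first `j` dyadic intervals of level `n`. -/
noncomputable def partialMass (m : Dyadic → ℝ) (n j : ℕ) : ℝ :=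
  ∑ i ∈ Finset.range j, if h : i < 2 ^ n then m ⟨n, i, h⟩ else 0

theorem partialMass_mono (hm : ∀ I, 0 ≤ m I) (n : ℕ) : Monotone (partialMass m n) := by
  intro i j hij
  refine Finset.sum_le_sum_of_subset_of_nonneg (Finset.range_mono hij) fun k _ _ => ?_
  split_ifs
  exacts [hm _, le_rfl]

theorem partialMass_succ_two_mul (hadd : ∀ I, m I = ∑ i, m (child I i)) (n j : ℕ) :
    partialMass m (n + 1) (2 * j) = partialMass m n j := by
  induction j with
  | zero => simp [partialMass]
  | succ j ih =>
    have e : 2 * (j + 1) = 2 * j + 1 + 1 := by ring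
    rw [e, partialMass, Finset.sum_range_succ, Finset.sum_range_succ, ← partialMass, ih,
      partialMass, partialMass, Finset.sum_range_succ, add_assoc]
    congr 1
    have hp := pow_succ 2 n
    by_cases h : j < 2 ^ n
    · rw [dif_pos (by omega), dif_pos (by omega), dif_pos h, hadd ⟨n, j, h⟩, Fin.sum_univ_two]
      congr 2 <;> exact Dyadic.ext_val rfl (by simp)
    · rw [dif_neg (by omega), dif_neg (by omega), dif_neg h, add_zero]

/-- An upper approximation to the distribution function of a mass distribution. -/
noncomputable def upperCdf (m : Dyadic → ℝ) (n : ℕ) (x : unitInterval) : ℝ :=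
  partialMass m n (idx n x + 1)

theorem upperCdf_succ_le (hm : ∀ I, 0 ≤ m I) (hadd : ∀ I, m I = ∑ i, m (child I i)) (n : ℕ)
    (x : unitInterval) : upperCdf m (n + 1) x ≤ upperCdf m n x := by
  rw [upperCdf, upperCdf, ← partialMass_succ_two_mul hadd n]
  refine partialMass_mono hm _ ?_
  rw [← parent_idx n x, parent_val]
  omega

/-- The lower approximations increase with the level and the upper ones decrease, so any two are
compared at the larger level. -/
theorem le_upperCdf (hm : ∀ I, 0 ≤ m I) (hadd : ∀ I, m I = ∑ i, m (child I i)) (n N : ℕ)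
    (x : unitInterval) : partialMass m n (idx n x) ≤ upperCdf m N x := by
  have hl : Monotone fun n => partialMass m n (idx n x) := by
    refine monotone_nat_of_le_succ fun n => ?_
    rw [← partialMass_succ_two_mul hadd]
    refine partialMass_mono hm _ ?_
    rw [← parent_idx, parent_val]
    omega
  have hu : Antitone fun n => upperCdf m n x :=
    antitone_nat_of_succ_le fun n => upperCdf_succ_le hm hadd n x
  calc partialMass m n (idx n x) ≤ partialMass m (max n N) (idx (max n N) x) :=
        hl (le_max_left n N)
    _ ≤ upperCdf m (max n N) x := partialMass_mono hm _ (Nat.le_succ _)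
    _ ≤ upperCdf m N x := hu (le_max_right n N)

theorem partialMass_nonneg (hm : ∀ I, 0 ≤ m I) (n j : ℕ) : 0 ≤ partialMass m n j :=
  Finset.sum_nonneg fun k _ => by split_ifs; exacts [hm _, le_rfl]

theorem bddBelow_upperCdf (hm : ∀ I, 0 ≤ m I) (x : unitInterval) :
    BddBelow (Set.range fun n => upperCdf m n x) := by
  refine ⟨0, ?_⟩
  rintro _ ⟨n, rfl⟩
  exact partialMass_nonneg hm _ _

/-- The point `k 2⁻ⁿ` of `[0,1]`. -/
noncomputable def gridPoint (n k : ℕ) (h : k ≤ 2 ^ n) : unitInterval :=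
  ⟨(k : ℝ) / 2 ^ n, by positivity, by
    rw [div_le_one (by positivity)]; exact_mod_cast h⟩

theorem idx_gridPoint_val (n k : ℕ) (h : k ≤ 2 ^ n) : (idx n (gridPoint n k h) : ℕ) = k - 1 := by
  rw [idx_val, gridPoint]
  simp only
  rw [mul_div_cancel₀ _ (by positivity), Nat.ceil_natCast]

theorem gridPoint_succ (n k : ℕ) (h : k ≤ 2 ^ n) :
    gridPoint n k h = gridPoint (n + 1) (2 * k) (by rw [pow_succ]; omega) := by
  apply Subtype.ext
  simp only [gridPoint]
  push_cast
  rw [pow_succ, mul_comm (2 ^ n : ℝ), mul_div_mul_left _ _ two_ne_zero]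

theorem upperCdf_gridPoint (hadd : ∀ I, m I = ∑ i, m (child I i)) (d : ℕ) :
    ∀ (n k : ℕ) (h : k ≤ 2 ^ n), 1 ≤ k → upperCdf m (n + d) (gridPoint n k h) =
      partialMass m n k := by
  induction d with
  | zero =>
    intro n k h hk
    rw [Nat.add_zero, upperCdf, idx_gridPoint_val, Nat.sub_add_cancel hk]
  | succ d ih =>
    intro n k h hk
    rw [gridPoint_succ, ← partialMass_succ_two_mul hadd, ← ih (n + 1) (2 * k) (by rw [pow_succ]; omega) (by omega)]
    congr 1
    omega

/-- An additive nonnegative mass distribution on dyadic intervals whose masses tend to zero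
uniformly is given by a finite measure without atoms. -/
theorem exists_measure_cell_eq {m : Dyadic → ℝ≥0∞} (hadd : ∀ I, m I = ∑ i, m (child I i))
    (hfin : ∀ I, m I ≠ ∞) (hlim : ∀ ε : ℝ≥0∞, 0 < ε → ∃ n, ∀ k, m ⟨n, k⟩ ≤ ε) :
    ∃ ν : Measure unitInterval, IsFiniteMeasure ν ∧ NullSingletonClass ν ∧ ∀ I, ν (cell I) = m I := by
  let M : Dyadic → ℝ := fun I => (m I).toReal
  have hM : ∀ I, 0 ≤ M I := fun I => ENNReal.toReal_nonneg
  have hMadd : ∀ I, M I = ∑ i, M (child I i) := fun I => by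
    simp only [M]
    rw [hadd, ENNReal.toReal_sum fun i _ => hfin _]
  have hMlim : ∀ ε : ℝ, 0 < ε → ∃ n, ∀ k, M ⟨n, k⟩ ≤ ε := fun ε hε => by
    obtain ⟨n, hn⟩ := hlim _ (ENNReal.ofReal_pos.2 hε)
    exact ⟨n, fun k => ENNReal.toReal_le_of_le_ofReal hε.le (hn k)⟩
  let F : unitInterval → ℝ := fun x => ⨅ n, upperCdf M n x
  have hFu : ∀ n x, F x ≤ upperCdf M n x := fun n x => ciInf_le (bddBelow_upperCdf hM x) n
  have hFl : ∀ n x, partialMass M n (idx n x) ≤ F x := fun n x =>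
    le_ciInf fun N => le_upperCdf hM hMadd n N x
  have hFmono : Monotone F := fun x y hxy =>
    ciInf_mono (bddBelow_upperCdf hM x) fun n => partialMass_mono hM n
      (Nat.succ_le_succ (idx_mono n hxy))
  -- A move to the right by less than `2⁻ⁿ` advances the index by at most one, so `F` grows by at
  -- most the masses of two intervals of level `n`.
  have hFcont : ∀ x, ContinuousWithinAt F (Set.Ici x) x := by
    intro x
    rw [Metric.continuousWithinAt_iff]
    intro ε hε
    obtain ⟨n, hn⟩ := hMlim (ε / 3) (by positivity)
    refine ⟨(2 : ℝ)⁻¹ ^ n, by positivity, fun y hy hd => ?_⟩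
    have hy : x ≤ y := hy
    rw [Subtype.dist_eq, Real.dist_eq] at hd
    have hd := (abs_lt.1 hd).2
    rw [Real.dist_eq, abs_of_nonneg (sub_nonneg.2 (hFmono hy))]
    have hidx : (idx n y : ℕ) ≤ idx n x + 1 := by
      rw [idx_val, idx_val]
      have : ⌈2 ^ n * (y : ℝ)⌉₊ ≤ ⌈2 ^ n * (x : ℝ)⌉₊ + 1 := by
        refine Nat.ceil_le.2 ?_
        push_cast
        have h1 := Nat.le_ceil (2 ^ n * (x : ℝ))
        have h2 : (2 : ℝ) ^ n * ((y : ℝ) - x) ≤ 2 ^ n * (2 : ℝ)⁻¹ ^ n := by gcongr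
        rw [← mul_pow, mul_inv_cancel₀ two_ne_zero, one_pow] at h2
        linarith
      omega
    have hterm : ∀ i, (if h : i < 2 ^ n then M ⟨n, i, h⟩ else 0) ≤ ε / 3 := fun i => by
      split_ifs
      exacts [hn _, by positivity]
    have h1 : upperCdf M n y ≤ partialMass M n (idx n x + 1 + 1) :=
      partialMass_mono hM n (by omega)
    rw [partialMass, Finset.sum_range_succ, Finset.sum_range_succ, ← partialMass] at h1
    linarith [hFu n y, hFl n x, hterm (idx n x), hterm (idx n x + 1)]
  let S : StieltjesFunction unitInterval := ⟨F, hFmono, hFcont⟩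
  have hgrid : ∀ n k h, F (gridPoint n k h) = partialMass M n k := by
    intro n k h
    rcases Nat.eq_zero_or_pos k with rfl | hk
    · refine le_antisymm (le_of_forall_pos_le_add fun ε hε => ?_) ?_
      · obtain ⟨N, hN⟩ := hMlim ε hε
        refine (hFu N _).trans ?_
        have e : gridPoint n 0 h = gridPoint N 0 (by positivity) := by simp [gridPoint]
        rw [e, upperCdf, idx_gridPoint_val, partialMass, partialMass]
        simp only [zero_tsub, zero_add, Finset.range_one, Finset.sum_singleton, Finset.range_zero,
          Finset.sum_empty]
        split_ifs
        exacts [hN _, hε.le]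
      · exact le_ciInf fun N => by
          simp only [partialMass, Finset.range_zero, Finset.sum_empty]
          exact partialMass_nonneg hM _ _
    · refine le_antisymm ?_ (le_ciInf fun N => ?_)
      · exact (hFu n _).trans (upperCdf_gridPoint hMadd 0 n k h hk).le
      · rw [← upperCdf_gridPoint hMadd N n k h hk]
        exact antitone_nat_of_succ_le (f := fun N => upperCdf M N (gridPoint n k h))
          (fun N => upperCdf_succ_le hM hMadd N _) (Nat.le_add_left N n)
  -- The leftmost cell contains `0` and is not a half-open interval `Ioc`. The Stieltjes measure
  -- does not charge the least point, so the two agree up to a null set.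
  have hbot : S.measure {0} = 0 := by
    rw [← botSet_eq_singleton_of_isBot (x := (0 : unitInterval))
      fun x => x.2.1]
    exact S.measure_botSet
  have hcell : ∀ I, S.measure (cell I) = m I := by
    rintro ⟨n, k⟩
    have hk : (k : ℕ) + 1 ≤ 2 ^ n := k.2
    have hlast : F (gridPoint n (k + 1) hk) - F (gridPoint n k (by omega)) = M ⟨n, k⟩ := by
      rw [hgrid, hgrid, partialMass, Finset.sum_range_succ, ← partialMass, add_sub_cancel_left,
        dif_pos k.2]
    have hae : (cell ⟨n, k⟩ : Set unitInterval) =ᵐ[S.measure]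
        Set.Ioc (gridPoint n k (by omega)) (gridPoint n (k + 1) hk) := by
      have h0 : ∀ᵐ x ∂S.measure, x ≠ 0 := by
        rw [ae_iff]; simpa using hbot
      filter_upwards [h0] with x hx
      refine propext ⟨fun h => ?_, fun h => ?_⟩
      · obtain ⟨h1, h2⟩ := cell_subset_Icc h
        refine ⟨?_, ?_⟩
        · rw [← Subtype.coe_lt_coe]
          change (k : ℝ) / 2 ^ n < x
          have hxpos : (0 : ℝ) < x := lt_of_le_of_ne x.2.1 fun e => hx (Subtype.ext e.symm)
          rw [div_lt_iff₀ (by positivity), mul_comm (x : ℝ), ← Nat.lt_ceil]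
          have hv := mem_cell_iff_val.1 h
          rw [idx_val] at hv
          simp only at hv
          have : 0 < ⌈2 ^ n * (x : ℝ)⌉₊ := Nat.ceil_pos.2 (by positivity)
          omega
        · rw [← Subtype.coe_le_coe]
          change (x : ℝ) ≤ ((k + 1 : ℕ) : ℝ) / 2 ^ n
          push_cast
          exact h2
      · refine mem_cell_of_lt (Subtype.coe_lt_coe.2 h.1) ?_
        have := Subtype.coe_le_coe.2 h.2
        simp only [gridPoint] at this
        push_cast at this
        exact this
    rw [measure_congr hae, StieltjesFunction.measure_Ioc]
    change ENNReal.ofReal (F _ - F _) = _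
    rw [hlast, ENNReal.ofReal_toReal (hfin _)]
  refine ⟨S.measure, ⟨?_⟩, ⟨fun x => ?_⟩, hcell⟩
  · rw [← cell_root, hcell]
    exact (hfin _).lt_top
  · refine le_antisymm (le_of_forall_pos_le_add fun ε hε => ?_) zero_le
    obtain ⟨n, hn⟩ := hlim ε hε
    rw [zero_add]
    exact (measure_mono (Set.singleton_subset_iff.2 (mem_cell_idx n x))).trans
      ((hcell _).le.trans (hn _))

end MassDistribution

/-! ### Weak convergence from convergence of the masses of dyadic intervals -/

theorem iUnion_cell (n : ℕ) : ⋃ k : Fin (2 ^ n), cell ⟨n, k⟩ = Set.univ :=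
  Set.eq_univ_of_forall fun x => Set.mem_iUnion.2 ⟨idx n x, mem_cell_idx n x⟩

theorem abs_integral_sub_sum_le (μ : Measure unitInterval) [IsFiniteMeasure μ]
    (f : BoundedContinuousFunction unitInterval ℝ) {ε : ℝ} {n : ℕ} {y : Fin (2 ^ n) → unitInterval}
    (hf : ∀ k, ∀ x ∈ cell ⟨n, k⟩, |f x - f (y k)| ≤ ε) :
    |∫ x, f x ∂μ - ∑ k, f (y k) * μ.real (cell ⟨n, k⟩)| ≤ ε * μ.real Set.univ := by
  have hdisj : Pairwise (Function.onFun Disjoint fun k : Fin (2 ^ n) => cell ⟨n, k⟩) :=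
    fun k l hkl => disjoint_cell rfl fun h => hkl (by simpa using h)
  have hmeas : ∀ k : Fin (2 ^ n), MeasurableSet (cell ⟨n, k⟩) := fun k => measurableSet_cell _
  have hint : Integrable f μ := f.integrable μ
  rw [← setIntegral_univ, ← iUnion_cell n, integral_iUnion_fintype hmeas hdisj
    fun k => hint.integrableOn, ← Finset.sum_sub_distrib, measureReal_def,
    measure_iUnion hdisj hmeas, tsum_fintype, ENNReal.toReal_sum fun k _ => measure_ne_top _ _,
    Finset.mul_sum]
  refine (Finset.abs_sum_le_sum_abs _ _).trans (Finset.sum_le_sum fun k _ => ?_)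
  have e : f (y k) * μ.real (cell ⟨n, k⟩) = ∫ x in cell ⟨n, k⟩, f (y k) ∂μ := by
    rw [setIntegral_const, smul_eq_mul, mul_comm]
  rw [e, ← integral_sub hint.integrableOn (integrable_const _)]
  exact norm_setIntegral_le_of_norm_le_const (f := fun x => f x - f (y k))
    (measure_lt_top μ (cell ⟨n, k⟩)) (hf k)

/-- A continuous function on `[0,1]` is nearly constant on the cells of a fine level, so its
integrals are uniformly close to finite combinations of cell masses. -/
theorem tendsto_of_tendsto_cell {μs : ℕ → FiniteMeasure unitInterval}
    {μ : FiniteMeasure unitInterval}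
    (h : ∀ I, Tendsto (fun n => (μs n : Measure unitInterval) (cell I)) atTop
      (𝓝 ((μ : Measure unitInterval) (cell I)))) : Tendsto μs atTop (𝓝 μ) := by
  rw [FiniteMeasure.tendsto_iff_forall_integral_tendsto]
  intro f
  have h' : ∀ I, Tendsto (fun n => (μs n : Measure unitInterval).real (cell I)) atTop
      (𝓝 ((μ : Measure unitInterval).real (cell I))) := fun I =>
    (ENNReal.tendsto_toReal (measure_ne_top _ _)).comp (h I)
  rw [Metric.tendsto_atTop']
  intro ε hε
  set T : ℝ := (μ : Measure unitInterval).real Set.univ with hT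
  have hT0 : 0 ≤ T := measureReal_nonneg
  -- The errors are at most `η (T + 1)` and `η T` for the two integrals and less than `η` for the
  -- sums, in total less than `ε`.
  let η : ℝ := ε / (2 * T + 3)
  have hη : 0 < η := by positivity
  have hunif : UniformContinuous f := CompactSpace.uniformContinuous_of_continuous f.continuous
  obtain ⟨δ, hδ, hfδ⟩ := Metric.uniformContinuous_iff.1 hunif η hη
  obtain ⟨n, hn⟩ := exists_pow_lt_of_lt_one hδ (by norm_num : (2 : ℝ)⁻¹ < 1)
  let y : Fin (2 ^ n) → unitInterval := fun k => gridPoint n (k + 1) k.2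
  have hy : ∀ k, ∀ x ∈ cell ⟨n, k⟩, |f x - f (y k)| ≤ η := by
    intro k x hx
    refine (hfδ (lt_of_le_of_lt ?_ hn)).le
    obtain ⟨h1, h2⟩ := cell_subset_Icc hx
    rw [Subtype.dist_eq, Real.dist_eq, abs_le]
    have e : ((y k : unitInterval) : ℝ) = (k : ℝ) / 2 ^ n + (2 : ℝ)⁻¹ ^ n := by
      simp only [y, gridPoint]
      push_cast
      rw [add_div, inv_pow, one_div]
    have hp : (0 : ℝ) < (2 : ℝ)⁻¹ ^ n := by positivity
    have e' : ((k : ℝ) + 1) / 2 ^ n = (k : ℝ) / 2 ^ n + (2 : ℝ)⁻¹ ^ n := by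
      rw [add_div, inv_pow, one_div]
    simp only at h1 h2
    constructor <;> linarith
  have hsum : Tendsto (fun N => ∑ k, f (y k) * (μs N : Measure unitInterval).real (cell ⟨n, k⟩))
      atTop (𝓝 (∑ k, f (y k) * (μ : Measure unitInterval).real (cell ⟨n, k⟩))) :=
    tendsto_finsetSum _ fun k _ => (h' _).const_mul _
  have huniv : Tendsto (fun N => (μs N : Measure unitInterval).real Set.univ) atTop (𝓝 T) := by
    have := h' ⟨0, 0⟩
    rwa [cell_root] at this
  obtain ⟨N, hN⟩ := eventually_atTop.1 ((Metric.tendsto_nhds.1 hsum η hη).and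
    (huniv.eventually (gt_mem_nhds (lt_add_one T))))
  refine ⟨N, fun j hj => ?_⟩
  obtain ⟨h1, h2⟩ := hN j hj.le
  have h3 := abs_integral_sub_sum_le (μs j : Measure unitInterval) f hy
  have h4 := abs_integral_sub_sum_le (μ : Measure unitInterval) f hy
  rw [Real.dist_eq] at h1 ⊢
  have h5 : η * (μs j : Measure unitInterval).real Set.univ ≤ η * (T + 1) := by gcongr
  have h6 : η * (2 * T + 3) = ε := div_mul_cancel₀ _ (by positivity)
  rw [abs_le] at h3 h4
  rw [abs_lt] at h1 ⊢
  constructor <;> nlinarith [h3.1, h3.2, h4.1, h4.2, h1.1, h1.2]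

/-! ### Lower bounds for the dimension from energies -/

/-- On the set where the potential is at most `M`, the mass of a set `E` is at most a constant times
`diam(E)ᵗ`; the restriction of `η` to it is then dominated by a multiple of Hausdorff measure. -/
theorem le_dimH_of_energy {η : Measure ℝ} [IsFiniteMeasure η] {s : Set ℝ}
    (hηs : η sᶜ = 0) (hη : η ≠ 0) {t : ℝ≥0} (ht : 0 < t)
    (henergy : ∫⁻ x, ∫⁻ y, edist x y ^ (-(t : ℝ)) ∂η ∂η ≠ ∞) : t ≤ dimH s := by
  have ht' : (0 : ℝ) < t := ht
  have hmeas : Measurable fun p : ℝ × ℝ => edist p.1 p.2 ^ (-(t : ℝ)) :=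
    (measurable_edist).pow_const _
  let φ : ℝ → ℝ≥0∞ := fun x => ∫⁻ y, edist x y ^ (-(t : ℝ)) ∂η
  have hφ : Measurable φ := hmeas.lintegral_prod_right'
  have hfin : ∀ᵐ x ∂η, φ x < ∞ := ae_lt_top hφ henergy
  obtain ⟨M, hM⟩ : ∃ M : ℕ, η {x | φ x ≤ M} ≠ 0 := by
    by_contra! hcon
    have h0 : η (⋃ M : ℕ, {x | φ x ≤ M}) = 0 := measure_iUnion_null hcon
    refine hη (Measure.measure_univ_eq_zero.1 ?_)
    refine le_antisymm ?_ zero_le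
    rw [← h0]
    refine measure_mono_ae ?_
    filter_upwards [hfin] with x hx _
    obtain ⟨M, hM⟩ := ENNReal.exists_nat_gt hx.ne
    exact Set.mem_iUnion.2 ⟨M, hM.le⟩
  let B : Set ℝ := {x | φ x ≤ M}
  have hB : MeasurableSet B := measurableSet_le hφ measurable_const
  let c : ℝ≥0∞ := (M : ℝ≥0∞) + 1
  have hc0 : c ≠ 0 := by simp [c]
  have hctop : c ≠ ∞ := by simp [c]
  have hle : c⁻¹ • η.restrict B ≤ μH[(t : ℝ)] := by
    refine Measure.le_hausdorffMeasure _ _ 1 one_pos fun E hE => ?_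
    rw [Measure.smul_apply, smul_eq_mul, Measure.restrict_apply' hB]
    rcases (E ∩ B).eq_empty_or_nonempty with h | ⟨x, hxE, hxB⟩
    · simp [h]
    have hdtop : Metric.ediam E ≠ ∞ := ne_top_of_le_ne_top ENNReal.one_ne_top hE
    have h1 : Metric.ediam E ^ (-(t : ℝ)) * η E ≤ c := by
      calc Metric.ediam E ^ (-(t : ℝ)) * η E = ∫⁻ _ in E, Metric.ediam E ^ (-(t : ℝ)) ∂η := by
            rw [setLIntegral_const]
        _ ≤ ∫⁻ y in E, edist x y ^ (-(t : ℝ)) ∂η := by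
            refine setLIntegral_mono (hmeas.comp measurable_prodMk_left) fun y hy => ?_
            rw [ENNReal.rpow_neg, ENNReal.rpow_neg]
            exact ENNReal.inv_le_inv.2
              (ENNReal.rpow_le_rpow (Metric.edist_le_ediam_of_mem hxE hy) ht'.le)
        _ ≤ φ x := setLIntegral_le_lintegral _ _
        _ ≤ M := hxB
        _ ≤ c := le_self_add
    rw [mul_comm, ← div_eq_mul_inv]
    refine ENNReal.div_le_of_le_mul ?_
    refine (measure_mono Set.inter_subset_left).trans ?_
    rcases eq_or_ne (Metric.ediam E) 0 with h0 | h0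
    -- A set of diameter zero has `0 ^ (-t) = ∞`, so the bound forces its mass to vanish.
    · rw [h0, ENNReal.zero_rpow_of_neg (neg_neg_of_pos ht')] at h1
      by_contra hcon
      have hne : η E ≠ 0 := fun h => hcon (by rw [h]; exact zero_le)
      rw [ENNReal.top_mul hne, top_le_iff] at h1
      exact hctop h1
    · rw [ENNReal.rpow_neg, mul_comm, ← div_eq_mul_inv,
        ENNReal.div_le_iff (by simp [h0, hdtop]) (by simp [h0, hdtop])] at h1
      rwa [mul_comm]
  refine le_dimH_of_hausdorffMeasure_ne_zero fun h0 => ?_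
  have h1 := hle s
  rw [h0, Measure.smul_apply, smul_eq_mul, Measure.restrict_apply' hB] at h1
  have h2 : η (s ∩ B) = η B := by
    refine measure_congr ?_
    have : ∀ᵐ x ∂η, x ∈ s := by rw [ae_iff]; exact hηs
    filter_upwards [this] with x hx
    exact propext ⟨fun h => h.2, fun h => ⟨hx, h⟩⟩
  rw [h2] at h1
  exact (mul_ne_zero (ENNReal.inv_ne_zero.2 hctop) hM) (le_antisymm h1 zero_le)

end Cascade

namespace Cascade

open scoped ENNReal NNReal

/-! ### The distribution function of a measure without atoms -/

section Cdf

variable (μ : Measure unitInterval)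

theorem ordConnected_cell (I : Dyadic) : (cell I).OrdConnected := by
  refine ⟨fun x hx y hy z hz => ?_⟩
  rw [mem_cell_iff] at *
  exact le_antisymm (hy ▸ idx_mono _ hz.2) (hx ▸ idx_mono _ hz.1)

theorem cell_subset_Ioc {n : ℕ} {x y : unitInterval} {j : Fin (2 ^ n)} (h1 : idx n x < j)
    (h2 : j < idx n y) : cell ⟨n, j⟩ ⊆ Set.Ioc x y := by
  intro z hz
  have hz : idx n z = j := hz
  refine ⟨lt_of_not_ge fun h => ?_, le_of_not_gt fun h => ?_⟩
  · exact absurd (idx_mono n h) (not_le.2 (hz ▸ h1))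
  · exact absurd (idx_mono n h.le) (not_le.2 (hz ▸ h2))

/-- The position of the first dyadic gap between two points. -/
theorem exists_gap {x y : unitInterval} (h : x < y) :
    ∃ n, ∃ d : Fin 2, (idx n y : ℕ) = idx n x + 2 + d := by
  classical
  have hxy : (0 : ℝ) < (y : ℝ) - x := sub_pos.2 (Subtype.coe_lt_coe.2 h)
  have hex : ∃ n, (idx n x : ℕ) + 2 ≤ idx n y := by
    obtain ⟨n, hn⟩ := pow_unbounded_of_one_lt (3 / ((y : ℝ) - x)) one_lt_two
    refine ⟨n, ?_⟩
    rw [div_lt_iff₀ hxy] at hn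
    obtain ⟨-, h1⟩ := cell_subset_Icc (mem_cell_idx n y)
    have hp : (0 : ℝ) < 2 ^ n := by positivity
    simp only at h1
    rw [le_div_iff₀ hp] at h1
    have h2 := (cell_subset_Icc (mem_cell_idx n x)).1
    simp only at h2
    rw [div_le_iff₀ hp] at h2
    have : ((idx n x : ℕ) : ℝ) + 2 < (idx n y : ℕ) := by nlinarith
    exact_mod_cast this.le
  have hspec := Nat.find_spec hex
  obtain ⟨n, hn⟩ : ∃ n, Nat.find hex = n + 1 := by
    refine Nat.exists_eq_succ_of_ne_zero fun h0 => ?_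
    rw [h0] at hspec
    have := (idx 0 y).2
    omega
  -- One level above the first gap the two positions differ by at most one, hence by at most three
  -- at the gap; the offset beyond `2` is thus `0` or `1`.
  have hmin := Nat.find_min hex (m := n) (by omega)
  rw [hn] at hspec
  rw [← parent_idx n x, ← parent_idx n y, parent_val, parent_val] at hmin
  refine ⟨n + 1, ⟨idx (n + 1) y - (idx (n + 1) x + 2), by omega⟩, ?_⟩
  simp only
  omega

/-- The distribution function of a measure on `[0,1]`. -/
noncomputable def cdf (x : unitInterval) : ℝ := μ.real (Set.Iic x)

variable [IsFiniteMeasure μ]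

theorem cdf_sub_cdf {x y : unitInterval} (h : x ≤ y) :
    cdf μ y - cdf μ x = μ.real (Set.Ioc x y) := by
  rw [cdf, cdf, ← measureReal_sdiff (Set.Iic_subset_Iic.2 h) measurableSet_Iic]
  congr 1
  ext z
  simp [and_comm]

theorem cdf_mono : Monotone (cdf μ) := fun x y h => by
  rw [← sub_nonneg, cdf_sub_cdf μ h]
  exact measureReal_nonneg

theorem edist_cdf {x y : unitInterval} (h : x ≤ y) :
    edist (cdf μ x) (cdf μ y) = μ (Set.Ioc x y) := by
  rw [edist_dist, dist_comm, Real.dist_eq, cdf_sub_cdf μ h, abs_of_nonneg measureReal_nonneg,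
    measureReal_def, ENNReal.ofReal_toReal (measure_ne_top _ _)]

theorem dist_cdf [NullSingletonClass μ] (x y : unitInterval) :
    dist (cdf μ x) (cdf μ y) = μ.real (Set.uIcc x y) := by
  wlog h : x ≤ y generalizing x y
  · rw [dist_comm, Set.uIcc_comm]
    exact this y x (le_of_not_ge h)
  rw [Set.uIcc_of_le h, dist_edist, edist_cdf μ h, measureReal_def,
    measure_congr Ioc_ae_eq_Icc]

theorem cdf_injective (hpos : ∀ I, μ (cell I) ≠ 0) : Function.Injective (cdf μ) := by
  intro x y hxy
  wlog h : x < y generalizing x y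
  · rcases eq_or_lt_of_le (le_of_not_gt h) with h | h
    exacts [h.symm, (this hxy.symm h).symm]
  exfalso
  obtain ⟨n, d, hd⟩ := exists_gap h
  have hj : (idx n x : ℕ) + 1 < 2 ^ n := by have := (idx n y).2; omega
  have h1 : μ (cell ⟨n, _, hj⟩) ≤ μ (Set.Ioc x y) :=
    measure_mono (cell_subset_Ioc (by rw [Fin.lt_def]; exact Nat.lt_succ_self _)
      (by rw [Fin.lt_def]; simp only; omega))
  rw [← edist_cdf μ h.le, hxy, edist_self] at h1
  exact hpos _ (le_antisymm h1 zero_le)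

theorem ediam_cdf_image_cell_le (I : Dyadic) :
    Metric.ediam (cdf μ '' cell I) ≤ μ (cell I) := by
  refine Metric.ediam_le ?_
  rintro _ ⟨x, hx, rfl⟩ _ ⟨y, hy, rfl⟩
  wlog h : x ≤ y generalizing x y
  · rw [edist_comm]
    exact this y hy x hx (le_of_not_ge h)
  rw [edist_cdf μ h]
  exact measure_mono (Set.Ioc_subset_Icc_self.trans ((ordConnected_cell I).out hx hy))

end Cdf

/-! ### Energies as sums over gaps -/

/-- The product of values of three functions at a dyadic interval, at one two or three places to
its right and at its right neighbour. -/
noncomputable def gapTerm (f f' g : Dyadic → ℝ≥0∞) (n : ℕ) (a : Fin (2 ^ n)) (d : Fin 2) : ℝ≥0∞ :=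
  if h : (a : ℕ) + 2 + d < 2 ^ n then
    f ⟨n, a⟩ * f' ⟨n, _, h⟩ * g ⟨n, (a : ℕ) + 1, by omega⟩ else 0

/-- The sum of the products over all dyadic gaps. -/
noncomputable def gapSum (f f' g : Dyadic → ℝ≥0∞) : ℝ≥0∞ :=
  ∑' n, ∑ a, ∑ d, gapTerm f f' g n a d

theorem lintegral_lintegral_gapSum (ν : Measure unitInterval) (g : Dyadic → ℝ≥0∞) :
    ∫⁻ x, ∫⁻ y, gapSum (fun I => (cell I).indicator 1 x) (fun I => (cell I).indicator 1 y) g ∂ν ∂ν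
      = gapSum (fun I => ν (cell I)) (fun I => ν (cell I)) g := by
  have hind : ∀ I, Measurable fun y => (cell I).indicator (1 : unitInterval → ℝ≥0∞) y := fun I =>
    measurable_one.indicator (measurableSet_cell I)
  have hm1 : ∀ (f : Dyadic → ℝ≥0∞) n a d, Measurable fun y =>
      gapTerm f (fun I => (cell I).indicator 1 y) g n a d := by
    intro f n a d
    unfold gapTerm
    split_ifs
    · exact ((hind _).const_mul _).mul_const _
    · exact measurable_const
  have hm2 : ∀ (f : Dyadic → ℝ≥0∞) n a d, Measurable fun x =>
      gapTerm (fun I => (cell I).indicator 1 x) f g n a d := by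
    intro f n a d
    unfold gapTerm
    split_ifs
    · exact ((hind _).mul_const _).mul_const _
    · exact measurable_const
  have h1 : ∀ (f : Dyadic → ℝ≥0∞), ∫⁻ y, gapSum f (fun I => (cell I).indicator 1 y) g ∂ν =
      gapSum f (fun I => ν (cell I)) g := by
    intro f
    unfold gapSum
    rw [lintegral_tsum fun n => (Finset.measurable_fun_sum _ fun a _ =>
      Finset.measurable_fun_sum _ fun d _ => hm1 f n a d).aemeasurable]
    refine tsum_congr fun n => ?_
    rw [lintegral_finsetSum _ fun a _ => Finset.measurable_fun_sum _ fun d _ => hm1 f n a d]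
    refine Finset.sum_congr rfl fun a _ => ?_
    rw [lintegral_finsetSum _ fun d _ => hm1 f n a d]
    refine Finset.sum_congr rfl fun d _ => ?_
    unfold gapTerm
    split_ifs
    · rw [lintegral_mul_const _ ((hind _).const_mul _), lintegral_const_mul _ (hind _),
        lintegral_indicator_one (measurableSet_cell _)]
    · simp
  have h2 : ∀ (f : Dyadic → ℝ≥0∞), ∫⁻ x, gapSum (fun I => (cell I).indicator 1 x) f g ∂ν =
      gapSum (fun I => ν (cell I)) f g := by
    intro f
    unfold gapSum
    rw [lintegral_tsum fun n => (Finset.measurable_fun_sum _ fun a _ =>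
      Finset.measurable_fun_sum _ fun d _ => hm2 f n a d).aemeasurable]
    refine tsum_congr fun n => ?_
    rw [lintegral_finsetSum _ fun a _ => Finset.measurable_fun_sum _ fun d _ => hm2 f n a d]
    refine Finset.sum_congr rfl fun a _ => ?_
    rw [lintegral_finsetSum _ fun d _ => hm2 f n a d]
    refine Finset.sum_congr rfl fun d _ => ?_
    unfold gapTerm
    split_ifs
    · rw [lintegral_mul_const _ ((hind _).mul_const _), lintegral_mul_const _ (hind _),
        lintegral_indicator_one (measurableSet_cell _)]
    · simp
  simp only [h1, h2]

/-- Only the term of one gap is kept: the right neighbour of the cell of `x` lies between `x` and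
`y`, so its mass is a lower bound for their distance. -/
theorem edist_cdf_rpow_neg_le (μ : Measure unitInterval) [IsFiniteMeasure μ] {t : ℝ} (ht : 0 ≤ t)
    {x y : unitInterval} (h : x < y) :
    edist (cdf μ x) (cdf μ y) ^ (-t) ≤
      gapSum (fun I => (cell I).indicator 1 x) (fun I => (cell I).indicator 1 y)
        (fun I => μ (cell I) ^ (-t)) := by
  obtain ⟨n, d, hd⟩ := exists_gap h
  have hlt : (idx n x : ℕ) + 2 + d < 2 ^ n := hd ▸ (idx n y).2
  have hj : (idx n x : ℕ) + 1 < 2 ^ n := by omega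
  refine le_trans ?_ (ENNReal.le_tsum n)
  refine le_trans ?_ (Finset.single_le_sum (fun _ _ => zero_le) (Finset.mem_univ (idx n x)))
  refine le_trans ?_ (Finset.single_le_sum (fun _ _ => zero_le) (Finset.mem_univ d))
  rw [gapTerm, dif_pos hlt, Set.indicator_of_mem (mem_cell_idx n x),
    Set.indicator_of_mem (mem_cell_iff_val.2 hd), Pi.one_apply, Pi.one_apply, one_mul, one_mul,
    ENNReal.rpow_neg, ENNReal.rpow_neg]
  refine ENNReal.inv_le_inv.2 (ENNReal.rpow_le_rpow ?_ ht)
  rw [edist_cdf μ h.le]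
  exact measure_mono (cell_subset_Ioc (by rw [Fin.lt_def]; exact Nat.lt_succ_self _)
      (by rw [Fin.lt_def]; simp only; omega))

theorem measurable_edist_cdf (μ : Measure unitInterval) [IsFiniteMeasure μ] (t : ℝ) :
    Measurable fun p : unitInterval × unitInterval => edist (cdf μ p.1) (cdf μ p.2) ^ t :=
  (((cdf_mono μ).measurable.comp measurable_fst).edist
    ((cdf_mono μ).measurable.comp measurable_snd)).pow_const _

/-- Symmetrisation by Tonelli; the diagonal, where the energy kernel is infinite, is null because
`ν` has no atoms. -/
theorem lintegral_le_two_mul_of_le_add_swap {X : Type*} [MeasurableSpace X]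
    [MeasurableSingletonClass X] (ν : Measure X) [SFinite ν] [NullSingletonClass ν]
    {E H : X → X → ℝ≥0∞} (hH : Measurable (Function.uncurry H))
    (h : ∀ x y, x ≠ y → E x y ≤ H x y + H y x) :
    ∫⁻ x, ∫⁻ y, E x y ∂ν ∂ν ≤ 2 * ∫⁻ x, ∫⁻ y, H x y ∂ν ∂ν := by
  have hH' : Measurable (Function.uncurry fun x y => H y x) := hH.comp measurable_swap
  have hsplit : ∀ x, ∫⁻ y, E x y ∂ν ≤ ∫⁻ y, H x y ∂ν + ∫⁻ y, H y x ∂ν := by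
    intro x
    have hx : Measurable fun y => H x y := hH.comp measurable_prodMk_left
    rw [← lintegral_add_left hx]
    refine lintegral_mono_ae ?_
    have hx : ∀ᵐ y ∂ν, y ≠ x := by
      rw [ae_iff]; simp
    filter_upwards [hx] with y hy using h x y hy.symm
  refine (lintegral_mono hsplit).trans ?_
  have hm : Measurable fun x => ∫⁻ y, H x y ∂ν := hH.lintegral_prod_right'
  rw [lintegral_add_left hm, two_mul]
  have := lintegral_lintegral_swap (μ := ν) (ν := ν) hH'.aemeasurable
  exact add_le_add le_rfl this.le

theorem lintegral_edist_cdf_le (μ ν : Measure unitInterval) [IsFiniteMeasure μ] [IsFiniteMeasure ν]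
    [NullSingletonClass ν] {t : ℝ} (ht : 0 ≤ t) :
    ∫⁻ x, ∫⁻ y, edist (cdf μ x) (cdf μ y) ^ (-t) ∂ν ∂ν ≤
      2 * gapSum (fun I => ν (cell I)) (fun I => ν (cell I)) (fun I => μ (cell I) ^ (-t)) := by
  have hlt : MeasurableSet {p : unitInterval × unitInterval | p.1 < p.2} :=
    measurableSet_lt measurable_fst measurable_snd
  let H : unitInterval → unitInterval → ℝ≥0∞ := fun x y =>
    {p : unitInterval × unitInterval | p.1 < p.2}.indicator
      (fun p => edist (cdf μ p.1) (cdf μ p.2) ^ (-t)) (x, y)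
  have hH : Measurable (Function.uncurry H) := (measurable_edist_cdf μ _).indicator hlt
  have hH1 : ∀ {x y}, x < y → H x y = edist (cdf μ x) (cdf μ y) ^ (-t) := fun {x y} h =>
    Set.indicator_of_mem (s := {p : unitInterval × unitInterval | p.1 < p.2}) h _
  have hH2 : ∀ {x y}, ¬ x < y → H x y = 0 := fun {x y} h =>
    Set.indicator_of_notMem (s := {p : unitInterval × unitInterval | p.1 < p.2}) h _
  clear_value H
  refine (lintegral_le_two_mul_of_le_add_swap ν hH fun x y hxy => ?_).trans ?_
  · rcases lt_or_gt_of_ne hxy with h | h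
    · rw [hH1 h]
      exact le_self_add
    · rw [hH1 h, edist_comm]
      exact le_add_self
  · refine mul_le_mul_right ?_ 2
    rw [← lintegral_lintegral_gapSum]
    refine lintegral_mono fun x => lintegral_mono fun y => ?_
    by_cases h : x < y
    · rw [hH1 h]
      exact edist_cdf_rpow_neg_le μ ht h
    · rw [hH2 h]
      exact zero_le

/-- A lower bound for the dimension of the image of a set under a distribution function. -/
theorem le_dimH_cdf_image {μ : Measure unitInterval} [IsFiniteMeasure μ]
    (hpos : ∀ I, μ (cell I) ≠ 0) {m : Dyadic → ℝ≥0∞} (hadd : ∀ I, m I = ∑ i, m (child I i))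
    (hfin : ∀ I, m I ≠ ∞) (hlim : ∀ ε : ℝ≥0∞, 0 < ε → ∃ n, ∀ k, m ⟨n, k⟩ ≤ ε)
    {K : Set unitInterval} (hK : IsCompact K) (hKm : ∀ I, K ∩ cell I = ∅ → m I = 0)
    (h0 : m ⟨0, 0⟩ ≠ 0) {t : ℝ≥0} (ht : 0 < t)
    (hS : gapSum m m (fun I => μ (cell I) ^ (-(t : ℝ))) ≠ ∞) : t ≤ dimH (cdf μ '' K) := by
  obtain ⟨ν, hνfin, hνat, hν⟩ := exists_measure_cell_eq hadd hfin hlim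
  have hmeas : Measurable (cdf μ) := (cdf_mono μ).measurable
  -- As `K` is closed, its complement is a countable union of cells that miss `K`, and these have no
  -- mass.
  have hνK : ν Kᶜ = 0 := by
    refine measure_mono_null (t := ⋃ I ∈ {I | K ∩ cell I = ∅}, cell I) ?_
      ((measure_biUnion_null_iff (Set.to_countable _)).2 fun I hI => (hν I).trans (hKm I hI))
    intro x hx
    obtain ⟨ε, hε, hball⟩ := EMetric.mem_nhds_iff.1 (hK.isClosed.isOpen_compl.mem_nhds hx)
    obtain ⟨n, hn⟩ := ((ENNReal.tendsto_pow_atTop_nhds_zero_of_lt_one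
      (by simp : (2 : ℝ≥0∞)⁻¹ < 1)).eventually (gt_mem_nhds hε)).exists
    refine Set.mem_iUnion₂.2 ⟨⟨n, idx n x⟩, ?_, mem_cell_idx n x⟩
    refine Set.eq_empty_of_forall_notMem fun z hz => hball ?_ hz.1
    exact ((Metric.edist_le_ediam_of_mem hz.2 (mem_cell_idx n x)).trans
      (ediam_cell_le _)).trans_lt hn
  refine le_dimH_of_energy (η := ν.map (cdf μ)) ?_ ?_ ht ?_
  · rw [Measure.map_apply hmeas
      (hK.measurableSet.image_of_measurable_injOn hmeas (cdf_injective μ hpos).injOn).compl]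
    exact measure_mono_null (fun x hx hxK => hx ⟨x, hxK, rfl⟩) hνK
  · intro h
    rw [Measure.map_eq_zero_iff hmeas.aemeasurable] at h
    apply h0
    rw [← hν, h]
    simp
  · have hE : Measurable fun p : ℝ × ℝ => edist p.1 p.2 ^ (-(t : ℝ)) :=
      measurable_edist.pow_const _
    rw [lintegral_map hE.lintegral_prod_right' hmeas]
    have h1 : ∀ x, ∫⁻ y, edist (cdf μ x) y ^ (-(t : ℝ)) ∂ν.map (cdf μ) =
        ∫⁻ y, edist (cdf μ x) (cdf μ y) ^ (-(t : ℝ)) ∂ν := fun x =>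
      lintegral_map (hE.comp measurable_prodMk_left) hmeas
    simp only [h1]
    refine ne_top_of_le_ne_top ?_ (lintegral_edist_cdf_le μ ν t.2)
    simp only [hν]
    exact ENNReal.mul_ne_top (by simp) hS

end Cascade

namespace Cascade

open scoped ENNReal NNReal

/-! ### Masses of a cascade with deterministic weights -/

/-- The mass of a dyadic interval when the base mass `b` is redistributed by the weights `w` of the
first `n` levels from that interval on. -/
noncomputable def subMass (b w : Dyadic → ℝ≥0∞) : ℕ → Dyadic → ℝ≥0∞
  | 0, I => b I
  | n + 1, I => w I * ∑ i, subMass b w n (child I i)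

theorem subMass_zero (b w : Dyadic → ℝ≥0∞) (I : Dyadic) : subMass b w 0 I = b I := rfl

theorem subMass_succ (b w : Dyadic → ℝ≥0∞) (n : ℕ) (I : Dyadic) :
    subMass b w (n + 1) I = w I * ∑ i, subMass b w n (child I i) := rfl

/-- The limit of the masses `subMass`. -/
noncomputable def limMass (b w : Dyadic → ℝ≥0∞) (I : Dyadic) : ℝ≥0∞ :=
  limsup (fun n => subMass b w n I) atTop

/-- The mass of a dyadic interval when the weights of all of its ancestors are included. -/
noncomputable def cascadeMass (b w : Dyadic → ℝ≥0∞) (I : Dyadic) : ℝ≥0∞ :=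
  pathProd w I.1 I.2 * limMass b w I

theorem subMass_ne_top {b w : Dyadic → ℝ≥0∞} (hb : ∀ I, b I ≠ ∞) (hw : ∀ I, w I ≠ ∞) (n : ℕ) :
    ∀ I, subMass b w n I ≠ ∞ := by
  induction n with
  | zero => exact hb
  | succ n ih => exact fun I => ENNReal.mul_ne_top (hw I) (ENNReal.sum_ne_top.2 fun i _ => ih _)

theorem subMass_eq_zero {b w : Dyadic → ℝ≥0∞} (hadd : ∀ I, b I = ∑ i, b (child I i)) (n : ℕ) :
    ∀ I, b I = 0 → subMass b w n I = 0 := by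
  induction n with
  | zero => exact fun I h => h
  | succ n ih =>
    intro I h
    rw [hadd] at h
    have h' := fun i => Finset.sum_eq_zero_iff.1 h i (Finset.mem_univ i)
    rw [subMass_succ, Finset.sum_eq_zero fun i _ => ih _ (h' i), mul_zero]

theorem limMass_eq_zero {b w : Dyadic → ℝ≥0∞} (hadd : ∀ I, b I = ∑ i, b (child I i)) {I : Dyadic}
    (h : b I = 0) : limMass b w I = 0 := by
  simp [limMass, subMass_eq_zero hadd _ I h]

theorem limMass_eq_mul_sum {b w : Dyadic → ℝ≥0∞} {I : Dyadic} (hw : w I ≠ ∞)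
    (h : ∀ J, Tendsto (fun n => subMass b w n J) atTop (𝓝 (limMass b w J))) :
    limMass b w I = w I * ∑ i, limMass b w (child I i) := by
  refine tendsto_nhds_unique ((tendsto_add_atTop_iff_nat 1).2 (h I)) ?_
  exact ENNReal.Tendsto.const_mul (tendsto_finsetSum _ fun i _ => h _) (Or.inr hw)

theorem cascadeMass_eq_sum {b w : Dyadic → ℝ≥0∞} (hw : ∀ I, w I ≠ ∞)
    (h : ∀ J, Tendsto (fun n => subMass b w n J) atTop (𝓝 (limMass b w J))) (I : Dyadic) :
    cascadeMass b w I = ∑ i, cascadeMass b w (child I i) := by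
  simp only [cascadeMass, pathProd_childIdx]
  rw [limMass_eq_mul_sum (hw I) h, ← mul_assoc, Finset.mul_sum]

/-- With the limit mass defined as a `limsup`, this needs no convergence and holds for every sample,
not merely almost every one. -/
theorem limMass_ge_child {b w : Dyadic → ℝ≥0∞} {I : Dyadic} (hw : w I ≠ ∞) (i : Fin 2) :
    w I * limMass b w (child I i) ≤ limMass b w I := by
  rw [limMass, ← ENNReal.limsup_const_mul_of_ne_top hw, limMass,
    ← limsup_nat_add (fun n => subMass b w n I) 1]
  refine limsup_le_limsup (Eventually.of_forall fun n => ?_)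
  change w I * subMass b w n (child I i) ≤ w I * ∑ i, subMass b w n (child I i)
  gcongr
  exact Finset.single_le_sum (f := fun i => subMass b w n (child I i)) (fun _ _ => zero_le)
    (Finset.mem_univ i)

/-- A vanishing `limsup` is a limit, so the recursion passes to it. Valid for every sample, this
makes degeneracy a tail event. -/
theorem limMass_eq_zero_iff {b w : Dyadic → ℝ≥0∞} {I : Dyadic} (hw0 : w I ≠ 0) (hw : w I ≠ ∞) :
    limMass b w I = 0 ↔ ∀ i, limMass b w (child I i) = 0 := by
  refine ⟨fun h i => ?_, fun h => ?_⟩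
  · have := limMass_ge_child (b := b) hw i
    rw [h] at this
    exact (mul_eq_zero.1 (le_antisymm this zero_le)).resolve_left hw0
  · have ht : ∀ i, Tendsto (fun n => subMass b w n (child I i)) atTop (𝓝 0) := fun i =>
      tendsto_of_le_liminf_of_limsup_le zero_le (h i).le
    have hlim : Tendsto (fun n => subMass b w (n + 1) I) atTop (𝓝 (w I * ∑ i : Fin 2, 0)) :=
      ENNReal.Tendsto.const_mul (tendsto_finsetSum _ fun i _ => ht i) (Or.inr hw)
    rw [limMass, ((tendsto_add_atTop_iff_nat 1).1 hlim).limsup_eq]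
    simp

theorem limMass_root_eq_zero_iff {b w : Dyadic → ℝ≥0∞} (hw0 : ∀ I, w I ≠ 0) (hw : ∀ I, w I ≠ ∞)
    (n : ℕ) : limMass b w ⟨0, 0⟩ = 0 ↔ ∀ k : Fin (2 ^ n), limMass b w ⟨n, k⟩ = 0 := by
  induction n with
  | zero =>
    refine ⟨fun h k => ?_, fun h => h 0⟩
    rwa [Subsingleton.elim (α := Fin 1) k 0]
  | succ n ih =>
    rw [ih]
    have hiff := fun k => limMass_eq_zero_iff (b := b) (hw0 ⟨n, k⟩) (hw ⟨n, k⟩)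
    refine ⟨fun h k => ?_, fun h k => (hiff k).2 fun i => h _⟩
    obtain ⟨i, hi⟩ := exists_eq_childIdx k
    rw [hi]
    exact (hiff _).1 (h _) i

/-! ### Independent weights -/

variable {Ω : Type*} {mΩ : MeasurableSpace Ω} {P : Measure Ω}

/-- The σ-algebra generated by the σ-algebras attached to a set of dyadic intervals. -/
abbrev sigmaOf (𝓕 : Dyadic → MeasurableSpace Ω) (S : Set Dyadic) : MeasurableSpace Ω :=
  ⨆ J ∈ S, 𝓕 J

theorem sigmaOf_mono {𝓕 : Dyadic → MeasurableSpace Ω} {S T : Set Dyadic} (h : S ⊆ T) :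
    sigmaOf 𝓕 S ≤ sigmaOf 𝓕 T := biSup_mono h

theorem le_sigmaOf {𝓕 : Dyadic → MeasurableSpace Ω} {S : Set Dyadic} {I : Dyadic} (h : I ∈ S) :
    𝓕 I ≤ sigmaOf 𝓕 S := le_iSup₂ (f := fun J (_ : J ∈ S) => 𝓕 J) I h

/-- Independent σ-algebras attached to the dyadic intervals. -/
structure IsIndepField (P : Measure Ω) (𝓕 : Dyadic → MeasurableSpace Ω) : Prop where
  le : ∀ I, 𝓕 I ≤ mΩ
  indep : iIndep 𝓕 P

theorem IsIndepField.sigmaOf_le {𝓕 : Dyadic → MeasurableSpace Ω} (h𝓕 : IsIndepField P 𝓕)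
    (S : Set Dyadic) : sigmaOf 𝓕 S ≤ mΩ := iSup₂_le fun I _ => h𝓕.le I

theorem IsIndepField.lintegral_mul {𝓕 : Dyadic → MeasurableSpace Ω} (h𝓕 : IsIndepField P 𝓕)
    {S T : Set Dyadic} (hST : Disjoint S T) {f g : Ω → ℝ≥0∞} (hf : Measurable[sigmaOf 𝓕 S] f)
    (hg : Measurable[sigmaOf 𝓕 T] g) :
    ∫⁻ ω, f ω * g ω ∂P = (∫⁻ ω, f ω ∂P) * ∫⁻ ω, g ω ∂P :=
  lintegral_mul_eq_lintegral_mul_lintegral_of_independent_measurableSpace (h𝓕.sigmaOf_le S)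
    (h𝓕.sigmaOf_le T) (indep_iSup_of_disjoint h𝓕.le h𝓕.indep hST) hf hg

/-- Independent positive finite weights of mean one. -/
structure IsWeight (P : Measure Ω) (𝓕 : Dyadic → MeasurableSpace Ω) (U : Ω → Dyadic → ℝ≥0∞) :
    Prop where
  meas : ∀ I, Measurable[𝓕 I] fun ω => U ω I
  mean : ∀ I, ∫⁻ ω, U ω I ∂P = 1
  ne_zero : ∀ ω I, U ω I ≠ 0
  ne_top : ∀ ω I, U ω I ≠ ∞

variable {𝓕 : Dyadic → MeasurableSpace Ω} {U : Ω → Dyadic → ℝ≥0∞} {b : Dyadic → ℝ≥0∞}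

theorem IsWeight.measurable_of_mem (hU : IsWeight P 𝓕 U) {S : Set Dyadic} {I : Dyadic}
    (h : I ∈ S) : Measurable[sigmaOf 𝓕 S] fun ω => U ω I :=
  (hU.meas I).mono (le_sigmaOf h) le_rfl

theorem IsWeight.measurable_subMass_level (hU : IsWeight P 𝓕 U) (n : ℕ) :
    ∀ I, Measurable[sigmaOf 𝓕 {J | J ∈ descendants I ∧ J.1 < I.1 + n}]
      fun ω => subMass b (U ω) n I := by
  induction n with
  | zero => exact fun I => measurable_const
  | succ n ih =>
    intro I
    refine (hU.measurable_of_mem (S := {J | J ∈ descendants I ∧ J.1 < I.1 + (n + 1)})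
      ⟨self_mem_descendants I, by omega⟩).mul (Finset.measurable_fun_sum _ fun i _ => (ih (child I i)).mono (sigmaOf_mono ?_) le_rfl)
    rintro J ⟨h1, h2⟩
    exact ⟨descendants_child_subset I i h1, by simp only at h2; omega⟩

theorem IsWeight.measurable_subMass (hU : IsWeight P 𝓕 U) (n : ℕ) (I : Dyadic) :
    Measurable[sigmaOf 𝓕 (descendants I)] fun ω => subMass b (U ω) n I :=
  (hU.measurable_subMass_level n I).mono (sigmaOf_mono fun _ h => h.1) le_rfl

theorem IsWeight.measurable_limMass (hU : IsWeight P 𝓕 U) (I : Dyadic) :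
    Measurable[sigmaOf 𝓕 (descendants I)] fun ω => limMass b (U ω) I :=
  Measurable.limsup fun n => hU.measurable_subMass n I

theorem IsWeight.measurable_pathProd (hU : IsWeight P 𝓕 U) (n : ℕ) (k : Fin (2 ^ n)) :
    Measurable[sigmaOf 𝓕 {J | J.1 < n}] fun ω => pathProd (U ω) n k := by
  induction n with
  | zero => exact measurable_const
  | succ n ih =>
    exact ((ih _).mono (sigmaOf_mono fun J (h : J.1 < n) => Nat.lt_succ_of_lt h) le_rfl).mul
      (hU.measurable_of_mem (Nat.lt_succ_self n))

theorem disjoint_level_descendants (I : Dyadic) :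
    Disjoint {J : Dyadic | J.1 < I.1} (descendants I) :=
  Set.disjoint_left.2 fun J (h : J.1 < I.1) h' => absurd h'.1 (not_le.2 h)

theorem disjoint_singleton_descendants_child (I : Dyadic) (i : Fin 2) :
    Disjoint {I} (descendants (child I i)) :=
  Set.disjoint_left.2 fun J hJ h' => by
    rw [Set.mem_singleton_iff.1 hJ] at h'
    exact absurd h'.1 (by simp)

/-- The martingale property, tested against functions `H` of the earlier levels. In the induction
the weight of `I` is absorbed into `H`, which explains the quantification over all `H`. -/
theorem IsWeight.lintegral_mul_subMass_succ (h𝓕 : IsIndepField P 𝓕) (hU : IsWeight P 𝓕 U)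
    (hadd : ∀ I, b I = ∑ i, b (child I i)) (n : ℕ) :
    ∀ (I : Dyadic) (H : Ω → ℝ≥0∞), Measurable[sigmaOf 𝓕 {J | J.1 < I.1 + n}] H →
      ∫⁻ ω, H ω * subMass b (U ω) (n + 1) I ∂P = ∫⁻ ω, H ω * subMass b (U ω) n I ∂P := by
  induction n with
  | zero =>
    intro I H hH
    simp only [subMass_succ, subMass_zero, ← hadd]
    have hH' := hH.mono (h𝓕.sigmaOf_le _) le_rfl
    have hU' := (hU.meas I).mono (h𝓕.le _) le_rfl
    simp only [← mul_assoc]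
    have hHU : Measurable fun ω => H ω * U ω I := hH'.mul hU'
    rw [lintegral_mul_const _ hHU, lintegral_mul_const _ hH',
      h𝓕.lintegral_mul (S := {J | J.1 < I.1}) (T := {I}) (by simp) hH
        (hU.measurable_of_mem (Set.mem_singleton I)), hU.mean, mul_one]
  | succ n ih =>
    intro I H hH
    have hHU : Measurable[sigmaOf 𝓕 {J | J.1 < I.1 + 1 + n}] fun ω => H ω * U ω I := by
      refine Measurable.mul (hH.mono (sigmaOf_mono fun J h => ?_) le_rfl)
        (hU.measurable_of_mem ?_)
      · simp only [Set.mem_ofPred_eq] at h ⊢; omega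
      · simp only [Set.mem_ofPred_eq]; omega
    have hm : ∀ n i, Measurable fun ω => H ω * U ω I * subMass b (U ω) n (child I i) :=
      fun n i => (hHU.mono (h𝓕.sigmaOf_le _) le_rfl).mul
        ((hU.measurable_subMass n _).mono (h𝓕.sigmaOf_le _) le_rfl)
    have hs : ∀ n, ∫⁻ ω, H ω * subMass b (U ω) (n + 1) I ∂P =
        ∑ i, ∫⁻ ω, H ω * U ω I * subMass b (U ω) n (child I i) ∂P := by
      intro n
      rw [← lintegral_finsetSum _ fun i _ => hm n i]
      refine lintegral_congr fun ω => ?_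
      rw [subMass_succ, ← mul_assoc, Finset.mul_sum]
    rw [hs, hs]
    exact Finset.sum_congr rfl fun i _ => ih (child I i) _ hHU

theorem IsWeight.lintegral_subMass [IsProbabilityMeasure P] (h𝓕 : IsIndepField P 𝓕)
    (hU : IsWeight P 𝓕 U) (hadd : ∀ I, b I = ∑ i, b (child I i)) (n : ℕ) (I : Dyadic) :
    ∫⁻ ω, subMass b (U ω) n I ∂P = b I := by
  induction n with
  | zero => simp [subMass_zero]
  | succ n ih =>
    have := hU.lintegral_mul_subMass_succ h𝓕 hadd n I (fun _ => 1) measurable_const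
    simp only [one_mul] at this
    rw [this, ih]

theorem IsWeight.ae_tendsto_subMass [IsProbabilityMeasure P] (h𝓕 : IsIndepField P 𝓕)
    (hU : IsWeight P 𝓕 U) (hadd : ∀ I, b I = ∑ i, b (child I i)) (hb : ∀ I, b I ≠ ∞)
    (I : Dyadic) : ∀ᵐ ω ∂P, Tendsto (fun n => subMass b (U ω) n I) atTop
      (𝓝 (limMass b (U ω) I)) ∧ limMass b (U ω) I ≠ ∞ := by
  let 𝒢 : Filtration ℕ mΩ :=
    { seq := fun n => sigmaOf 𝓕 {J | J.1 < I.1 + n}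
      mono' := fun m n hmn => sigmaOf_mono fun J (h : J.1 < I.1 + m) => by
        simp only [Set.mem_ofPred_eq]; omega
      le' := fun n => h𝓕.sigmaOf_le _ }
  have hmeas : ∀ n, Measurable fun ω => subMass b (U ω) n I := fun n =>
    (hU.measurable_subMass n I).mono (h𝓕.sigmaOf_le _) le_rfl
  have hfin : ∀ n ω, subMass b (U ω) n I ≠ ∞ := fun n ω => subMass_ne_top hb (hU.ne_top ω) n I
  let f : ℕ → Ω → ℝ := fun n ω => (subMass b (U ω) n I).toReal
  have hadp : StronglyAdapted 𝒢 f := fun n =>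
    (((hU.measurable_subMass_level n I).mono (sigmaOf_mono fun J h => h.2)
      le_rfl).ennreal_toReal).stronglyMeasurable
  have hint : ∀ n, Integrable (f n) P := fun n =>
    integrable_toReal_of_lintegral_ne_top (hmeas n).aemeasurable
      (by rw [hU.lintegral_subMass h𝓕 hadd]; exact hb I)
  have hset : ∀ n s, MeasurableSet s → ∫ ω in s, f n ω ∂P =
      (∫⁻ ω in s, subMass b (U ω) n I ∂P).toReal := fun n s hs =>
    integral_toReal (hmeas n).aemeasurable (Eventually.of_forall fun ω => (hfin n ω).lt_top)
  have hmart : Martingale f 𝒢 P := by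
    refine martingale_of_setIntegral_eq_succ hadp hint fun n s hs => ?_
    have hs' : MeasurableSet s := 𝒢.le n s hs
    rw [hset n s hs', hset (n + 1) s hs']
    congr 1
    have hind : Measurable[sigmaOf 𝓕 {J | J.1 < I.1 + n}] (s.indicator (1 : Ω → ℝ≥0∞)) :=
      Measurable.indicator (@measurable_const _ _ _ (sigmaOf 𝓕 {J | J.1 < I.1 + n}) 1) hs
    have := hU.lintegral_mul_subMass_succ h𝓕 hadd n I _ hind
    have e : ∀ n, ∫⁻ ω, s.indicator (1 : Ω → ℝ≥0∞) ω * subMass b (U ω) n I ∂P =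
        ∫⁻ ω in s, subMass b (U ω) n I ∂P := by
      intro n
      rw [← lintegral_indicator hs']
      refine lintegral_congr fun ω => ?_
      by_cases h : ω ∈ s <;> simp [h]
    rw [← e, ← e, this]
  have hbdd : ∀ n, eLpNorm (f n) 1 P ≤ ((b I).toNNReal : ℝ≥0∞) := by
    intro n
    rw [eLpNorm_one_eq_lintegral_enorm, ENNReal.coe_toNNReal (hb I),
      ← hU.lintegral_subMass h𝓕 hadd n I]
    refine lintegral_mono fun ω => ?_
    rw [Real.enorm_of_nonneg ENNReal.toReal_nonneg, ENNReal.ofReal_toReal (hfin n ω)]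
  filter_upwards [hmart.submartingale.exists_ae_tendsto_of_bdd hbdd] with ω ⟨c, hc⟩
  have hc' := ENNReal.tendsto_ofReal hc
  simp only [f, ENNReal.ofReal_toReal (hfin _ ω)] at hc'
  have : limMass b (U ω) I = ENNReal.ofReal c := hc'.limsup_eq
  rw [this]
  exact ⟨hc', ENNReal.ofReal_ne_top⟩

/-- This is Fatou's lemma; only upper bounds survive in the limit. -/
theorem IsWeight.lintegral_limMass_rpow_le [IsProbabilityMeasure P] (h𝓕 : IsIndepField P 𝓕)
    (hU : IsWeight P 𝓕 U) (hadd : ∀ I, b I = ∑ i, b (child I i)) (hb : ∀ I, b I ≠ ∞)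
    (I : Dyadic) {p : ℝ} {D : ℝ≥0∞}
    (hD : ∀ n, ∫⁻ ω, subMass b (U ω) n I ^ p ∂P ≤ D) : ∫⁻ ω, limMass b (U ω) I ^ p ∂P ≤ D := by
  have hm : ∀ n, Measurable fun ω => subMass b (U ω) n I ^ p := fun n =>
    ((hU.measurable_subMass n I).mono (h𝓕.sigmaOf_le _) le_rfl).pow_const p
  calc ∫⁻ ω, limMass b (U ω) I ^ p ∂P
      = ∫⁻ ω, liminf (fun n => subMass b (U ω) n I ^ p) atTop ∂P := by
        refine lintegral_congr_ae ?_
        filter_upwards [hU.ae_tendsto_subMass h𝓕 hadd hb I] with ω hω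
        exact (((ENNReal.continuous_rpow_const).tendsto _).comp hω.1).liminf_eq.symm
    _ ≤ liminf (fun n => ∫⁻ ω, subMass b (U ω) n I ^ p ∂P) atTop := lintegral_liminf_le hm
    _ ≤ liminf (fun _ => D) atTop := liminf_le_liminf (Eventually.of_forall hD)
    _ = D := liminf_const D

theorem IsWeight.lintegral_limMass_le [IsProbabilityMeasure P] (h𝓕 : IsIndepField P 𝓕)
    (hU : IsWeight P 𝓕 U) (hadd : ∀ I, b I = ∑ i, b (child I i)) (hb : ∀ I, b I ≠ ∞)
    (I : Dyadic) : ∫⁻ ω, limMass b (U ω) I ∂P ≤ b I := by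
  have := hU.lintegral_limMass_rpow_le h𝓕 hadd hb I (p := 1) (D := b I) fun n => by
    simp only [ENNReal.rpow_one]
    exact (hU.lintegral_subMass h𝓕 hadd n I).le
  simpa only [ENNReal.rpow_one] using this

/-! ### Moments -/

theorem lintegral_rpow_le_rpow_lintegral [IsProbabilityMeasure P] {X : Ω → ℝ≥0∞}
    (hX : Measurable X) {q : ℝ} (hq0 : 0 < q) (hq1 : q ≤ 1) :
    ∫⁻ ω, X ω ^ q ∂P ≤ (∫⁻ ω, X ω ∂P) ^ q := by
  rcases eq_or_lt_of_le hq1 with rfl | hq1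
  · simp
  have h := ENNReal.lintegral_mul_le_Lp_mul_Lq P
    (.conjExponent (show 1 < q⁻¹ from (one_lt_inv₀ hq0).2 hq1))
    (hX.pow_const q).aemeasurable (aemeasurable_const (b := (1 : ℝ≥0∞)))
  simpa [← ENNReal.rpow_mul, mul_inv_cancel₀ hq0.ne'] using h

/-- The power `p / 2 ≤ 1` is subadditive, and squaring isolates a cross term which factors for
independent variables. -/
theorem add_rpow_le_of_le_two {p : ℝ} (hp0 : 0 ≤ p) (hp : p ≤ 2) (x y : ℝ≥0∞) :
    (x + y) ^ p ≤ x ^ p + y ^ p + 2 * (x ^ (p / 2) * y ^ (p / 2)) := by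
  have e : ∀ z : ℝ≥0∞, z ^ p = (z ^ (p / 2)) ^ 2 := fun z => by
    rw [← ENNReal.rpow_mul_natCast]; congr 1; push_cast; ring
  have h := ENNReal.rpow_add_le_add_rpow x y (p := p / 2) (by linarith) (by linarith)
  rw [e, e, e]
  calc ((x + y) ^ (p / 2)) ^ 2 ≤ (x ^ (p / 2) + y ^ (p / 2)) ^ 2 := by gcongr
    _ = _ := by ring

/-- The masses of a cascade are bounded in `Lᵖ` if `E Uᵖ` is not too large. -/
theorem IsWeight.exists_lintegral_subMass_rpow_le [IsProbabilityMeasure P]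
    (h𝓕 : IsIndepField P 𝓕) (hU : IsWeight P 𝓕 U) {p : ℝ} (hp1 : 1 < p) (hp2 : p ≤ 2)
    {u q : ℝ≥0∞} (hu : ∀ I, ∫⁻ ω, U ω I ^ p ∂P ≤ u) (hutop : u ≠ ∞) (huq : u * q ^ (p - 1) < 1) :
    ∃ B : ℝ≥0∞, B ≠ ∞ ∧ ∀ b : Dyadic → ℝ≥0∞, (∀ I, b I = ∑ i, b (child I i)) →
      (∀ I, b I ≤ q ^ I.1) → ∀ n I, ∫⁻ ω, subMass b (U ω) n I ^ p ∂P ≤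
        B * b I * (q ^ (p - 1)) ^ I.1 := by
  set r : ℝ≥0∞ := q ^ (p - 1) with hr
  set c : ℝ≥0∞ := 2 * u + 1 with hc
  have hsub : 1 - u * r ≠ 0 := by rw [Ne, tsub_eq_zero_iff_le, not_le]; exact huq
  set B : ℝ≥0∞ := c * (1 - u * r)⁻¹ with hB
  have hBtop : B ≠ ∞ := by
    rw [hB, hc]
    exact ENNReal.mul_ne_top (by simp [ENNReal.mul_eq_top, hutop]) (ENNReal.inv_ne_top.2 hsub)
  -- `B` is the fixed point of the recursion for the moments: each level multiplies the bound by `u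
  -- r < 1`, and the cross term contributes at most `c`.
  have hBeq : u * r * B + c = B := by
    have h1 : (1 - u * r) * B = c := by
      rw [hB, mul_comm, mul_assoc, ENNReal.inv_mul_cancel hsub (by simp), mul_one]
    calc u * r * B + c = u * r * B + (1 - u * r) * B := by rw [h1]
      _ = (u * r + (1 - u * r)) * B := by ring
      _ = B := by rw [add_tsub_cancel_of_le huq.le, one_mul]
  have hB1 : 1 ≤ B := by
    rw [← hBeq, hc]
    exact le_add_left le_add_self
  have hB2 : u * (r * B + 2) ≤ B := by
    calc u * (r * B + 2) = u * r * B + 2 * u := by ring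
      _ ≤ u * r * B + c := by gcongr; exact le_self_add
      _ = B := hBeq
  refine ⟨B, hBtop, fun b hadd hbq n => ?_⟩
  have hbp : ∀ I, b I ^ p ≤ b I * r ^ I.1 := by
    intro I
    have e : b I ^ p = b I * b I ^ (p - 1) := by
      conv_rhs => rw [← ENNReal.rpow_one (b I), ← ENNReal.rpow_mul, one_mul]
      rw [← ENNReal.rpow_add_of_nonneg _ _ zero_le_one (by linarith)]
      congr 1; ring
    rw [e, hr, ← ENNReal.rpow_natCast, ← ENNReal.rpow_mul, mul_comm (p - 1), ENNReal.rpow_mul,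
      ENNReal.rpow_natCast]
    gcongr
    exact hbq I
  induction n with
  | zero =>
    intro I
    simp only [subMass_zero, lintegral_const, measure_univ, mul_one]
    refine (hbp I).trans ?_
    rw [mul_assoc]
    exact le_mul_of_one_le_left zero_le hB1
  | succ n ih =>
    intro I
    have hmX : ∀ i, Measurable[sigmaOf 𝓕 (descendants (child I i))]
        fun ω => subMass b (U ω) n (child I i) := fun i => hU.measurable_subMass n _
    have hmX' : ∀ i, Measurable fun ω => subMass b (U ω) n (child I i) := fun i =>
      (hmX i).mono (h𝓕.sigmaOf_le _) le_rfl
    -- As `p / 2 ≤ 1`, Jensen's inequality bounds the factors of the cross term by first moments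
    -- alone.
    have hhalf : ∀ i, ∫⁻ ω, subMass b (U ω) n (child I i) ^ (p / 2) ∂P ≤ b I ^ (p / 2) := by
      intro i
      refine (lintegral_rpow_le_rpow_lintegral (hmX' i) (by linarith) (by linarith)).trans ?_
      rw [hU.lintegral_subMass h𝓕 hadd, hadd I]
      gcongr
      exact Finset.single_le_sum (f := fun i => b (child I i)) (fun _ _ => zero_le)
        (Finset.mem_univ i)
    have hcross : ∫⁻ ω, subMass b (U ω) n (child I 0) ^ (p / 2) *
        subMass b (U ω) n (child I 1) ^ (p / 2) ∂P ≤ b I * r ^ I.1 := by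
      have hc : ∀ i, Measurable[sigmaOf 𝓕 (descendants (child I i))]
        fun ω => subMass b (U ω) n (child I i) ^ (p / 2) := fun i => (hmX i).pow_const _
      rw [h𝓕.lintegral_mul (S := descendants (child I 0)) (T := descendants (child I 1))
        (disjoint_descendants rfl (child_ne (by decide)))
        (hc 0) (hc 1)]
      refine (mul_le_mul' (hhalf 0) (hhalf 1)).trans ((le_of_eq ?_).trans (hbp I))
      rw [← ENNReal.rpow_add_of_nonneg _ _ (by linarith) (by linarith)]
      congr 1; ring
    have hmS : Measurable[sigmaOf 𝓕 (⋃ i, descendants (child I i))]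
        fun ω => (∑ i, subMass b (U ω) n (child I i)) ^ p := by
      refine Measurable.pow_const (Finset.measurable_fun_sum _ fun i _ => ?_) p
      exact (hmX i).mono
        (sigmaOf_mono (Set.subset_iUnion (fun i => descendants (child I i)) i)) le_rfl
    have hmU : Measurable[sigmaOf 𝓕 {I}] fun ω => U ω I ^ p :=
      (hU.measurable_of_mem (Set.mem_singleton I)).pow_const _
    have h1 : ∫⁻ ω, subMass b (U ω) (n + 1) I ^ p ∂P =
        (∫⁻ ω, U ω I ^ p ∂P) * ∫⁻ ω, (∑ i, subMass b (U ω) n (child I i)) ^ p ∂P := by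
      rw [← h𝓕.lintegral_mul
        (Set.disjoint_iUnion_right.2 fun i => disjoint_singleton_descendants_child I i) hmU hmS]
      refine lintegral_congr fun ω => ?_
      rw [subMass_succ, ENNReal.mul_rpow_of_nonneg _ _ (by linarith)]
    have hm0 := (hmX' 0).pow_const p
    have hm1 := (hmX' 1).pow_const p
    have hm01 : Measurable fun ω => subMass b (U ω) n (child I 0) ^ p +
      subMass b (U ω) n (child I 1) ^ p := hm0.add hm1
    have hmc : Measurable fun ω => subMass b (U ω) n (child I 0) ^ (p / 2) *
      subMass b (U ω) n (child I 1) ^ (p / 2) := ((hmX' 0).pow_const _).mul ((hmX' 1).pow_const _)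
    have h2 : ∫⁻ ω, (∑ i, subMass b (U ω) n (child I i)) ^ p ∂P ≤
        ∫⁻ ω, subMass b (U ω) n (child I 0) ^ p ∂P + ∫⁻ ω, subMass b (U ω) n (child I 1) ^ p ∂P +
          2 * ∫⁻ ω, subMass b (U ω) n (child I 0) ^ (p / 2) *
            subMass b (U ω) n (child I 1) ^ (p / 2) ∂P := by
      rw [← lintegral_const_mul _ hmc, ← lintegral_add_left hm0, ← lintegral_add_left hm01]
      refine lintegral_mono fun ω => ?_
      rw [Fin.sum_univ_two]
      exact add_rpow_le_of_le_two (by linarith) hp2 _ _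
    rw [h1]
    calc (∫⁻ ω, U ω I ^ p ∂P) * ∫⁻ ω, (∑ i, subMass b (U ω) n (child I i)) ^ p ∂P
        ≤ u * (∫⁻ ω, subMass b (U ω) n (child I 0) ^ p ∂P +
            ∫⁻ ω, subMass b (U ω) n (child I 1) ^ p ∂P +
            2 * ∫⁻ ω, subMass b (U ω) n (child I 0) ^ (p / 2) *
              subMass b (U ω) n (child I 1) ^ (p / 2) ∂P) := mul_le_mul' (hu I) h2
      _ ≤ u * (B * b (child I 0) * r ^ (I.1 + 1) + B * b (child I 1) * r ^ (I.1 + 1) +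
            2 * (b I * r ^ I.1)) := by
          gcongr
          · exact ih (child I 0)
          · exact ih (child I 1)
      _ = u * (r * B + 2) * (b I * r ^ I.1) := by
          have : b I = b (child I 0) + b (child I 1) := by rw [hadd, Fin.sum_univ_two]
          rw [this]
          ring
      _ ≤ B * (b I * r ^ I.1) := by gcongr
      _ = B * b I * r ^ I.1 := by ring

end Cascade

namespace Cascade

open scoped ENNReal NNReal

variable {Ω : Type*} {mΩ : MeasurableSpace Ω} {P : Measure Ω}
  {𝓕 : Dyadic → MeasurableSpace Ω} {U : Ω → Dyadic → ℝ≥0∞} {b : Dyadic → ℝ≥0∞}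

/-! ### Nondegeneracy -/

/-- A Paley–Zygmund type inequality. -/
theorem exists_le_measure_half_le [IsProbabilityMeasure P] {p : ℝ} (hp : 1 < p) {D : ℝ≥0∞}
    (hD : D ≠ ∞) : ∃ δ : ℝ≥0∞, δ ≠ 0 ∧ ∀ X : Ω → ℝ≥0∞, Measurable X → ∫⁻ ω, X ω ∂P = 1 →
      ∫⁻ ω, X ω ^ p ∂P ≤ D → δ ≤ P {ω | 2⁻¹ ≤ X ω} := by
  have hlim : Tendsto (fun n : ℕ => D * ((n : ℝ≥0∞)⁻¹) ^ (p - 1)) atTop (𝓝 (D * 0)) := by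
    refine ENNReal.Tendsto.const_mul ?_ (Or.inr hD)
    have := (ENNReal.continuous_rpow_const (y := p - 1)).tendsto 0 |>.comp
      ENNReal.tendsto_inv_nat_nhds_zero
    rwa [ENNReal.zero_rpow_of_pos (by linarith)] at this
  rw [mul_zero] at hlim
  obtain ⟨n, hn, hn0⟩ := ((hlim.eventually (gt_mem_nhds (by simp : (0 : ℝ≥0∞) < 4⁻¹))).and
    (eventually_gt_atTop 0)).exists
  have hn0' : (n : ℝ≥0∞) ≠ 0 := by exact_mod_cast hn0.ne'
  refine ⟨4⁻¹ / n, by simp, fun X hX h1 hXp => ?_⟩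
  have hS : MeasurableSet {ω | 2⁻¹ ≤ X ω} := measurableSet_le measurable_const hX
  -- Where `X ≥ 1/2`, either `X ≤ n` or `X ≤ n^(1-p) X^p`. By the choice of `n` the last term has
  -- mean at most `1/4`, so a mean of at least `1/4` is left for `n` times the indicator.
  have hpt : ∀ ω, X ω ≤ 2⁻¹ + ({ω | 2⁻¹ ≤ X ω}.indicator (fun _ => (n : ℝ≥0∞)) ω +
      ((n : ℝ≥0∞)⁻¹) ^ (p - 1) * X ω ^ p) := by
    intro ω
    by_cases h : 2⁻¹ ≤ X ω
    · rw [Set.indicator_of_mem (s := {ω | 2⁻¹ ≤ X ω}) h]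
      refine le_add_left ?_
      rcases le_total (X ω) n with h' | h'
      · exact le_add_right h'
      · refine le_add_left ?_
        rcases eq_or_ne (X ω) ∞ with htop | htop
        · rw [htop, ENNReal.top_rpow_of_pos (by linarith), ENNReal.mul_top]
          simp [hp.le, hp]
        · have hX0 : X ω ≠ 0 := fun h0 => by simp [h0] at h
          have e : X ω ^ p = X ω ^ (p - 1) * X ω := by
            conv_rhs => rw [← ENNReal.rpow_one (X ω), ← ENNReal.rpow_mul, one_mul]
            rw [← ENNReal.rpow_add _ _ hX0 htop]
            congr 1; ring
          rw [e, ← mul_assoc, ← ENNReal.mul_rpow_of_nonneg _ _ (by linarith)]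
          refine le_mul_of_one_le_left zero_le (ENNReal.one_le_rpow ?_ (by linarith))
          calc (1 : ℝ≥0∞) = (n : ℝ≥0∞)⁻¹ * n := (ENNReal.inv_mul_cancel hn0' (by simp)).symm
            _ ≤ (n : ℝ≥0∞)⁻¹ * X ω := by gcongr
    · exact le_add_right (not_le.1 h).le
  have hint : (1 : ℝ≥0∞) ≤ 2⁻¹ + (n * P {ω | 2⁻¹ ≤ X ω} + 4⁻¹) := by
    calc (1 : ℝ≥0∞) = ∫⁻ ω, X ω ∂P := h1.symm
      _ ≤ ∫⁻ ω, (2⁻¹ + ({ω | 2⁻¹ ≤ X ω}.indicator (fun _ => (n : ℝ≥0∞)) ω +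
            ((n : ℝ≥0∞)⁻¹) ^ (p - 1) * X ω ^ p)) ∂P := lintegral_mono hpt
      _ = 2⁻¹ + (n * P {ω | 2⁻¹ ≤ X ω} + ((n : ℝ≥0∞)⁻¹) ^ (p - 1) * ∫⁻ ω, X ω ^ p ∂P) := by
          rw [lintegral_add_left measurable_const, lintegral_const, measure_univ, mul_one,
            lintegral_add_left (measurable_const.indicator hS), lintegral_indicator_const hS,
            lintegral_const_mul _ (hX.pow_const p)]
      _ ≤ 2⁻¹ + (n * P {ω | 2⁻¹ ≤ X ω} + 4⁻¹) := by
          gcongr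
          calc ((n : ℝ≥0∞)⁻¹) ^ (p - 1) * ∫⁻ ω, X ω ^ p ∂P ≤ ((n : ℝ≥0∞)⁻¹) ^ (p - 1) * D := by
                gcongr
            _ ≤ 4⁻¹ := by rw [mul_comm]; exact hn.le
  refine ENNReal.div_le_of_le_mul ?_
  rw [mul_comm]
  have e1 : (1 : ℝ≥0∞) = 4⁻¹ + (2⁻¹ + 4⁻¹) := by
    rw [← ENNReal.toReal_eq_toReal_iff' (by simp) (by simp)]
    rw [ENNReal.toReal_add (by simp) (by simp), ENNReal.toReal_add (by simp) (by simp)]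
    simp; norm_num
  have e2 : 2⁻¹ + (n * P {ω | 2⁻¹ ≤ X ω} + 4⁻¹) = n * P {ω | 2⁻¹ ≤ X ω} + (2⁻¹ + 4⁻¹) := by ring
  rw [e1, e2] at hint
  exact (ENNReal.add_le_add_iff_right (by simp)).1 hint

/-- Dividing by `b I` makes the lower bound `δ` independent of `b` and of `I`; the uniformity in `I`
is needed for the negative moments. -/
theorem IsWeight.exists_le_measure_half_le_limMass [IsProbabilityMeasure P]
    (h𝓕 : IsIndepField P 𝓕) (hU : IsWeight P 𝓕 U) {p : ℝ} (hp : 1 < p) {D : ℝ≥0∞} (hD : D ≠ ∞) :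
    ∃ δ : ℝ≥0∞, δ ≠ 0 ∧ ∀ b : Dyadic → ℝ≥0∞, (∀ I, b I = ∑ i, b (child I i)) →
      (∀ I, b I ≠ ∞) → ∀ I, b I ≠ 0 →
      (∀ n, ∫⁻ ω, subMass b (U ω) n I ^ p ∂P ≤ D * b I ^ p) →
      δ ≤ P {ω | b I / 2 ≤ limMass b (U ω) I} := by
  obtain ⟨δ, hδ, hPZ⟩ := exists_le_measure_half_le (P := P) hp hD
  refine ⟨δ, hδ, fun b hadd hfin I h0 hmom => ?_⟩
  have hmeas : ∀ n, Measurable fun ω => subMass b (U ω) n I := fun n =>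
    (hU.measurable_subMass n I).mono (h𝓕.sigmaOf_le _) le_rfl
  have hmeasL : Measurable fun ω => limMass b (U ω) I :=
    (hU.measurable_limMass I).mono (h𝓕.sigmaOf_le _) le_rfl
  have hn : ∀ n, δ ≤ P {ω | b I / 2 ≤ subMass b (U ω) n I} := by
    intro n
    have h := hPZ (fun ω => (b I)⁻¹ * subMass b (U ω) n I) ((hmeas n).const_mul _) ?_ ?_
    · refine h.trans (measure_mono fun ω hω => ?_)
      have hω : 2⁻¹ ≤ (b I)⁻¹ * subMass b (U ω) n I := hω
      calc b I / 2 ≤ b I * ((b I)⁻¹ * subMass b (U ω) n I) := by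
            rw [div_eq_mul_inv]; gcongr
        _ = subMass b (U ω) n I := by
            rw [← mul_assoc, ENNReal.mul_inv_cancel h0 (hfin I), one_mul]
    · rw [lintegral_const_mul _ (hmeas n), hU.lintegral_subMass h𝓕 hadd,
        ENNReal.inv_mul_cancel h0 (hfin I)]
    · simp only [ENNReal.mul_rpow_of_nonneg _ _ (zero_le_one.trans hp.le)]
      rw [lintegral_const_mul _ ((hmeas n).pow_const p)]
      calc (b I)⁻¹ ^ p * ∫⁻ ω, subMass b (U ω) n I ^ p ∂P ≤ (b I)⁻¹ ^ p * (D * b I ^ p) := by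
            gcongr
            exact hmom n
        _ = D * ((b I)⁻¹ * b I) ^ p := by
            rw [ENNReal.mul_rpow_of_nonneg _ _ (zero_le_one.trans hp.le)]; ring
        _ = D := by rw [ENNReal.inv_mul_cancel h0 (hfin I), ENNReal.one_rpow, mul_one]
  have hSn : ∀ n, MeasurableSet {ω | subMass b (U ω) n I < b I / 2} := fun n =>
    measurableSet_lt (hmeas n) measurable_const
  have hS : MeasurableSet {ω | limMass b (U ω) I < b I / 2} :=
    measurableSet_lt hmeasL measurable_const
  have hcompl : ∀ Y : Ω → ℝ≥0∞, {ω | b I / 2 ≤ Y ω} = {ω | Y ω < b I / 2}ᶜ := fun Y => by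
    ext ω; simp
  -- Fatou is applied to the indicators of the strict inequality: being an open condition, it passes
  -- from the limit to all large `n`.
  have key : P {ω | limMass b (U ω) I < b I / 2} ≤ 1 - δ := by
    calc P {ω | limMass b (U ω) I < b I / 2}
        = ∫⁻ ω, {ω | limMass b (U ω) I < b I / 2}.indicator 1 ω ∂P :=
          (lintegral_indicator_one hS).symm
      _ ≤ ∫⁻ ω, liminf (fun n => {ω | subMass b (U ω) n I < b I / 2}.indicator
            (1 : Ω → ℝ≥0∞) ω) atTop ∂P := by
          refine lintegral_mono_ae ?_
          filter_upwards [hU.ae_tendsto_subMass h𝓕 hadd hfin I] with ω hω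
          by_cases h : limMass b (U ω) I < b I / 2
          · rw [Set.indicator_of_mem (s := {ω | limMass b (U ω) I < b I / 2}) h]
            refine le_liminf_of_le (by isBoundedDefault) ?_
            filter_upwards [hω.1.eventually (gt_mem_nhds h)] with n hn
            rw [Set.indicator_of_mem (s := {ω | subMass b (U ω) n I < b I / 2}) hn]
          · rw [Set.indicator_of_notMem (s := {ω | limMass b (U ω) I < b I / 2}) h]
            exact zero_le
      _ ≤ liminf (fun n => ∫⁻ ω, {ω | subMass b (U ω) n I < b I / 2}.indicator
            (1 : Ω → ℝ≥0∞) ω ∂P) atTop :=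
          lintegral_liminf_le fun n => measurable_one.indicator (hSn n)
      _ ≤ liminf (fun _ : ℕ => 1 - δ) atTop := by
          refine liminf_le_liminf (Eventually.of_forall fun n => ?_)
          rw [lintegral_indicator_one (hSn n)]
          have h := hn n
          rw [hcompl, prob_compl_eq_one_sub (hSn n)] at h
          exact ENNReal.le_sub_of_add_le_left (ne_top_of_le_ne_top ENNReal.one_ne_top
            (h.trans tsub_le_self)) (by
              calc δ + P {ω | subMass b (U ω) n I < b I / 2}
                  ≤ 1 - P {ω | subMass b (U ω) n I < b I / 2} +
                    P {ω | subMass b (U ω) n I < b I / 2} := by gcongr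
                _ = 1 := tsub_add_cancel_of_le prob_le_one)
      _ = 1 - δ := liminf_const _
  have hδ1 : δ ≤ 1 := (hn 0).trans prob_le_one
  rw [hcompl, prob_compl_eq_one_sub hS]
  calc δ = 1 - (1 - δ) := (ENNReal.sub_sub_cancel ENNReal.one_ne_top hδ1).symm
    _ ≤ 1 - P {ω | limMass b (U ω) I < b I / 2} := tsub_le_tsub_left key 1

/-- Kolmogorov's zero-one law for the event that the cascade degenerates. -/
theorem IsWeight.limMass_root_zero_or_one [IsProbabilityMeasure P] (h𝓕 : IsIndepField P 𝓕)
    (hU : IsWeight P 𝓕 U) : P {ω | limMass b (U ω) ⟨0, 0⟩ = 0} = 0 ∨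
      P {ω | limMass b (U ω) ⟨0, 0⟩ = 0} = 1 := by
  refine measure_zero_or_one_of_measurableSet_limsup (s := 𝓕) (f := cofinite)
    (p := Set.Finite) (ns := fun F : Finset Dyadic => (F : Set Dyadic)) h𝓕.le h𝓕.indep
    (fun t ht => ht.compl_mem_cofinite)
    (directed_of_isDirected_le fun F G h => Finset.coe_subset.2 h) (fun F => F.finite_toSet)
    (fun I => ⟨{I}, by simp⟩) ?_
  rw [limsup_eq_iInf_iSup]
  rw [MeasurableSpace.measurableSet_iInf]
  intro T
  rw [MeasurableSpace.measurableSet_iInf]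
  intro hT
  -- A cofinite set of intervals contains all levels from some `N` on, and degeneracy at the root is
  -- decided by the subtrees of level `N`.
  obtain ⟨N, hN⟩ : ∃ N, ∀ J : Dyadic, N ≤ J.1 → J ∈ T := by
    have hfin : (Tᶜ).Finite := hT
    obtain ⟨N, hN⟩ := (hfin.image Sigma.fst).bddAbove
    refine ⟨N + 1, fun J hJ => ?_⟩
    by_contra h
    have := hN ⟨J, h, rfl⟩
    omega
  have hset : {ω | limMass b (U ω) ⟨0, 0⟩ = 0} =
      ⋂ k : Fin (2 ^ N), {ω | limMass b (U ω) ⟨N, k⟩ = 0} := by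
    ext ω
    simp only [Set.mem_ofPred_eq, Set.mem_iInter]
    exact limMass_root_eq_zero_iff (hU.ne_zero ω) (hU.ne_top ω) N
  rw [hset]
  refine MeasurableSet.iInter fun k => ?_
  have hle : sigmaOf 𝓕 (descendants ⟨N, k⟩) ≤ sigmaOf 𝓕 T :=
    sigmaOf_mono fun J hJ => hN J hJ.1
  exact ((hU.measurable_limMass ⟨N, k⟩).mono hle le_rfl) (measurableSet_singleton 0)

/-! ### Almost sure properties -/

theorem IsWeight.lintegral_pathProd_rpow_le [IsProbabilityMeasure P] (h𝓕 : IsIndepField P 𝓕)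
    (hU : IsWeight P 𝓕 U) {p : ℝ} (hp : 0 ≤ p) {u : ℝ≥0∞} (hu : ∀ I, ∫⁻ ω, U ω I ^ p ∂P ≤ u)
    (n : ℕ) (k : Fin (2 ^ n)) : ∫⁻ ω, pathProd (U ω) n k ^ p ∂P ≤ u ^ n := by
  induction n with
  | zero => simp [pathProd]
  | succ n ih =>
    simp only [pathProd_succ, ENNReal.mul_rpow_of_nonneg _ _ hp]
    rw [h𝓕.lintegral_mul (S := {J | J.1 < n}) (T := {⟨n, parent k⟩}) (by simp)
      ((hU.measurable_pathProd n _).pow_const p)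
      ((hU.measurable_of_mem (Set.mem_singleton _)).pow_const p), pow_succ]
    exact mul_le_mul' (ih _) (hu _)

theorem IsWeight.lintegral_cascadeMass_rpow [IsProbabilityMeasure P] (h𝓕 : IsIndepField P 𝓕)
    (hU : IsWeight P 𝓕 U) {p : ℝ} (hp : 0 ≤ p) (I : Dyadic) :
    ∫⁻ ω, cascadeMass b (U ω) I ^ p ∂P =
      (∫⁻ ω, pathProd (U ω) I.1 I.2 ^ p ∂P) * ∫⁻ ω, limMass b (U ω) I ^ p ∂P := by
  simp only [cascadeMass, ENNReal.mul_rpow_of_nonneg _ _ hp]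
  exact h𝓕.lintegral_mul (disjoint_level_descendants I)
    ((hU.measurable_pathProd _ _).pow_const p) ((hU.measurable_limMass I).pow_const p)

theorem eventually_small_of_tsum_rpow_ne_top {m : Dyadic → ℝ≥0∞} {p : ℝ} (hp : 0 < p)
    (h : ∑' I, m I ^ p ≠ ∞) {ε : ℝ≥0∞} (hε : 0 < ε) : ∃ n, ∀ k, m ⟨n, k⟩ ≤ ε := by
  have hε' : (0 : ℝ≥0∞) < min ε 1 ^ p :=
    ENNReal.rpow_pos (lt_min hε one_pos) (ne_top_of_le_ne_top ENNReal.one_ne_top (min_le_right _ _))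
  have hev := (ENNReal.tendsto_cofinite_zero_of_tsum_ne_top h).eventually (gt_mem_nhds hε')
  have hfin : {I : Dyadic | ¬ m I ^ p < min ε 1 ^ p}.Finite := hev
  obtain ⟨N, hN⟩ := (hfin.image Sigma.fst).bddAbove
  refine ⟨N + 1, fun k => ?_⟩
  have : m ⟨N + 1, k⟩ ^ p < min ε 1 ^ p := by
    by_contra hcon
    have := hN ⟨⟨N + 1, k⟩, hcon, rfl⟩
    simp at this
  exact ((ENNReal.rpow_lt_rpow_iff hp).1 this).le.trans (min_le_left _ _)

/-- Almost sure convergence of the masses of a nondegenerate cascade to a mass distribution without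
atoms. -/
theorem IsWeight.ae_cascadeMass [IsProbabilityMeasure P] (h𝓕 : IsIndepField P 𝓕)
    (hU : IsWeight P 𝓕 U) (hadd : ∀ I, b I = ∑ i, b (child I i)) {p : ℝ} (hp1 : 1 < p)
    (hp2 : p ≤ 2) {u q : ℝ≥0∞} (hu : ∀ I, ∫⁻ ω, U ω I ^ p ∂P ≤ u) (hutop : u ≠ ∞)
    (huq : u * q ^ (p - 1) < 1) (hbq : ∀ I, b I ≤ q ^ I.1) (hq : q ≠ ∞) :
    ∀ᵐ ω ∂P, (∀ I, Tendsto (fun n => subMass b (U ω) n I) atTop (𝓝 (limMass b (U ω) I))) ∧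
      (∀ I, cascadeMass b (U ω) I = ∑ i, cascadeMass b (U ω) (child I i)) ∧
      (∀ I, cascadeMass b (U ω) I ≠ ∞) ∧
      ∀ ε : ℝ≥0∞, 0 < ε → ∃ n, ∀ k, cascadeMass b (U ω) ⟨n, k⟩ ≤ ε := by
  have hfin : ∀ I, b I ≠ ∞ := fun I => ne_top_of_le_ne_top (ENNReal.pow_ne_top hq) (hbq I)
  have hp0 : 0 ≤ p := zero_le_one.trans hp1.le
  obtain ⟨B, hBtop, hB⟩ := hU.exists_lintegral_subMass_rpow_le h𝓕 hp1 hp2 hu hutop huq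
  have hmeas : ∀ I, Measurable fun ω => cascadeMass b (U ω) I ^ p := fun I =>
    (((hU.measurable_pathProd _ _).mono (h𝓕.sigmaOf_le _) le_rfl).mul
      ((hU.measurable_limMass I).mono (h𝓕.sigmaOf_le _) le_rfl)).pow_const p
  -- The expected sum of the `p`-th powers over level `n` decays geometrically, like `(u q^(p-1))ⁿ`.
  -- Almost surely the powers are thus summable and the masses tend to zero uniformly, which
  -- excludes atoms.
  have hsum : ∫⁻ ω, ∑' I, cascadeMass b (U ω) I ^ p ∂P ≠ ∞ := by
    rw [lintegral_tsum fun I => (hmeas I).aemeasurable, ENNReal.tsum_sigma']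
    have hle : ∀ n, ∑' k : Fin (2 ^ n), ∫⁻ ω, cascadeMass b (U ω) ⟨n, k⟩ ^ p ∂P ≤
        B * b ⟨0, 0⟩ * (u * q ^ (p - 1)) ^ n := by
      intro n
      rw [tsum_fintype]
      calc ∑ k : Fin (2 ^ n), ∫⁻ ω, cascadeMass b (U ω) ⟨n, k⟩ ^ p ∂P
          ≤ ∑ k : Fin (2 ^ n), u ^ n * (B * b ⟨n, k⟩ * (q ^ (p - 1)) ^ n) := by
            refine Finset.sum_le_sum fun k _ => ?_
            rw [hU.lintegral_cascadeMass_rpow h𝓕 hp0]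
            exact mul_le_mul' (hU.lintegral_pathProd_rpow_le h𝓕 hp0 hu n k)
              (hU.lintegral_limMass_rpow_le h𝓕 hadd hfin _ fun N => hB b hadd hbq N _)
        _ = B * (∑ k : Fin (2 ^ n), b ⟨n, k⟩) * (u * q ^ (p - 1)) ^ n := by
            rw [Finset.mul_sum, Finset.sum_mul]
            exact Finset.sum_congr rfl fun k _ => by rw [mul_pow]; ring
        _ = _ := by rw [sum_level_eq hadd]
    refine ne_top_of_le_ne_top ?_ (ENNReal.tsum_le_tsum hle)
    rw [ENNReal.tsum_mul_left, ENNReal.tsum_geometric]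
    refine ENNReal.mul_ne_top (ENNReal.mul_ne_top hBtop (hfin _)) (ENNReal.inv_ne_top.2 ?_)
    rw [Ne, tsub_eq_zero_iff_le, not_le]
    exact huq
  have h1 : ∀ᵐ ω ∂P, ∀ I, Tendsto (fun n => subMass b (U ω) n I) atTop
      (𝓝 (limMass b (U ω) I)) ∧ limMass b (U ω) I ≠ ∞ :=
    ae_all_iff.2 fun I => hU.ae_tendsto_subMass h𝓕 hadd hfin I
  have hpath : ∀ ω n k, pathProd (U ω) n k ≠ ∞ := by
    intro ω n
    induction n with
    | zero => simp [pathProd]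
    | succ n ih => exact fun k => ENNReal.mul_ne_top (ih _) (hU.ne_top _ _)
  filter_upwards [h1, ae_lt_top' (AEMeasurable.tsum fun I => (hmeas I).aemeasurable) hsum]
    with ω hω hω'
  refine ⟨fun I => (hω I).1, cascadeMass_eq_sum (hU.ne_top ω) fun I => (hω I).1,
    fun I => ENNReal.mul_ne_top (hpath ω _ _) (hω I).2, fun ε hε => ?_⟩
  exact eventually_small_of_tsum_rpow_ne_top (zero_lt_one.trans hp1) hω'.ne hε

/-- The Paley–Zygmund bound makes survival possible with positive probability, and the zero-one law
makes it certain. -/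
theorem IsWeight.ae_limMass_root_ne_zero [IsProbabilityMeasure P] (h𝓕 : IsIndepField P 𝓕)
    (hU : IsWeight P 𝓕 U) (hadd : ∀ I, b I = ∑ i, b (child I i)) {p : ℝ} (hp1 : 1 < p)
    (hp2 : p ≤ 2) {u q : ℝ≥0∞} (hu : ∀ I, ∫⁻ ω, U ω I ^ p ∂P ≤ u) (hutop : u ≠ ∞)
    (huq : u * q ^ (p - 1) < 1) (hbq : ∀ I, b I ≤ q ^ I.1) (hq : q ≠ ∞) (h0 : b ⟨0, 0⟩ ≠ 0) :
    ∀ᵐ ω ∂P, limMass b (U ω) ⟨0, 0⟩ ≠ 0 := by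
  have hfin : ∀ I, b I ≠ ∞ := fun I => ne_top_of_le_ne_top (ENNReal.pow_ne_top hq) (hbq I)
  have hp0 : 0 ≤ p := zero_le_one.trans hp1.le
  obtain ⟨B, hBtop, hB⟩ := hU.exists_lintegral_subMass_rpow_le h𝓕 hp1 hp2 hu hutop huq
  have hbp0 : b ⟨0, 0⟩ ^ p ≠ 0 := by simp [h0, hfin]
  have hbptop : b ⟨0, 0⟩ ^ p ≠ ∞ := ENNReal.rpow_ne_top_of_nonneg hp0 (hfin _)
  obtain ⟨δ, hδ, hPZ⟩ := hU.exists_le_measure_half_le_limMass h𝓕 hp1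
    (D := B * b ⟨0, 0⟩ * (b ⟨0, 0⟩ ^ p)⁻¹)
    (ENNReal.mul_ne_top (ENNReal.mul_ne_top hBtop (hfin _)) (ENNReal.inv_ne_top.2 hbp0))
  have h := hPZ b hadd hfin ⟨0, 0⟩ h0 fun n => by
    rw [mul_assoc _ (b ⟨0, 0⟩ ^ p)⁻¹, ENNReal.inv_mul_cancel hbp0 hbptop, mul_one]
    simpa using hB b hadd hbq n ⟨0, 0⟩
  rw [ae_iff]
  simp only [not_not]
  refine (hU.limMass_root_zero_or_one h𝓕).resolve_right fun h1 => hδ (le_antisymm (h.trans ?_)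
    zero_le)
  have hS : MeasurableSet {ω | limMass b (U ω) ⟨0, 0⟩ = 0} :=
    ((hU.measurable_limMass ⟨0, 0⟩).mono (h𝓕.sigmaOf_le _) le_rfl) (measurableSet_singleton 0)
  rw [← prob_compl_eq_zero_iff hS] at h1
  rw [← h1]
  refine measure_mono fun ω hω hz => ?_
  have hω : b ⟨0, 0⟩ / 2 ≤ limMass b (U ω) ⟨0, 0⟩ := hω
  have hz : limMass b (U ω) ⟨0, 0⟩ = 0 := hz
  rw [hz] at hω
  exact (ENNReal.div_pos h0 (by simp)).ne' (le_antisymm hω zero_le)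

end Cascade

namespace Cascade

open scoped ENNReal NNReal

variable {Ω : Type*} {mΩ : MeasurableSpace Ω} {P : Measure Ω}
  {𝓕 : Dyadic → MeasurableSpace Ω} {U : Ω → Dyadic → ℝ≥0∞}

/-! ### Negative moments of the masses -/

theorem mul_rpow_neg {x y : ℝ≥0∞} (hx0 : x ≠ 0) (hx : x ≠ ∞) {p : ℝ} (hp : 0 ≤ p) :
    (x * y) ^ (-p) = x ^ (-p) * y ^ (-p) := by
  rw [ENNReal.rpow_neg, ENNReal.mul_rpow_of_nonneg _ _ hp, ENNReal.rpow_neg, ENNReal.rpow_neg,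
    ENNReal.mul_inv (Or.inl (by simp [hx0, hx])) (Or.inl (ENNReal.rpow_ne_top_of_nonneg hp hx))]

theorem rpow_neg_le_rpow_neg {x y : ℝ≥0∞} (h : x ≤ y) {p : ℝ} (hp : 0 ≤ p) :
    y ^ (-p) ≤ x ^ (-p) := by
  rw [ENNReal.rpow_neg, ENNReal.rpow_neg]
  exact ENNReal.inv_le_inv.2 (ENNReal.rpow_le_rpow h hp)

theorem disjoint_singleton_descendants_children (I : Dyadic) :
    Disjoint {I} (descendants (child I 0) ∪ descendants (child I 1)) :=
  (disjoint_singleton_descendants_child I 0).union_right (disjoint_singleton_descendants_child I 1)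

/-- `Z I` dominates a multiple of either child's variable. The first child is used unless it is
below `x`; in that case, of probability at most `q`, the second, independent child is used. The
supremum `f` of the moments then satisfies `f ≤ C (x⁻ᵖ + q f)`, which bounds `f` when `C q < 1`. -/
theorem IsWeight.exists_lintegral_rpow_neg_le_of_mul_lt_one [IsProbabilityMeasure P]
    (h𝓕 : IsIndepField P 𝓕) (hU : IsWeight P 𝓕 U) {Z : Dyadic → Ω → ℝ≥0∞}
    (hZ : ∀ I, Measurable[sigmaOf 𝓕 (descendants I)] (Z I))
    (hge : ∀ I i ω, U ω I / 2 * Z (child I i) ω ≤ Z I ω) {p : ℝ} (hp : 0 < p)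
    {x q C : ℝ≥0∞} (hx : x ≠ 0) (hq : ∀ I, P {ω | Z I ω < x} ≤ q) (hCtop : C ≠ ∞)
    (hC : ∀ I, ∫⁻ ω, max 1 ((U ω I / 2) ^ (-p)) ∂P ≤ C) (hCq : C * q < 1) :
    ∃ D : ℝ≥0∞, D ≠ ∞ ∧ ∀ I, ∫⁻ ω, Z I ω ^ (-p) ∂P ≤ D := by
  have hxp : x ^ (-p) ≠ ∞ := by
    rw [ENNReal.rpow_neg]
    exact ENNReal.inv_ne_top.2 fun h => hx ((ENNReal.rpow_eq_zero_iff_of_pos hp).1 h)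
  have hsub : 1 - C * q ≠ 0 := by rwa [Ne, tsub_eq_zero_iff_le, not_le]
  refine ⟨C * x ^ (-p) / (1 - C * q),
    ENNReal.div_ne_top (ENNReal.mul_ne_top hCtop hxp) hsub, fun I => ?_⟩
  have hZm : ∀ I, Measurable (Z I) := fun I => (hZ I).mono (h𝓕.sigmaOf_le _) le_rfl
  have hpt : ∀ (n : ℕ) I ω, min (Z I ω ^ (-p)) n ≤ max 1 ((U ω I / 2) ^ (-p)) *
      (x ^ (-p) + {ω | Z (child I 0) ω < x}.indicator 1 ω *
        min (Z (child I 1) ω ^ (-p)) n) := by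
    intro n I ω
    have hi : ∀ i, Z I ω ^ (-p) ≤ (U ω I / 2) ^ (-p) * Z (child I i) ω ^ (-p) := by
      intro i
      rw [← mul_rpow_neg (ENNReal.div_pos (hU.ne_zero ω I) (by simp)).ne'
        (ENNReal.div_ne_top (hU.ne_top ω I) (by simp)) hp.le]
      exact rpow_neg_le_rpow_neg (hge I i ω) hp.le
    by_cases h : Z (child I 0) ω < x
    · rw [Set.indicator_of_mem (s := {ω | Z (child I 0) ω < x}) h, Pi.one_apply, one_mul]
      refine le_trans ?_ (mul_le_mul_right le_add_self _)
      rw [mul_min]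
      refine min_le_min ((hi 1).trans ?_) ?_
      · gcongr
        exact le_max_right _ _
      · exact le_mul_of_one_le_left zero_le (le_max_left _ _)
    · refine le_trans ?_ (mul_le_mul_right le_self_add _)
      refine (min_le_left _ _).trans ((hi 0).trans ?_)
      exact mul_le_mul' (le_max_right _ _) (rpow_neg_le_rpow_neg (not_lt.1 h) hp.le)
  -- Truncation at `n` makes the supremum finite, so that the self-bound may be solved for it; the
  -- result does not depend on `n`.
  have hbound : ∀ (n : ℕ) I, ∫⁻ ω, min (Z I ω ^ (-p)) n ∂P ≤ C * x ^ (-p) / (1 - C * q) := by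
    intro n
    set f : ℝ≥0∞ := ⨆ I, ∫⁻ ω, min (Z I ω ^ (-p)) n ∂P with hf
    have hftop : f ≠ ∞ := by
      refine ne_top_of_le_ne_top (ENNReal.natCast_ne_top n) (iSup_le fun I => ?_)
      calc ∫⁻ ω, min (Z I ω ^ (-p)) n ∂P ≤ ∫⁻ _, (n : ℝ≥0∞) ∂P :=
            lintegral_mono fun ω => min_le_right _ _
        _ = n := by simp
    have hmain : f ≤ C * (x ^ (-p) + q * f) := by
      refine iSup_le fun I => (lintegral_mono (hpt n I)).trans ?_
      have hS : MeasurableSet[sigmaOf 𝓕 (descendants (child I 0))] {ω | Z (child I 0) ω < x} :=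
        (hZ (child I 0)) measurableSet_Iio
      have hind : Measurable[sigmaOf 𝓕 (descendants (child I 0))]
          ({ω | Z (child I 0) ω < x}.indicator (1 : Ω → ℝ≥0∞)) :=
        Measurable.indicator
          (@measurable_const _ _ _ (sigmaOf 𝓕 (descendants (child I 0))) 1) hS
      have hmin : Measurable[sigmaOf 𝓕 (descendants (child I 1))]
          fun ω => min (Z (child I 1) ω ^ (-p)) n :=
        ((hZ (child I 1)).pow_const _).min measurable_const
      have hprod : Measurable[sigmaOf 𝓕 (descendants (child I 0) ∪ descendants (child I 1))]
          fun ω => x ^ (-p) + {ω | Z (child I 0) ω < x}.indicator 1 ω *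
            min (Z (child I 1) ω ^ (-p)) n :=
        Measurable.add measurable_const
          ((hind.mono (sigmaOf_mono Set.subset_union_left) le_rfl).mul
            (hmin.mono (sigmaOf_mono Set.subset_union_right) le_rfl))
      rw [h𝓕.lintegral_mul (disjoint_singleton_descendants_children I)
        (Measurable.max measurable_const
          (((hU.measurable_of_mem (Set.mem_singleton I)).div_const 2).pow_const _)) hprod,
        lintegral_add_left measurable_const, lintegral_const, measure_univ, mul_one,
        h𝓕.lintegral_mul (disjoint_descendants (I := child I 0) (J := child I 1) rfl
          (child_ne (by decide))) hind hmin,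
        lintegral_indicator_one (h𝓕.sigmaOf_le _ _ hS)]
      gcongr
      · exact hC I
      · exact hq _
      · exact le_iSup (fun I => ∫⁻ ω, min (Z I ω ^ (-p)) n ∂P) _
    have hfle : f ≤ C * x ^ (-p) / (1 - C * q) := by
      rw [ENNReal.le_div_iff_mul_le (Or.inl hsub) (Or.inl (ne_top_of_le_ne_top
        ENNReal.one_ne_top tsub_le_self)), ENNReal.mul_sub fun _ _ => hftop, mul_one]
      refine tsub_le_iff_right.2 (hmain.trans_eq ?_)
      ring
    exact fun I => (le_iSup (fun I => ∫⁻ ω, min (Z I ω ^ (-p)) n ∂P) I).trans hfle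
  have hsup : ∀ ω, Z I ω ^ (-p) = ⨆ n : ℕ, min (Z I ω ^ (-p)) n := fun ω => by
    rw [← inf_iSup_eq, ENNReal.iSup_natCast, inf_top_eq]
  rw [lintegral_congr hsup, lintegral_iSup (fun n => ((hZm I).pow_const _).min measurable_const)
    fun m n hmn ω => min_le_min le_rfl (Nat.cast_le.2 hmn)]
  exact iSup_le fun n => hbound n I

/-- A bootstrap in two rounds. For a tiny exponent the constant `C` is close enough to `1` for the
crude bound `1 - δ` on the small values. The resulting moment makes small values as unlikely as
needed for any exponent. -/
theorem IsWeight.exists_lintegral_rpow_neg_le [IsProbabilityMeasure P]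
    (h𝓕 : IsIndepField P 𝓕) (hU : IsWeight P 𝓕 U) {Z : Dyadic → Ω → ℝ≥0∞}
    (hZ : ∀ I, Measurable[sigmaOf 𝓕 (descendants I)] (Z I))
    (hge : ∀ I i ω, U ω I / 2 * Z (child I i) ω ≤ Z I ω)
    (hneg : ∀ p : ℝ, 0 < p → ∃ c : ℝ≥0∞, c ≠ ∞ ∧ ∀ I, ∫⁻ ω, U ω I ^ (-p) ∂P ≤ c)
    {δ : ℝ≥0∞} (hδ : δ ≠ 0) (hδZ : ∀ I, δ ≤ P {ω | 2⁻¹ ≤ Z I ω}) {p : ℝ} (hp : 0 < p) :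
    ∃ D : ℝ≥0∞, D ≠ ∞ ∧ ∀ I, ∫⁻ ω, Z I ω ^ (-p) ∂P ≤ D := by
  have hZm : ∀ I, Measurable (Z I) := fun I => (hZ I).mono (h𝓕.sigmaOf_le _) le_rfl
  have hUm : ∀ I, Measurable fun ω => U ω I := fun I => (hU.meas I).mono (h𝓕.le I) le_rfl
  have hA : ∀ p : ℝ, 0 < p → ∃ A : ℝ≥0∞, A ≠ ∞ ∧
      ∀ I, ∫⁻ ω, max 1 ((U ω I / 2) ^ (-p)) ∂P ≤ A := by
    intro p hp
    obtain ⟨c, hc, hcU⟩ := hneg p hp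
    refine ⟨1 + c * 2⁻¹ ^ (-p), ENNReal.add_ne_top.2 ⟨ENNReal.one_ne_top,
      ENNReal.mul_ne_top hc ?_⟩, fun I => ?_⟩
    · rw [ENNReal.rpow_neg]
      exact ENNReal.inv_ne_top.2 fun h => by simpa using (ENNReal.rpow_eq_zero_iff_of_pos hp).1 h
    · calc ∫⁻ ω, max 1 ((U ω I / 2) ^ (-p)) ∂P
          ≤ ∫⁻ ω, (1 + U ω I ^ (-p) * 2⁻¹ ^ (-p)) ∂P := by
            refine lintegral_mono fun ω => ?_
            rw [div_eq_mul_inv, mul_rpow_neg (hU.ne_zero ω I) (hU.ne_top ω I) hp.le]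
            exact max_le le_self_add le_add_self
        _ = 1 + (∫⁻ ω, U ω I ^ (-p) ∂P) * 2⁻¹ ^ (-p) := by
            rw [lintegral_add_left measurable_const, lintegral_const, measure_univ, mul_one,
              lintegral_mul_const _ ((hUm I).pow_const _)]
        _ ≤ _ := by gcongr; exact hcU I
  obtain ⟨r, D, hr, hD, hDZ⟩ : ∃ (r : ℝ) (D : ℝ≥0∞), 0 < r ∧ D ≠ ∞ ∧
      ∀ I, ∫⁻ ω, Z I ω ^ (-r) ∂P ≤ D := by
    obtain ⟨A, hAtop, hAU⟩ := hA 1 one_pos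
    have hq1 : 1 - δ < 1 := ENNReal.sub_lt_self ENNReal.one_ne_top one_ne_zero hδ
    have hlim := ENNReal.Tendsto.const_mul
      (ENNReal.tendsto_pow_atTop_nhds_zero_of_lt_one hq1) (Or.inr hAtop)
    rw [mul_zero] at hlim
    obtain ⟨n, hn, hn0⟩ := ((hlim.eventually (gt_mem_nhds one_pos)).and
      (eventually_gt_atTop 0)).exists
    have hn0' : (0 : ℝ) < n := by exact_mod_cast hn0
    have hn1 : (n : ℝ)⁻¹ ≤ 1 := inv_le_one_of_one_le₀ (by exact_mod_cast hn0)
    have hr : 0 < (n : ℝ)⁻¹ := inv_pos.2 hn0'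
    refine ⟨(n : ℝ)⁻¹, ?_⟩
    simp only [hr, true_and]
    refine hU.exists_lintegral_rpow_neg_le_of_mul_lt_one h𝓕 hZ hge hr
      (x := 2⁻¹) (q := 1 - δ) (C := A ^ (n : ℝ)⁻¹) (by simp) ?_
      (ENNReal.rpow_ne_top_of_nonneg hr.le hAtop) ?_ ?_
    · intro I
      have hS : MeasurableSet {ω | 2⁻¹ ≤ Z I ω} := measurableSet_le measurable_const (hZm I)
      have : {ω | Z I ω < 2⁻¹} = {ω | 2⁻¹ ≤ Z I ω}ᶜ := by ext ω; simp
      rw [this, prob_compl_eq_one_sub hS]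
      exact tsub_le_tsub_left (hδZ I) 1
    · intro I
      have hm : Measurable fun ω => max 1 ((U ω I / 2) ^ (-1 : ℝ)) :=
        Measurable.max measurable_const (((hUm I).div_const 2).pow_const _)
      calc ∫⁻ ω, max 1 ((U ω I / 2) ^ (-(n : ℝ)⁻¹)) ∂P
          = ∫⁻ ω, (max 1 ((U ω I / 2) ^ (-1 : ℝ))) ^ (n : ℝ)⁻¹ ∂P := by
            refine lintegral_congr fun ω => ?_
            rw [(ENNReal.monotone_rpow_of_nonneg hr.le).map_max, ENNReal.one_rpow,
              ← ENNReal.rpow_mul]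
            ring_nf
        _ ≤ (∫⁻ ω, max 1 ((U ω I / 2) ^ (-1 : ℝ)) ∂P) ^ (n : ℝ)⁻¹ :=
            lintegral_rpow_le_rpow_lintegral hm hr hn1
        _ ≤ A ^ (n : ℝ)⁻¹ := by gcongr; exact hAU I
    · have e : A ^ (n : ℝ)⁻¹ * (1 - δ) = (A * (1 - δ) ^ n) ^ (n : ℝ)⁻¹ := by
        rw [ENNReal.mul_rpow_of_nonneg _ _ hr.le, ← ENNReal.rpow_natCast (1 - δ),
          ← ENNReal.rpow_mul, mul_inv_cancel₀ hn0'.ne', ENNReal.rpow_one]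
      rw [e]
      exact ENNReal.rpow_lt_one hn hr
  obtain ⟨C, hC, hCU⟩ := hA p hp
  obtain ⟨x, hx0, hxtop, hx⟩ : ∃ x : ℝ≥0∞, x ≠ 0 ∧ x ≠ ∞ ∧ C * (x ^ r * D) < 1 := by
    have hlim : Tendsto (fun n : ℕ => C * ((n : ℝ≥0∞)⁻¹ ^ r * D)) atTop (𝓝 (C * (0 * D))) := by
      refine ENNReal.Tendsto.const_mul (ENNReal.Tendsto.mul_const ?_ (Or.inr hD)) (Or.inr hC)
      have := (ENNReal.continuous_rpow_const (y := r)).tendsto 0 |>.comp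
        ENNReal.tendsto_inv_nat_nhds_zero
      rwa [ENNReal.zero_rpow_of_pos hr] at this
    rw [zero_mul, mul_zero] at hlim
    obtain ⟨n, hn, hn0⟩ := ((hlim.eventually (gt_mem_nhds one_pos)).and
      (eventually_gt_atTop 0)).exists
    exact ⟨(n : ℝ≥0∞)⁻¹, by simp, by simpa using hn0.ne', hn⟩
  -- Markov's inequality for the small exponent `r` gives `P(Z < x) ≤ xʳ D`.
  refine hU.exists_lintegral_rpow_neg_le_of_mul_lt_one h𝓕 hZ hge hp hx0
    (q := x ^ r * D) (fun I => ?_) hC hCU hx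
  have h1 : P {ω | Z I ω < x} ≤ P {ω | x ^ (-r) ≤ Z I ω ^ (-r)} :=
    measure_mono fun ω (hω : Z I ω < x) => rpow_neg_le_rpow_neg hω.le hr.le
  have h2 := mul_meas_ge_le_lintegral (μ := P) ((hZm I).pow_const (-r)) (x ^ (-r))
  calc P {ω | Z I ω < x} ≤ P {ω | x ^ (-r) ≤ Z I ω ^ (-r)} := h1
    _ = x ^ r * (x ^ (-r) * P {ω | x ^ (-r) ≤ Z I ω ^ (-r)}) := by
        rw [← mul_assoc, ← ENNReal.rpow_add _ _ hx0 hxtop]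
        simp
    _ ≤ x ^ r * D := by gcongr; exact h2.trans (hDZ I)

/-! ### Lebesgue base mass -/

/-- The Lebesgue measure of a dyadic interval. -/
noncomputable def lebMass (I : Dyadic) : ℝ≥0∞ := 2⁻¹ ^ I.1

theorem lebMass_eq_sum (I : Dyadic) : lebMass I = ∑ i, lebMass (child I i) := by
  simp only [lebMass, Finset.sum_const, Finset.card_univ, Fintype.card_fin, nsmul_eq_mul, pow_succ]
  rw [Nat.cast_ofNat, mul_comm, mul_assoc, ENNReal.inv_mul_cancel (by simp) (by simp), mul_one]

theorem lebMass_ne_top (I : Dyadic) : lebMass I ≠ ∞ := ENNReal.pow_ne_top (by simp)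

theorem lebMass_ne_zero (I : Dyadic) : lebMass I ≠ 0 := pow_ne_zero _ (by simp)

theorem two_pow_mul_lebMass (I : Dyadic) : 2 ^ I.1 * lebMass I = 1 := by
  rw [lebMass, ← mul_pow, ENNReal.mul_inv_cancel (by simp) (by simp), one_pow]

/-- Uniform bounds for the negative moments of the normalized masses. -/
theorem IsWeight.exists_lintegral_limMass_rpow_neg_le [IsProbabilityMeasure P]
    (h𝓕 : IsIndepField P 𝓕) (hU : IsWeight P 𝓕 U) {p : ℝ} (hp1 : 1 < p)
    (hp2 : p ≤ 2) {u : ℝ≥0∞} (hu : ∀ I, ∫⁻ ω, U ω I ^ p ∂P ≤ u) (hutop : u ≠ ∞)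
    (huq : u * 2⁻¹ ^ (p - 1) < 1)
    (hneg : ∀ p : ℝ, 0 < p → ∃ c : ℝ≥0∞, c ≠ ∞ ∧ ∀ I, ∫⁻ ω, U ω I ^ (-p) ∂P ≤ c)
    {r : ℝ} (hr : 0 < r) : ∃ D : ℝ≥0∞, D ≠ ∞ ∧
      ∀ I, ∫⁻ ω, (2 ^ I.1 * limMass lebMass (U ω) I) ^ (-r) ∂P ≤ D := by
  obtain ⟨B, hBtop, hB⟩ := hU.exists_lintegral_subMass_rpow_le h𝓕 hp1 hp2 hu hutop huq
  obtain ⟨δ, hδ, hPZ⟩ := hU.exists_le_measure_half_le_limMass h𝓕 hp1 hBtop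
  refine hU.exists_lintegral_rpow_neg_le h𝓕
    (Z := fun I ω => 2 ^ I.1 * limMass lebMass (U ω) I)
    (fun I => (hU.measurable_limMass I).const_mul _) (fun I i ω => ?_) hneg hδ (fun I => ?_) hr
  · calc U ω I / 2 * (2 ^ (I.1 + 1) * limMass lebMass (U ω) (child I i))
        = (2⁻¹ * 2) * (2 ^ I.1 * (U ω I * limMass lebMass (U ω) (child I i))) := by
          rw [div_eq_mul_inv]; ring
      _ = 2 ^ I.1 * (U ω I * limMass lebMass (U ω) (child I i)) := by
          rw [ENNReal.inv_mul_cancel (by simp) (by simp), one_mul]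
      _ ≤ _ := by gcongr; exact limMass_ge_child (hU.ne_top ω I) i
  · refine (hPZ lebMass lebMass_eq_sum lebMass_ne_top I (lebMass_ne_zero I) fun n => ?_).trans
      (measure_mono fun ω (hω : lebMass I / 2 ≤ limMass lebMass (U ω) I) => ?_)
    · refine (hB lebMass lebMass_eq_sum (fun _ => le_rfl) n I).trans_eq ?_
      rw [mul_assoc]
      congr 1
      conv_rhs => rw [← add_sub_cancel 1 p, ENNReal.rpow_add _ _ (lebMass_ne_zero I)
        (lebMass_ne_top I), ENNReal.rpow_one]
      congr 1
      rw [lebMass, ← ENNReal.rpow_natCast, ← ENNReal.rpow_natCast, ← ENNReal.rpow_mul,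
        ← ENNReal.rpow_mul, mul_comm]
    · calc (2 : ℝ≥0∞)⁻¹ = 2 ^ I.1 * (lebMass I / 2) := by
            rw [div_eq_mul_inv, ← mul_assoc, two_pow_mul_lebMass, one_mul]
        _ ≤ _ := by gcongr

end Cascade

namespace Cascade

open scoped ENNReal NNReal

variable {Ω : Type*} {mΩ : MeasurableSpace Ω} {P : Measure Ω} {a : ℝ} {G : Dyadic → Ω → ℝ}

/-! ### Log-normal weights -/

/-- Independent variables with the exponential moments of Gaussian variables of variance `2 a` and
mean `-a`. -/
structure IsGaussianField (P : Measure Ω) (a : ℝ) (G : Dyadic → Ω → ℝ) : Prop where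
  meas : ∀ I, Measurable (G I)
  indep : iIndepFun G P
  mgf : ∀ I θ, ∫⁻ ω, ENNReal.ofReal (Real.exp (θ * G I ω)) ∂P =
    ENNReal.ofReal (Real.exp (a * (θ ^ 2 - θ)))

/-- The σ-algebras generated by the variables of a field. -/
abbrev fieldAlg (G : Dyadic → Ω → ℝ) (I : Dyadic) : MeasurableSpace Ω :=
  MeasurableSpace.comap (G I) inferInstance

theorem IsGaussianField.isIndepField (hG : IsGaussianField P a G) :
    IsIndepField P (fieldAlg G) :=
  ⟨fun I => (hG.meas I).comap_le, hG.indep⟩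

/-- The exponential weights of order `t`, normalized to have mean one. -/
noncomputable def expWeight (a : ℝ) (G : Dyadic → Ω → ℝ) (t : ℝ) (ω : Ω) (I : Dyadic) : ℝ≥0∞ :=
  ENNReal.ofReal (Real.exp (t * G I ω + a * t * (1 - t)))

theorem ofReal_exp_rpow (x p : ℝ) :
    ENNReal.ofReal (Real.exp x) ^ p = ENNReal.ofReal (Real.exp (p * x)) := by
  rw [ENNReal.ofReal_rpow_of_pos (Real.exp_pos x), ← Real.exp_mul, mul_comm]

theorem ofReal_exp_mul (x y : ℝ) : ENNReal.ofReal (Real.exp x) * ENNReal.ofReal (Real.exp y) =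
    ENNReal.ofReal (Real.exp (x + y)) := by
  rw [← ENNReal.ofReal_mul (Real.exp_pos x).le, ← Real.exp_add]

theorem expWeight_ne_zero (t : ℝ) (ω : Ω) (I : Dyadic) : expWeight a G t ω I ≠ 0 :=
  (ENNReal.ofReal_pos.2 (Real.exp_pos _)).ne'

theorem expWeight_ne_top (t : ℝ) (ω : Ω) (I : Dyadic) : expWeight a G t ω I ≠ ∞ :=
  ENNReal.ofReal_ne_top

theorem expWeight_one (ω : Ω) (I : Dyadic) :
    expWeight a G 1 ω I = ENNReal.ofReal (Real.exp (G I ω)) := by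
  simp [expWeight]

/-- The random factors cancel and a constant, `1 / E Wᵗ`, is left. This is what makes the expected
energy computable along common ancestors. -/
theorem expWeight_mul_one_rpow_neg (t : ℝ) (ω : Ω) (I : Dyadic) :
    expWeight a G t ω I * expWeight a G 1 ω I ^ (-t) =
      ENNReal.ofReal (Real.exp (a * t * (1 - t))) := by
  rw [expWeight_one, ofReal_exp_rpow, expWeight, ofReal_exp_mul]
  ring_nf

theorem one_rpow_expWeight (t : ℝ) (ω : Ω) (I : Dyadic) :
    expWeight a G 1 ω I ^ t =
      ENNReal.ofReal (Real.exp (-(a * t * (1 - t)))) * expWeight a G t ω I := by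
  rw [expWeight_one, ofReal_exp_rpow, expWeight, ofReal_exp_mul]
  ring_nf

theorem pathProd_expWeight_one_rpow {t : ℝ} (ht : 0 ≤ t) (ω : Ω) (n : ℕ) (k : Fin (2 ^ n)) :
    pathProd (expWeight a G 1 ω) n k ^ t =
      ENNReal.ofReal (Real.exp (-(a * t * (1 - t)))) ^ n * pathProd (expWeight a G t ω) n k := by
  induction n with
  | zero => simp [pathProd]
  | succ n ih =>
    rw [pathProd_succ, pathProd_succ, ENNReal.mul_rpow_of_nonneg _ _ ht, ih, one_rpow_expWeight,
      pow_succ]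
    ring

theorem IsGaussianField.lintegral_expWeight_rpow (hG : IsGaussianField P a G) (t p : ℝ)
    (I : Dyadic) : ∫⁻ ω, expWeight a G t ω I ^ p ∂P =
      ENNReal.ofReal (Real.exp (a * t ^ 2 * (p * (p - 1)))) := by
  have h : ∀ ω, expWeight a G t ω I ^ p = ENNReal.ofReal (Real.exp (p * t * G I ω)) *
      ENNReal.ofReal (Real.exp (p * (a * t * (1 - t)))) := fun ω => by
    rw [expWeight, ofReal_exp_rpow, ofReal_exp_mul]
    ring_nf
  rw [lintegral_congr h, lintegral_mul_const' _ _ ENNReal.ofReal_ne_top, hG.mgf, ofReal_exp_mul]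
  ring_nf

theorem IsGaussianField.isWeight (hG : IsGaussianField P a G) (t : ℝ) :
    IsWeight P (fieldAlg G) (expWeight a G t) where
  meas I := by
    have : Measurable[fieldAlg G I] (G I) := comap_measurable _
    exact (Real.measurable_exp.comp ((this.const_mul t).add_const _)).ennreal_ofReal
  mean I := by
    have := hG.lintegral_expWeight_rpow t 1 I
    simpa using this
  ne_zero := expWeight_ne_zero t
  ne_top := expWeight_ne_top t

theorem ratio_eq (s : ℝ) : ratio s = ENNReal.ofReal (Real.exp (-(s * Real.log 2))) := by
  have : (2 : ℝ≥0∞)⁻¹ = ENNReal.ofReal (Real.exp (-Real.log 2)) := by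
    rw [Real.exp_neg, Real.exp_log two_pos, ENNReal.ofReal_inv_of_pos two_pos,
      ENNReal.ofReal_ofNat]
  rw [ratio, this, ofReal_exp_rpow]
  ring_nf

theorem ofReal_exp_lt_one {x : ℝ} (h : x < 0) : ENNReal.ofReal (Real.exp x) < 1 :=
  ENNReal.ofReal_lt_one.2 (Real.exp_lt_one_iff.2 h)

/-- The logarithm of the product is `(p - 1) (A p - s log 2)`, negative for `p` slightly above `1`.
With `A = a t²` this is the nondegeneracy condition of the tilted cascade on a mass of dimension
`s`. -/
theorem exists_moment_mul_ratio_lt_one {A s : ℝ} (h : A < s * Real.log 2) :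
    ∃ p : ℝ, 1 < p ∧ p ≤ 2 ∧
      ENNReal.ofReal (Real.exp (A * (p * (p - 1)))) * ratio s ^ (p - 1) < 1 := by
  have hc : Tendsto (fun p : ℝ => A * p - s * Real.log 2) (𝓝[>] 1)
      (𝓝 (A * 1 - s * Real.log 2)) :=
    (Continuous.tendsto (by fun_prop) 1).mono_left nhdsWithin_le_nhds
  obtain ⟨p, hp, hp1, hp2⟩ := ((hc.eventually (gt_mem_nhds (show A * 1 - s * Real.log 2 < 0 by
    linarith))).and (Ioo_mem_nhdsGT one_lt_two)).exists
  refine ⟨p, hp1, hp2.le, ?_⟩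
  rw [ratio_eq, ofReal_exp_rpow, ofReal_exp_mul]
  refine ofReal_exp_lt_one ?_
  have : (p - 1) * (A * p - s * Real.log 2) < 0 := mul_neg_of_pos_of_neg (by linarith) hp
  linarith

/-- The exponent `φ(t) = t + a t (1 - t) / log 2` of the KPZ formula. -/
noncomputable def kpzExponent (a t : ℝ) : ℝ := t + a / Real.log 2 * t * (1 - t)

theorem le_kpzExponent {a t : ℝ} (ha : 0 ≤ a) (ht : 0 ≤ t) (ht1 : t ≤ 1) :
    t ≤ kpzExponent a t :=
  le_add_of_nonneg_right (mul_nonneg (mul_nonneg (div_nonneg ha (Real.log_pos one_lt_two).le) ht)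
    (sub_nonneg.2 ht1))

/-- The origin of the exponent: `2^(-φ(t)) = 2⁻ᵗ E Wᵗ`. -/
theorem ratio_kpzExponent (a t : ℝ) :
    ratio (kpzExponent a t) = ENNReal.ofReal (Real.exp (-(a * t * (1 - t)))) * ratio t := by
  have : Real.log 2 ≠ 0 := (Real.log_pos one_lt_two).ne'
  rw [ratio_eq, ratio_eq, ofReal_exp_mul, kpzExponent]
  congr 2
  field_simp
  ring

/-! ### The upper bound for the dimension -/

theorem lebMass_eq_ratio_pow (I : Dyadic) : lebMass I = ratio 1 ^ I.1 := by
  rw [lebMass, ratio, ENNReal.rpow_one]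

/-- The ancestors contribute a factor `E Wᵗ` per level, and Jensen's inequality bounds the remaining
moment by the power `t` of the length. -/
theorem IsGaussianField.lintegral_cascadeMass_rpow_le [IsProbabilityMeasure P]
    (hG : IsGaussianField P a G) {t : ℝ} (ht0 : 0 < t) (ht1 : t ≤ 1) (I : Dyadic) :
    ∫⁻ ω, cascadeMass lebMass (expWeight a G 1 ω) I ^ t ∂P ≤ ratio (kpzExponent a t) ^ I.1 := by
  have hU := hG.isWeight 1
  have h𝓕 := hG.isIndepField
  have hm : Measurable fun ω => limMass lebMass (expWeight a G 1 ω) I :=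
    (hU.measurable_limMass I).mono (h𝓕.sigmaOf_le _) le_rfl
  have hpath : ∫⁻ ω, pathProd (expWeight a G t ω) I.1 I.2 ∂P ≤ 1 := by
    simpa using (hG.isWeight t).lintegral_pathProd_rpow_le h𝓕 (p := 1) zero_le_one (u := 1)
      (fun J => by simpa using ((hG.isWeight t).mean J).le) I.1 I.2
  rw [hU.lintegral_cascadeMass_rpow h𝓕 ht0.le, ratio_kpzExponent, mul_pow]
  refine mul_le_mul' ?_ ?_
  · simp only [pathProd_expWeight_one_rpow ht0.le]
    rw [lintegral_const_mul' _ _ (ENNReal.pow_ne_top ENNReal.ofReal_ne_top)]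
    exact mul_le_of_le_one_right zero_le hpath
  · refine (lintegral_rpow_le_rpow_lintegral hm ht0 ht1).trans ?_
    rw [ratio_pow]
    exact ENNReal.rpow_le_rpow (hU.lintegral_limMass_le h𝓕 lebMass_eq_sum lebMass_ne_top I) ht0.le

theorem IsGaussianField.ae_dimH_cdf_image_le [IsProbabilityMeasure P]
    (hG : IsGaussianField P a G) {K : Set unitInterval} {t : ℝ≥0} (ht0 : 0 < t) (ht1 : t ≤ 1)
    (h : dimH K < ENNReal.ofReal (kpzExponent a t)) :
    ∀ᵐ ω ∂P, ∀ μ : Measure unitInterval, IsFiniteMeasure μ →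
      (∀ I, μ (cell I) = cascadeMass lebMass (expWeight a G 1 ω) I) →
      dimH (cdf μ '' K) ≤ t := by
  have hU := hG.isWeight 1
  have h𝓕 := hG.isIndepField
  have ht0' : (0 : ℝ) < t := ht0
  have hpos : 0 < kpzExponent a t := ENNReal.ofReal_pos.1 (lt_of_le_of_lt zero_le h)
  have hnet : netContent (ratio (kpzExponent a t)) K = 0 := by
    have := netContent_eq_zero_of_dimH_lt (K := K) (s := (kpzExponent a t).toNNReal) h
    rwa [Real.coe_toNNReal _ hpos.le] at this
  have hm : ∀ I, Measurable fun ω => cascadeMass lebMass (expWeight a G 1 ω) I ^ (t : ℝ) :=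
    fun I => (((hU.measurable_pathProd _ _).mono (h𝓕.sigmaOf_le _) le_rfl).mul
      ((hU.measurable_limMass I).mono (h𝓕.sigmaOf_le _) le_rfl)).pow_const _
  -- Costs `2⁻ⁿ` make the expected sum over all the covers finite, so almost surely the random costs
  -- tend to zero. The exceptional set depends on the covers only, hence the quantifier over `μ`
  -- inside.
  choose C hC hCcost using fun n : ℕ => exists_covers_cost_lt
    (show netContent (ratio (kpzExponent a t)) K < (2⁻¹ : ℝ≥0∞) ^ n by
      rw [hnet]; exact ENNReal.pow_pos (by simp) n)
  let X : ℕ → Ω → ℝ≥0∞ := fun n ω =>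
    ∑' I : C n, cascadeMass lebMass (expWeight a G 1 ω) I ^ (t : ℝ)
  have hXm : ∀ n, AEMeasurable (X n) P := fun n => AEMeasurable.tsum fun I => (hm I).aemeasurable
  have hX : ∀ n, ∫⁻ ω, X n ω ∂P ≤ 2⁻¹ ^ n := by
    intro n
    refine (lintegral_tsum fun I : C n => (hm I).aemeasurable).trans_le ?_
    refine le_trans (ENNReal.tsum_le_tsum fun I =>
      hG.lintegral_cascadeMass_rpow_le ht0' (by exact_mod_cast ht1) I) ?_
    rw [← cost_eq_tsum_subtype]
    exact (hCcost n).le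
  have hsum : ∫⁻ ω, ∑' n, X n ω ∂P ≠ ∞ := by
    rw [lintegral_tsum hXm]
    refine ne_top_of_le_ne_top ?_ (ENNReal.tsum_le_tsum hX)
    rw [ENNReal.tsum_geometric]
    simp
  filter_upwards [ae_lt_top' (AEMeasurable.tsum hXm) hsum] with ω hω μ hμ hμcell
  have hlim := ENNReal.tendsto_cofinite_zero_of_tsum_ne_top hω.ne
  rw [Nat.cofinite_eq_atTop] at hlim
  refine dimH_le_of_covers ht0 (fun I => cdf μ '' cell I) fun ε hε => ?_
  obtain ⟨n, hn⟩ := (hlim.eventually (gt_mem_nhds hε)).exists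
  refine ⟨C n, ?_, le_trans (ENNReal.tsum_le_tsum fun I => ?_) hn.le⟩
  · rintro _ ⟨x, hx, rfl⟩
    obtain ⟨I, hI, hxI⟩ := hC n x hx
    exact Set.mem_iUnion₂.2 ⟨I, hI, x, hxI, rfl⟩
  · refine ENNReal.rpow_le_rpow ?_ t.2
    rw [← hμcell]
    exact ediam_cdf_image_cell_le μ I

end Cascade

namespace Cascade

open scoped ENNReal NNReal

variable {Ω : Type*} {mΩ : MeasurableSpace Ω} {P : Measure Ω} {a : ℝ} {G : Dyadic → Ω → ℝ}

/-! ### The expected energy -/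

/-- The product of two path products of order `t` and of a power of a path product of order one. -/
noncomputable def pathTriple (a : ℝ) (G : Dyadic → Ω → ℝ) (t : ℝ) (ω : Ω) (n : ℕ)
    (i j k : Fin (2 ^ n)) : ℝ≥0∞ :=
  pathProd (expWeight a G t ω) n i * pathProd (expWeight a G t ω) n k *
    pathProd (expWeight a G 1 ω) n j ^ (-t)

theorem pathProd_ne_zero {w : Dyadic → ℝ≥0∞} (hw : ∀ I, w I ≠ 0) {n : ℕ} (k : Fin (2 ^ n)) :
    pathProd w n k ≠ 0 := by
  induction n with
  | zero => simp [pathProd]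
  | succ n ih => exact mul_ne_zero (ih _) (hw _)

theorem pathProd_ne_top {w : Dyadic → ℝ≥0∞} (hw : ∀ I, w I ≠ ∞) {n : ℕ} (k : Fin (2 ^ n)) :
    pathProd w n k ≠ ∞ := by
  induction n with
  | zero => simp [pathProd]
  | succ n ih => exact ENNReal.mul_ne_top (ih _) (hw _)

theorem pathTriple_succ {t : ℝ} (ht : 0 ≤ t) (ω : Ω) (n : ℕ) (i j k : Fin (2 ^ (n + 1))) :
    pathTriple a G t ω (n + 1) i j k = pathTriple a G t ω n (parent i) (parent j) (parent k) *
      (expWeight a G t ω ⟨n, parent i⟩ * expWeight a G t ω ⟨n, parent k⟩ *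
        expWeight a G 1 ω ⟨n, parent j⟩ ^ (-t)) := by
  simp only [pathTriple, pathProd_succ]
  rw [mul_rpow_neg (pathProd_ne_zero (expWeight_ne_zero 1 ω) _)
    (pathProd_ne_top (expWeight_ne_top 1 ω) _) ht]
  ring

theorem IsGaussianField.measurable_pathTriple (hG : IsGaussianField P a G) (t : ℝ) (n : ℕ)
    (i j k : Fin (2 ^ n)) : Measurable[sigmaOf (fieldAlg G) {J | J.1 < n}]
      fun ω => pathTriple a G t ω n i j k :=
  (((hG.isWeight t).measurable_pathProd n i).mul ((hG.isWeight t).measurable_pathProd n k)).mul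
    (((hG.isWeight 1).measurable_pathProd n j).pow_const _)

theorem IsGaussianField.lintegral_pathTriple_succ (hG : IsGaussianField P a G)
    {t : ℝ} (ht : 0 ≤ t) (n : ℕ) (i j k : Fin (2 ^ (n + 1))) :
    ∫⁻ ω, pathTriple a G t ω (n + 1) i j k ∂P =
      (∫⁻ ω, pathTriple a G t ω n (parent i) (parent j) (parent k) ∂P) *
        ∫⁻ ω, expWeight a G t ω ⟨n, parent i⟩ * expWeight a G t ω ⟨n, parent k⟩ *
          expWeight a G 1 ω ⟨n, parent j⟩ ^ (-t) ∂P := by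
  simp only [pathTriple_succ ht]
  refine hG.isIndepField.lintegral_mul (S := {J | J.1 < n}) (T := {J | J.1 = n})
    (Set.disjoint_left.2 fun J (h : J.1 < n) (h' : J.1 = n) => h.ne h')
    (hG.measurable_pathTriple t n _ _ _) ?_
  have hm : ∀ t (k : Fin (2 ^ n)), Measurable[sigmaOf (fieldAlg G) {J | J.1 = n}]
      fun ω => expWeight a G t ω ⟨n, k⟩ := fun t k =>
    (hG.isWeight t).measurable_of_mem (S := {J | J.1 = n}) (I := ⟨n, k⟩) (by simp)
  exact ((hm t _).mul (hm t _)).mul ((hm 1 _).pow_const _)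

/-- Parents of adjacent positions are equal or adjacent, so at each level the ancestor in the middle
coincides with one at an end. There the negative power cancels, and the other tilted weight has mean
one. -/
theorem IsGaussianField.lintegral_pathTriple_of_adjacent [IsProbabilityMeasure P]
    (hG : IsGaussianField P a G) {t : ℝ} (ht : 0 ≤ t) (n : ℕ) :
    ∀ i j k : Fin (2 ^ n), i ≤ j → j ≤ k → (k : ℕ) ≤ i + 1 →
      ∫⁻ ω, pathTriple a G t ω n i j k ∂P = ENNReal.ofReal (Real.exp (a * t * (1 - t))) ^ n := by
  induction n with
  | zero => intro i j k _ _ _; simp [pathTriple, pathProd]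
  | succ n ih =>
    intro i j k hij hjk hki
    rw [Fin.le_def] at hij hjk
    rw [hG.lintegral_pathTriple_succ ht, ih _ _ _ (by rw [Fin.le_def, parent_val, parent_val]; omega)
      (by rw [Fin.le_def, parent_val, parent_val]; omega)
      (by rw [parent_val, parent_val]; omega), pow_succ]
    congr 1
    have hc : parent j = parent i ∨ parent j = parent k := by
      rcases (by omega : (j : ℕ) = i ∨ (j : ℕ) = k) with h | h
      · exact Or.inl (congrArg parent (Fin.ext h))
      · exact Or.inr (congrArg parent (Fin.ext h))
    have hmean : ∀ J, ∫⁻ ω, ENNReal.ofReal (Real.exp (a * t * (1 - t))) *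
        expWeight a G t ω J ∂P = ENNReal.ofReal (Real.exp (a * t * (1 - t))) := fun J => by
      rw [lintegral_const_mul' _ _ ENNReal.ofReal_ne_top, (hG.isWeight t).mean, mul_one]
    rcases hc with h | h
    · rw [h, ← hmean ⟨n, parent k⟩]
      refine lintegral_congr fun ω => ?_
      rw [← expWeight_mul_one_rpow_neg t ω ⟨n, parent i⟩]
      ring
    · rw [h, ← hmean ⟨n, parent i⟩]
      refine lintegral_congr fun ω => ?_
      rw [← expWeight_mul_one_rpow_neg t ω ⟨n, parent k⟩]
      ring

theorem mul_mul_le_add_pow_three (x y z : ℝ≥0∞) : x * y * z ≤ x ^ 3 + y ^ 3 + z ^ 3 := by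
  have h : ∀ w : ℝ≥0∞, x ≤ w → y ≤ w → z ≤ w → x * y * z ≤ w ^ 3 := fun w hx hy hz => by
    calc x * y * z ≤ w * w * w := by gcongr
      _ = w ^ 3 := by ring
  rcases le_total x y with h1 | h1 <;> rcases le_total y z with h2 | h2 <;>
    rcases le_total x z with h3 | h3
  all_goals first
    | exact (h x le_rfl (by assumption) (by assumption)).trans (le_add_right le_self_add)
    | exact (h y (by assumption) le_rfl (by assumption)).trans (le_add_right le_add_self)
    | exact (h z (by assumption) (by assumption) le_rfl).trans le_add_self
    | exact (h z (h1.trans h2) h2 le_rfl).trans le_add_self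
    | exact (h x le_rfl h1 (h2.trans h1)).trans (le_add_right le_self_add)

/-- Taking parents reduces a spread of three to at most two, and of two to at most one. Each
reduction costs one level, paid by the constant `Q`, before the adjacent case applies. -/
theorem IsGaussianField.exists_lintegral_pathTriple_le [IsProbabilityMeasure P]
    (hG : IsGaussianField P a G) (ha : 0 ≤ a) {t : ℝ} (ht : 0 ≤ t) (ht1 : t ≤ 1) :
    ∃ Q : ℝ≥0∞, Q ≠ ∞ ∧ ∀ n (i j k : Fin (2 ^ n)), i ≤ j → j ≤ k → (k : ℕ) ≤ i + 3 →
      ∫⁻ ω, pathTriple a G t ω n i j k ∂P ≤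
        Q * ENNReal.ofReal (Real.exp (a * t * (1 - t))) ^ n := by
  set E : ℝ≥0∞ := ENNReal.ofReal (Real.exp (a * t * (1 - t))) with hE
  have hE1 : 1 ≤ E := ENNReal.one_le_ofReal.2 (Real.one_le_exp
    (mul_nonneg (mul_nonneg ha ht) (by linarith)))
  obtain ⟨Q, hQ, hQI⟩ : ∃ Q : ℝ≥0∞, Q ≠ ∞ ∧ ∀ I J K : Dyadic,
      ∫⁻ ω, expWeight a G t ω I * expWeight a G t ω K * expWeight a G 1 ω J ^ (-t) ∂P ≤ Q := by
    let c : ℝ → ℝ → ℝ≥0∞ := fun t p => ENNReal.ofReal (Real.exp (a * t ^ 2 * (p * (p - 1))))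
    refine ⟨c t 3 + c t 3 + c 1 (-(t * 3)), by simp [c], fun I J K => ?_⟩
    have hm : ∀ t I (p : ℝ), Measurable fun ω => expWeight a G t ω I ^ p := fun t I p =>
      (((hG.isWeight t).meas I).mono (hG.isIndepField.le I) le_rfl).pow_const p
    have e : ∀ ω, expWeight a G t ω I * expWeight a G t ω K * expWeight a G 1 ω J ^ (-t) ≤
        expWeight a G t ω I ^ (3 : ℝ) + expWeight a G t ω K ^ (3 : ℝ) +
          expWeight a G 1 ω J ^ (-(t * 3)) := fun ω => by
      refine (mul_mul_le_add_pow_three _ _ _).trans_eq ?_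
      have h3 : ∀ x : ℝ≥0∞, x ^ 3 = x ^ (3 : ℝ) := fun x => by
        rw [← ENNReal.rpow_natCast]; norm_num
      rw [h3, h3, h3, ← ENNReal.rpow_mul]
      ring_nf
    refine (lintegral_mono e).trans_eq ?_
    have hm2 : Measurable fun ω => expWeight a G t ω I ^ (3 : ℝ) + expWeight a G t ω K ^ (3 : ℝ) :=
      (hm t I 3).add (hm t K 3)
    rw [lintegral_add_left hm2, lintegral_add_left (hm t I 3), hG.lintegral_expWeight_rpow,
      hG.lintegral_expWeight_rpow, hG.lintegral_expWeight_rpow]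
  have step : ∀ (B : ℝ≥0∞) (d : ℕ),
      (∀ n (i j k : Fin (2 ^ n)), i ≤ j → j ≤ k → (k : ℕ) ≤ i + d →
        ∫⁻ ω, pathTriple a G t ω n i j k ∂P ≤ B * E ^ n) → 1 ≤ d →
      ∀ n (i j k : Fin (2 ^ n)), i ≤ j → j ≤ k → (k : ℕ) ≤ i + (d + 1) →
        ∫⁻ ω, pathTriple a G t ω n i j k ∂P ≤ (Q + 1) * B * E ^ n := by
    intro B d hB hd n
    have h0 : 1 ≤ B := by
      have := hB 0 0 0 0 le_rfl le_rfl (by simp)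
      simpa [pathTriple, pathProd] using this
    cases n with
    | zero =>
      intro i j k _ _ _
      simp only [pathTriple, pathProd, ENNReal.one_rpow, lintegral_const, measure_univ,
        pow_zero, mul_one]
      exact one_le_mul le_add_self h0
    | succ n =>
      intro i j k hij hjk hki
      rw [Fin.le_def] at hij hjk
      rw [hG.lintegral_pathTriple_succ ht]
      refine (mul_le_mul' (hB n _ _ _ (by rw [Fin.le_def, parent_val, parent_val]; omega)
        (by rw [Fin.le_def, parent_val, parent_val]; omega)
        (by rw [parent_val, parent_val]; omega)) (hQI _ _ _)).trans ?_
      calc B * E ^ n * Q = Q * B * E ^ n := by ring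
        _ ≤ (Q + 1) * B * E ^ (n + 1) := by
            gcongr
            · exact le_self_add
            · exact n.le_succ
  have h1 : ∀ n (i j k : Fin (2 ^ n)), i ≤ j → j ≤ k → (k : ℕ) ≤ i + 1 →
      ∫⁻ ω, pathTriple a G t ω n i j k ∂P ≤ 1 * E ^ n := fun n i j k hij hjk hki => by
    rw [one_mul]
    exact (hG.lintegral_pathTriple_of_adjacent ht n i j k hij hjk hki).le
  have hQ1 : Q + 1 ≠ ∞ := ENNReal.add_ne_top.2 ⟨hQ, ENNReal.one_ne_top⟩
  exact ⟨(Q + 1) * ((Q + 1) * 1), ENNReal.mul_ne_top hQ1 (ENNReal.mul_ne_top hQ1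
    ENNReal.one_ne_top), step _ 2 (step _ 1 h1 le_rfl) one_le_two⟩

theorem IsGaussianField.exists_lintegral_limMass_rpow_neg_le [IsProbabilityMeasure P]
    (hG : IsGaussianField P a G) (ha : a < Real.log 2) {r : ℝ} (hr : 0 < r) :
    ∃ D : ℝ≥0∞, D ≠ ∞ ∧
      ∀ I, ∫⁻ ω, (2 ^ I.1 * limMass lebMass (expWeight a G 1 ω) I) ^ (-r) ∂P ≤ D := by
  obtain ⟨p, hp1, hp2, hp⟩ := exists_moment_mul_ratio_lt_one (A := a) (s := 1) (by linarith)
  refine (hG.isWeight 1).exists_lintegral_limMass_rpow_neg_le hG.isIndepField hp1 hp2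
    (u := ENNReal.ofReal (Real.exp (a * (p * (p - 1))))) (fun I => ?_) ENNReal.ofReal_ne_top ?_
    (fun p _ => ⟨ENNReal.ofReal (Real.exp (a * 1 ^ 2 * (-p * (-p - 1)))), ENNReal.ofReal_ne_top,
      fun I => (hG.lintegral_expWeight_rpow 1 (-p) I).le⟩) hr
  · rw [hG.lintegral_expWeight_rpow]
    simp
  · rwa [ratio, ENNReal.rpow_one] at hp

/-- The subtrees of three distinct intervals of one level are independent of each other and of the
levels above. The expectation factors into the path triple, two means and a negative moment; the
latter, once normalised, gives `2^(n t)`. -/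
theorem IsGaussianField.exists_lintegral_gapTerm_le [IsProbabilityMeasure P]
    (hG : IsGaussianField P a G) (ha : 0 ≤ a) (ha2 : a < Real.log 2) {t : ℝ} (ht : 0 < t)
    (ht1 : t ≤ 1) : ∃ Q : ℝ≥0∞, Q ≠ ∞ ∧ ∀ b : Dyadic → ℝ≥0∞,
      (∀ I, b I = ∑ i, b (child I i)) → (∀ I, b I ≠ ∞) → ∀ n (i j k : Fin (2 ^ n)),
      i < j → j < k → (k : ℕ) ≤ i + 3 →
      ∫⁻ ω, cascadeMass b (expWeight a G t ω) ⟨n, i⟩ * cascadeMass b (expWeight a G t ω) ⟨n, k⟩ *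
        cascadeMass lebMass (expWeight a G 1 ω) ⟨n, j⟩ ^ (-t) ∂P ≤
      Q * (ENNReal.ofReal (Real.exp (a * t * (1 - t))) * ratio (-t)) ^ n *
        (b ⟨n, i⟩ * b ⟨n, k⟩) := by
  obtain ⟨Q, hQ, hQn⟩ := hG.exists_lintegral_pathTriple_le ha ht.le ht1
  obtain ⟨D, hD, hDI⟩ := hG.exists_lintegral_limMass_rpow_neg_le ha2 ht
  refine ⟨Q * D, ENNReal.mul_ne_top hQ hD, fun b hadd hfin n i j k hij hjk hki => ?_⟩
  have h𝓕 := hG.isIndepField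
  have hU := hG.isWeight t
  have hW := hG.isWeight 1
  have hne : ∀ {x y : Fin (2 ^ n)}, x < y →
      Disjoint (descendants ⟨n, x⟩) (descendants ⟨n, y⟩) := fun {x y} h =>
    disjoint_descendants rfl fun e => h.ne (eq_of_heq (Sigma.mk.inj e).2)
  have hsplit : ∀ ω, cascadeMass b (expWeight a G t ω) ⟨n, i⟩ *
      cascadeMass b (expWeight a G t ω) ⟨n, k⟩ *
        cascadeMass lebMass (expWeight a G 1 ω) ⟨n, j⟩ ^ (-t) =
      pathTriple a G t ω n i j k * (limMass b (expWeight a G t ω) ⟨n, i⟩ *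
        (limMass b (expWeight a G t ω) ⟨n, k⟩ *
          limMass lebMass (expWeight a G 1 ω) ⟨n, j⟩ ^ (-t))) := fun ω => by
    simp only [cascadeMass, pathTriple]
    rw [mul_rpow_neg (pathProd_ne_zero (expWeight_ne_zero 1 ω) _)
      (pathProd_ne_top (expWeight_ne_top 1 ω) _) ht.le]
    ring
  have hY : ∫⁻ ω, limMass lebMass (expWeight a G 1 ω) ⟨n, j⟩ ^ (-t) ∂P ≤ ratio (-t) ^ n * D := by
    have e : ∀ ω, limMass lebMass (expWeight a G 1 ω) ⟨n, j⟩ ^ (-t) =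
        ratio (-t) ^ n * (2 ^ n * limMass lebMass (expWeight a G 1 ω) ⟨n, j⟩) ^ (-t) := fun ω => by
      rw [ratio_pow, ← mul_rpow_neg (by simp) (by simp) ht.le, ← mul_assoc, ← mul_pow,
        ENNReal.inv_mul_cancel (by simp) (by simp), one_pow, one_mul]
    have hr : ratio (-t) ^ n ≠ ∞ := by
      refine ENNReal.pow_ne_top ?_
      rw [ratio_eq]
      exact ENNReal.ofReal_ne_top
    rw [lintegral_congr e, lintegral_const_mul' _ _ hr]
    gcongr
    exact hDI ⟨n, j⟩
  have hXi := hU.measurable_limMass (b := b) ⟨n, i⟩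
  have hXk := hU.measurable_limMass (b := b) ⟨n, k⟩
  have hYj := (hW.measurable_limMass (b := lebMass) ⟨n, j⟩).pow_const (-t)
  have hkj : Measurable[sigmaOf (fieldAlg G) (descendants ⟨n, k⟩ ∪ descendants ⟨n, j⟩)] fun ω =>
      limMass b (expWeight a G t ω) ⟨n, k⟩ * limMass lebMass (expWeight a G 1 ω) ⟨n, j⟩ ^ (-t) :=
    (hXk.mono (sigmaOf_mono Set.subset_union_left) le_rfl).mul
      (hYj.mono (sigmaOf_mono Set.subset_union_right) le_rfl)
  have hikj : Measurable[sigmaOf (fieldAlg G) {J | n ≤ J.1}] fun ω =>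
      limMass b (expWeight a G t ω) ⟨n, i⟩ * (limMass b (expWeight a G t ω) ⟨n, k⟩ *
        limMass lebMass (expWeight a G 1 ω) ⟨n, j⟩ ^ (-t)) :=
    (hXi.mono (sigmaOf_mono (descendants_subset_level _)) le_rfl).mul
      (hkj.mono (sigmaOf_mono (Set.union_subset (descendants_subset_level _)
        (descendants_subset_level _))) le_rfl)
  rw [lintegral_congr hsplit, h𝓕.lintegral_mul (S := {J | J.1 < n}) (T := {J | n ≤ J.1})
      (Set.disjoint_left.2 fun J (h : J.1 < n) (h' : n ≤ J.1) => absurd h' (not_le.2 h))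
      (hG.measurable_pathTriple t n i j k) hikj,
    h𝓕.lintegral_mul ((hne (hij.trans hjk)).union_right (hne hij)) hXi hkj,
    h𝓕.lintegral_mul (hne hjk).symm hXk hYj]
  calc _ ≤ Q * ENNReal.ofReal (Real.exp (a * t * (1 - t))) ^ n *
        (b ⟨n, i⟩ * (b ⟨n, k⟩ * (ratio (-t) ^ n * D))) :=
        mul_le_mul' (hQn n i j k hij.le hjk.le hki)
          (mul_le_mul' (hU.lintegral_limMass_le h𝓕 hadd hfin _)
            (mul_le_mul' (hU.lintegral_limMass_le h𝓕 hadd hfin _) hY))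
    _ = _ := by rw [mul_pow]; ring

theorem IsGaussianField.lintegral_gapSum_ne_top [IsProbabilityMeasure P]
    (hG : IsGaussianField P a G) (ha : 0 ≤ a) (ha2 : a < Real.log 2) {t s : ℝ} (ht : 0 < t)
    (ht1 : t ≤ 1) (hs : kpzExponent a t < s) {b : Dyadic → ℝ≥0∞}
    (hadd : ∀ I, b I = ∑ i, b (child I i)) (hfin : ∀ I, b I ≠ ∞) (hb : ∀ I, b I ≤ ratio s ^ I.1) :
    ∀ᵐ ω ∂P, gapSum (cascadeMass b (expWeight a G t ω)) (cascadeMass b (expWeight a G t ω))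
      (fun I => cascadeMass lebMass (expWeight a G 1 ω) I ^ (-t)) ≠ ∞ := by
  obtain ⟨Q, hQ, hQn⟩ := hG.exists_lintegral_gapTerm_le ha ha2 ht ht1
  have hm : ∀ (b : Dyadic → ℝ≥0∞) t I, Measurable fun ω => cascadeMass b (expWeight a G t ω) I :=
    fun b t I => (((hG.isWeight t).measurable_pathProd _ _).mono
      (hG.isIndepField.sigmaOf_le _) le_rfl).mul (((hG.isWeight t).measurable_limMass I).mono
      (hG.isIndepField.sigmaOf_le _) le_rfl)
  let T : ∀ n, Fin (2 ^ n) → Fin 2 → Ω → ℝ≥0∞ := fun n i d ω =>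
    gapTerm (cascadeMass b (expWeight a G t ω)) (cascadeMass b (expWeight a G t ω))
      (fun I => cascadeMass lebMass (expWeight a G 1 ω) I ^ (-t)) n i d
  have hT : ∀ n i d, Measurable (T n i d) := by
    intro n i d
    by_cases h : (i : ℕ) + 2 + d < 2 ^ n
    · simp only [T, gapTerm, dif_pos h]
      exact ((hm _ _ _).mul (hm _ _ _)).mul ((hm _ _ _).pow_const _)
    · simp only [T, gapTerm, dif_neg h]
      exact measurable_const
  -- This ratio is `2^(φ(t) - s)`, less than one by the choice of `s`.
  set x : ℝ≥0∞ := ENNReal.ofReal (Real.exp (a * t * (1 - t))) * ratio (-t) * ratio s with hx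
  have hx1 : x < 1 := by
    rw [hx, ratio_eq, ratio_eq, ofReal_exp_mul, ofReal_exp_mul]
    refine ofReal_exp_lt_one ?_
    have hl : 0 < Real.log 2 := Real.log_pos one_lt_two
    have := mul_lt_mul_of_pos_right hs hl
    rw [kpzExponent, add_mul, mul_right_comm, mul_right_comm (a / Real.log 2),
      div_mul_cancel₀ _ hl.ne'] at this
    linarith
  have hTle : ∀ n i d, ∫⁻ ω, T n i d ω ∂P ≤ Q * x ^ n * b ⟨n, i⟩ := by
    intro n i d
    by_cases h : (i : ℕ) + 2 + d < 2 ^ n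
    · simp only [T, gapTerm, dif_pos h]
      refine (hQn b hadd hfin n i _ _ (by rw [Fin.lt_def]; exact Nat.lt_succ_self _)
        (by rw [Fin.lt_def]; simp only; omega) (by simp only; omega)).trans ?_
      rw [hx, mul_pow _ (ratio s)]
      -- One of the two base masses is bounded by Frostman's condition; the other is kept and summed
      -- over the level to the total mass.
      calc _ ≤ Q * (ENNReal.ofReal (Real.exp (a * t * (1 - t))) * ratio (-t)) ^ n *
            (b ⟨n, i⟩ * ratio s ^ n) := by gcongr; exact hb ⟨n, _⟩
        _ = _ := by ring
    · simp [T, gapTerm, dif_neg h]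
  have hsum : ∫⁻ ω, ∑' n, ∑ i, ∑ d, T n i d ω ∂P ≠ ∞ := by
    rw [lintegral_tsum fun n => (Finset.measurable_fun_sum _ fun i _ =>
      Finset.measurable_fun_sum _ fun d _ => hT n i d).aemeasurable]
    have hle : ∀ n, ∫⁻ ω, ∑ i, ∑ d, T n i d ω ∂P ≤ Q * 2 * b ⟨0, 0⟩ * x ^ n := by
      intro n
      rw [lintegral_finsetSum _ fun i _ => Finset.measurable_fun_sum _ fun d _ => hT n i d]
      calc ∑ i, ∫⁻ ω, ∑ d, T n i d ω ∂P ≤ ∑ i, Q * 2 * x ^ n * b ⟨n, i⟩ := by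
            refine Finset.sum_le_sum fun i _ => ?_
            rw [lintegral_finsetSum _ fun d _ => hT n i d]
            refine (Finset.sum_le_sum fun d _ => hTle n i d).trans_eq ?_
            rw [Finset.sum_const, Finset.card_univ, Fintype.card_fin, nsmul_eq_mul]
            push_cast
            ring
        _ = Q * 2 * b ⟨0, 0⟩ * x ^ n := by
            rw [← Finset.mul_sum, sum_level_eq hadd]
            ring
    refine ne_top_of_le_ne_top ?_ (ENNReal.tsum_le_tsum hle)
    rw [ENNReal.tsum_mul_left, ENNReal.tsum_geometric]
    refine ENNReal.mul_ne_top (ENNReal.mul_ne_top (ENNReal.mul_ne_top hQ (by simp)) (hfin _))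
      (ENNReal.inv_ne_top.2 ?_)
    rw [Ne, tsub_eq_zero_iff_le, not_le]
    exact hx1
  have hmeas : AEMeasurable (fun ω => ∑' n, ∑ i, ∑ d, T n i d ω) P :=
    AEMeasurable.tsum fun n => (Finset.measurable_fun_sum _ fun i _ =>
      Finset.measurable_fun_sum _ fun d _ => hT n i d).aemeasurable
  filter_upwards [ae_lt_top' hmeas hsum] with ω hω
  exact hω.ne

theorem IsGaussianField.ae_le_dimH_cdf_image [IsProbabilityMeasure P]
    (hG : IsGaussianField P a G) (ha : 0 ≤ a) (ha2 : a < Real.log 2) {K : Set unitInterval}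
    (hK : AnalyticSet K) {t : ℝ≥0} (ht : 0 < t) (ht1 : t ≤ 1)
    (h : ENNReal.ofReal (kpzExponent a t) < dimH K) :
    ∀ᵐ ω ∂P, ∀ μ : Measure unitInterval, IsFiniteMeasure μ →
      (∀ I, μ (cell I) = cascadeMass lebMass (expWeight a G 1 ω) I) →
      (∀ I, μ (cell I) ≠ 0) → t ≤ dimH (cdf μ '' K) := by
  have ht' : (0 : ℝ) < t := ht
  have ht1' : (t : ℝ) ≤ 1 := by exact_mod_cast ht1
  have hl : 0 < Real.log 2 := Real.log_pos one_lt_two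
  obtain ⟨s, hs1, hs2⟩ := ENNReal.lt_iff_exists_nnreal_btwn.1 h
  have hts : (t : ℝ) ≤ kpzExponent a t := le_kpzExponent ha ht'.le ht1'
  have hks : kpzExponent a t < s := by
    rwa [← ENNReal.ofReal_coe_nnreal,
      ENNReal.ofReal_lt_ofReal_iff_of_nonneg (ht'.le.trans hts)] at hs1
  have hs0 : (0 : ℝ) < s := by linarith
  obtain ⟨K', hK', hcomp, b, hadd, hb, hbK, hb0⟩ := exists_frostman_of_lt_dimH hK
    (by exact_mod_cast hs0 : (0 : ℝ≥0) < s) hs2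
  have hrtop : ratio s ≠ ∞ := by rw [ratio_eq]; exact ENNReal.ofReal_ne_top
  have hfin : ∀ I, b I ≠ ∞ := fun I => ne_top_of_le_ne_top (ENNReal.pow_ne_top hrtop) (hb I)
  -- From `φ(t) < s` and `a t² ≤ t log 2`: the tilted cascade on `b` does not degenerate.
  have hmom : a * (t : ℝ) ^ 2 < s * Real.log 2 := by
    have h1 := mul_lt_mul_of_pos_right hks hl
    rw [kpzExponent, add_mul, mul_right_comm, mul_right_comm (a / Real.log 2),
      div_mul_cancel₀ _ hl.ne'] at h1
    have h2 : a * t ≤ Real.log 2 * t := by gcongr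
    nlinarith [mul_nonneg (mul_nonneg ha ht'.le) (sub_nonneg.2 ht1')]
  obtain ⟨p, hp1, hp2, hp⟩ := exists_moment_mul_ratio_lt_one hmom
  have hu : ∀ I, ∫⁻ ω, expWeight a G t ω I ^ p ∂P ≤
      ENNReal.ofReal (Real.exp (a * (t : ℝ) ^ 2 * (p * (p - 1)))) := fun I =>
    (hG.lintegral_expWeight_rpow t p I).le
  filter_upwards [hG.lintegral_gapSum_ne_top ha ha2 ht' ht1' hks hadd hfin hb,
    (hG.isWeight t).ae_cascadeMass hG.isIndepField hadd hp1 hp2 hu ENNReal.ofReal_ne_top hp hb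
      hrtop,
    (hG.isWeight t).ae_limMass_root_ne_zero hG.isIndepField hadd hp1 hp2 hu ENNReal.ofReal_ne_top
      hp hb hrtop hb0] with ω hgap hcas hroot μ hμ hμcell hpos
  obtain ⟨-, hcadd, hcfin, hcsmall⟩ := hcas
  refine (le_dimH_cdf_image hpos hcadd hcfin hcsmall hcomp (fun I hI => ?_) ?_ ht ?_).trans
    (dimH_mono (Set.image_mono hK'))
  · rw [cascadeMass, limMass_eq_zero hadd (hbK I hI), mul_zero]
  · simpa [cascadeMass, pathProd] using hroot
  · simpa only [hμcell] using hgap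

end Cascade

namespace Cascade

open scoped ENNReal NNReal

/-! ### The approximating measures -/

theorem volume_cell (I : Dyadic) : (volume : Measure unitInterval) (cell I) = lebMass I := by
  obtain ⟨n, k⟩ := I
  let x := gridPoint n k k.2.le
  let y := gridPoint n (k + 1) k.2
  have h : ENNReal.ofReal ((y : ℝ) - x) = lebMass ⟨n, k⟩ := by
    have : (y : ℝ) - x = (2 : ℝ)⁻¹ ^ n := by
      simp only [x, y, gridPoint]
      rw [← sub_div]
      push_cast
      rw [add_sub_cancel_left, one_div, inv_pow]
    rw [this, ofReal_inv_two_pow, lebMass]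
  refine le_antisymm ?_ ?_
  · rw [← h, ← unitInterval.volume_Icc]
    refine measure_mono fun z hz => ?_
    obtain ⟨h1, h2⟩ := cell_subset_Icc hz
    exact ⟨h1, by simpa [y, gridPoint, ← Subtype.coe_le_coe] using h2⟩
  · rw [← h, ← unitInterval.volume_Ioc]
    refine measure_mono fun z hz => mem_cell_of_lt hz.1 ?_
    have : (z : ℝ) ≤ y := hz.2
    simpa [y, gridPoint] using this

theorem approx_cell_level (W : Dyadic → ℝ) (n : ℕ) (k : Fin (2 ^ n)) :
    (approx W n : Measure unitInterval) (cell ⟨n, k⟩) =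
      pathProd (fun J => ENNReal.ofReal (W J)) n k * lebMass ⟨n, k⟩ := by
  change (volume : Measure unitInterval).withDensity (density W n) (cell ⟨n, k⟩) = _
  rw [withDensity_apply _ (measurableSet_cell _), ← volume_cell, ← setLIntegral_const]
  refine setLIntegral_congr_fun (measurableSet_cell _) fun x (hx : idx n x = k) => ?_
  rw [density, ← hx, pathProd_idx]

theorem measure_cell_eq_sum (μ : Measure unitInterval) (I : Dyadic) :
    μ (cell I) = ∑ i, μ (cell (child I i)) := by
  rw [cell_eq_iUnion_child, measure_iUnion (fun i j hij =>
      disjoint_cell (I := child I i) (J := child I j) rfl (child_ne hij))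
    fun i => measurableSet_cell _, tsum_fintype]

theorem approx_cell (W : Dyadic → ℝ) (m : ℕ) : ∀ I,
    (approx W (I.1 + m) : Measure unitInterval) (cell I) =
      pathProd (fun J => ENNReal.ofReal (W J)) I.1 I.2 *
        subMass lebMass (fun J => ENNReal.ofReal (W J)) m I := by
  induction m with
  | zero => exact fun I => approx_cell_level W I.1 I.2
  | succ m ih =>
    intro I
    rw [measure_cell_eq_sum, subMass_succ, ← mul_assoc, Finset.mul_sum]
    refine Finset.sum_congr rfl fun i _ => ?_
    have h := ih (child I i)
    rw [pathProd_childIdx, show (child I i).1 + m = I.1 + (m + 1) by simp only; omega] at h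
    exact h

theorem tendsto_approx {W : Dyadic → ℝ} {μ : FiniteMeasure unitInterval}
    (hlim : ∀ I, Tendsto (fun n => subMass lebMass (fun J => ENNReal.ofReal (W J)) n I) atTop
      (𝓝 (limMass lebMass (fun J => ENNReal.ofReal (W J)) I)))
    (hμ : ∀ I, (μ : Measure unitInterval) (cell I) =
      cascadeMass lebMass (fun J => ENNReal.ofReal (W J)) I) :
    Tendsto (approx W) atTop (𝓝 μ) := by
  refine tendsto_of_tendsto_cell fun I => ?_
  rw [← tendsto_add_atTop_iff_nat I.1, hμ, cascadeMass]
  simp only [add_comm _ I.1, approx_cell]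
  exact ENNReal.Tendsto.const_mul (hlim I)
    (Or.inr (pathProd_ne_top (fun _ => ENNReal.ofReal_ne_top) _))

theorem rho_eq_dist_cdf {W : Dyadic → ℝ} {μ : FiniteMeasure unitInterval}
    [NullSingletonClass (μ : Measure unitInterval)] (h : Tendsto (approx W) atTop (𝓝 μ))
    (x y : unitInterval) : rho W x y = dist (cdf (μ : Measure unitInterval) x)
      (cdf (μ : Measure unitInterval) y) := by
  rw [rho, limitMeasure, h.limUnder_eq, dist_cdf]
  rfl

/-! ### The KPZ formula for log-normal cascades -/

theorem continuous_kpzExponent (a : ℝ) : Continuous (kpzExponent a) := by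
  unfold kpzExponent
  fun_prop

/-- The difference of two values is `(x - y) (1 + c (1 - x - y))` with `c = a / log 2 < 1`; the
second factor is positive because `x + y ≤ 2`. -/
theorem kpzExponent_injOn {a : ℝ} (ha : 0 ≤ a) (ha2 : a < Real.log 2) :
    Set.InjOn (kpzExponent a) (Set.Icc 0 1) := by
  intro x hx y hy h
  have hl : 0 < Real.log 2 := Real.log_pos one_lt_two
  have hc0 : 0 ≤ a / Real.log 2 := div_nonneg ha hl.le
  have hc1 : a / Real.log 2 < 1 := (div_lt_one hl).2 ha2
  have h' : (x - y) * (1 + a / Real.log 2 * (1 - x - y)) = 0 := by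
    unfold kpzExponent at h
    linear_combination h
  rcases mul_eq_zero.1 h' with h' | h'
  · linarith
  · nlinarith [hx.2, hy.2]

theorem dimH_real_le_one (A : Set ℝ) : dimH A ≤ 1 :=
  (dimH_mono (Set.subset_univ _)).trans Real.dimH_univ.le

theorem dimH_le_one (K : Set unitInterval) : dimH K ≤ 1 := by
  rw [← isometry_subtype_coe.dimH_image K]
  exact dimH_real_le_one _

/-- A dimension that is bounded through the KPZ exponent at rational points solves the KPZ
equation. -/
theorem kpzExponent_toReal_eq {a : ℝ} (ha : 0 ≤ a) {d D : ℝ≥0∞} (hd : d ≤ 1) (hD : D ≤ 1)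
    (hle : ∀ q : ℚ, 0 < q → q ≤ 1 → d < ENNReal.ofReal (kpzExponent a q) →
      D ≤ (Real.toNNReal q : ℝ≥0))
    (hge : ∀ q : ℚ, 0 < q → q ≤ 1 → ENNReal.ofReal (kpzExponent a q) < d →
      (Real.toNNReal q : ℝ≥0) ≤ D) : kpzExponent a D.toReal = d.toReal := by
  have hdtop : d ≠ ∞ := ne_top_of_le_ne_top ENNReal.one_ne_top hd
  have hDtop : D ≠ ∞ := ne_top_of_le_ne_top ENNReal.one_ne_top hD
  have hd1 : d.toReal ≤ 1 := ENNReal.toReal_le_of_le_ofReal zero_le_one (by simpa using hd)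
  have hD1 : D.toReal ≤ 1 := ENNReal.toReal_le_of_le_ofReal zero_le_one (by simpa using hD)
  have hd0 : 0 ≤ d.toReal := ENNReal.toReal_nonneg
  have hD0 : 0 ≤ D.toReal := ENNReal.toReal_nonneg
  have hcont := (continuous_kpzExponent a).tendsto D.toReal
  rcases lt_trichotomy (kpzExponent a D.toReal) d.toReal with h | h | h
  · exfalso
    -- Since `φ(1) = 1` is at least the dimension `d`, the value `1` is excluded, which leaves room
    -- for a rational point above `D`. In the opposite case `φ(0) = 0` plays this role.
    have hD1' : D.toReal < 1 := by
      refine lt_of_le_of_ne hD1 fun h1 => ?_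
      rw [h1] at h
      simp only [kpzExponent, sub_self, mul_zero, add_zero] at h
      linarith
    obtain ⟨u, hu, hsub⟩ := mem_nhdsGE_iff_exists_Icc_subset.1
      (nhdsWithin_le_nhds (s := Set.Ici D.toReal) (hcont.eventually (gt_mem_nhds h)))
    obtain ⟨q, hq1, hq2⟩ := exists_rat_btwn (lt_min hu hD1')
    have hqφ : kpzExponent a q < d.toReal := hsub ⟨hq1.le, (hq2.trans_le (min_le_left _ _)).le⟩
    have hq0 : (0 : ℝ) < q := hD0.trans_lt hq1
    have hq1' : (q : ℝ) ≤ 1 := (hq2.trans_le (min_le_right _ _)).le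
    have := hge q (by exact_mod_cast hq0) (by exact_mod_cast hq1')
      ((ENNReal.ofReal_lt_iff_lt_toReal (hq0.le.trans (le_kpzExponent ha hq0.le hq1')) hdtop).2 hqφ)
    rw [← ENNReal.ofReal_toReal hDtop] at this
    exact absurd hq1 (not_lt.2 ((ENNReal.ofReal_le_ofReal_iff hD0).1 this))
  · exact h
  · exfalso
    have hD0' : 0 < D.toReal := by
      refine lt_of_le_of_ne hD0 fun h1 => ?_
      rw [← h1] at h
      simp only [kpzExponent, mul_zero, zero_mul, add_zero] at h
      linarith
    obtain ⟨l, hl, hsub⟩ := mem_nhdsLE_iff_exists_Icc_subset.1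
        (nhdsWithin_le_nhds (s := Set.Iic D.toReal) (hcont.eventually (lt_mem_nhds h)))
    obtain ⟨q, hq1, hq2⟩ := exists_rat_btwn (max_lt hl hD0')
    have hqφ : d.toReal < kpzExponent a q := hsub ⟨((le_max_left _ _).trans_lt hq1).le, hq2.le⟩
    have hq0 : (0 : ℝ) < q := (le_max_right _ _).trans_lt hq1
    have hq1' : (q : ℝ) ≤ 1 := hq2.le.trans hD1
    have := hle q (by exact_mod_cast hq0) (by exact_mod_cast hq1')
      ((ENNReal.lt_ofReal_iff_toReal_lt hdtop).2 hqφ)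
    rw [← ENNReal.ofReal_toReal hDtop] at this
    exact absurd hq2 (not_lt.2 ((ENNReal.ofReal_le_ofReal_iff hq0.le).1 this))

variable {Ω : Type*} {mΩ : MeasurableSpace Ω} {P : Measure Ω} {a : ℝ} {G : Dyadic → Ω → ℝ}

/-- A finite negative moment excludes the value zero, and there are only countably many intervals.
-/
theorem IsGaussianField.ae_limMass_ne_zero [IsProbabilityMeasure P] (hG : IsGaussianField P a G)
    (ha : a < Real.log 2) : ∀ᵐ ω ∂P, ∀ I, limMass lebMass (expWeight a G 1 ω) I ≠ 0 := by
  obtain ⟨D, hD, hDI⟩ := hG.exists_lintegral_limMass_rpow_neg_le ha one_pos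
  rw [ae_all_iff]
  intro I
  have hm : Measurable fun ω => (2 ^ I.1 * limMass lebMass (expWeight a G 1 ω) I) ^ (-1 : ℝ) :=
    ((((hG.isWeight 1).measurable_limMass I).mono (hG.isIndepField.sigmaOf_le _)
      le_rfl).const_mul _).pow_const _
  filter_upwards [ae_lt_top hm (ne_top_of_le_ne_top hD (hDI I))] with ω hω h0
  rw [h0, mul_zero, ENNReal.zero_rpow_of_neg (by norm_num)] at hω
  exact lt_irrefl _ hω

/-- The limit measure of a log-normal cascade, and the KPZ formula for the distances it defines. -/
theorem IsGaussianField.ae_exists_measure [IsProbabilityMeasure P] (hG : IsGaussianField P a G)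
    (ha : 0 ≤ a) (ha2 : a < Real.log 2) {K : Set unitInterval} (hK : AnalyticSet K) :
    ∀ᵐ ω ∂P, (∀ I, Tendsto (fun n => subMass lebMass (expWeight a G 1 ω) n I) atTop
        (𝓝 (limMass lebMass (expWeight a G 1 ω) I))) ∧
      ∃ μ : FiniteMeasure unitInterval, NullSingletonClass (μ : Measure unitInterval) ∧
        (∀ I, (μ : Measure unitInterval) (cell I) =
          cascadeMass lebMass (expWeight a G 1 ω) I) ∧
        Function.Injective (cdf (μ : Measure unitInterval)) ∧
        kpzExponent a (dimH (cdf (μ : Measure unitInterval) '' K)).toReal = (dimH K).toReal := by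
  obtain ⟨p, hp1, hp2, hp⟩ := exists_moment_mul_ratio_lt_one (A := a * 1 ^ 2) (s := 1)
    (by linarith)
  have hle : ∀ᵐ ω ∂P, ∀ q : ℚ, 0 < q → q ≤ 1 → dimH K < ENNReal.ofReal (kpzExponent a q) →
      ∀ μ : Measure unitInterval, IsFiniteMeasure μ →
      (∀ I, μ (cell I) = cascadeMass lebMass (expWeight a G 1 ω) I) →
      dimH (cdf μ '' K) ≤ (Real.toNNReal q : ℝ≥0) := by
    simp only [ae_all_iff, eventually_imp_distrib_left]
    intro q hq0 hq1 h
    have hq0' : (0 : ℝ) < q := by exact_mod_cast hq0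
    have hq1' : (q : ℝ) ≤ 1 := by exact_mod_cast hq1
    refine hG.ae_dimH_cdf_image_le (Real.toNNReal_pos.2 hq0') (Real.toNNReal_le_one.2 hq1') ?_
    rwa [Real.coe_toNNReal _ hq0'.le]
  have hge : ∀ᵐ ω ∂P, ∀ q : ℚ, 0 < q → q ≤ 1 → ENNReal.ofReal (kpzExponent a q) < dimH K →
      ∀ μ : Measure unitInterval, IsFiniteMeasure μ →
      (∀ I, μ (cell I) = cascadeMass lebMass (expWeight a G 1 ω) I) →
      (∀ I, μ (cell I) ≠ 0) → (Real.toNNReal q : ℝ≥0) ≤ dimH (cdf μ '' K) := by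
    simp only [ae_all_iff, eventually_imp_distrib_left]
    intro q hq0 hq1 h
    have hq0' : (0 : ℝ) < q := by exact_mod_cast hq0
    have hq1' : (q : ℝ) ≤ 1 := by exact_mod_cast hq1
    refine hG.ae_le_dimH_cdf_image ha ha2 hK (Real.toNNReal_pos.2 hq0')
      (Real.toNNReal_le_one.2 hq1') ?_
    rwa [Real.coe_toNNReal _ hq0'.le]
  filter_upwards [hle, hge, hG.ae_limMass_ne_zero ha2,
    (hG.isWeight 1).ae_cascadeMass hG.isIndepField lebMass_eq_sum hp1 hp2
      (fun I => (hG.lintegral_expWeight_rpow 1 p I).le) ENNReal.ofReal_ne_top hp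
      (fun I => (lebMass_eq_ratio_pow I).le) (by simp [ratio])] with ω hle hge hpos hcas
  obtain ⟨hlim, hadd, hfin, hsmall⟩ := hcas
  refine ⟨hlim, ?_⟩
  obtain ⟨μ, hμ, hμ0, hμcell⟩ := exists_measure_cell_eq hadd hfin hsmall
  have hμpos : ∀ I, μ (cell I) ≠ 0 := fun I => by
    rw [hμcell]
    exact mul_ne_zero (pathProd_ne_zero (expWeight_ne_zero 1 ω) _) (hpos I)
  refine ⟨⟨μ, hμ⟩, hμ0, hμcell, cdf_injective μ hμpos, ?_⟩
  exact kpzExponent_toReal_eq ha (dimH_le_one K) (dimH_real_le_one _)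
    (fun q h0 h1 h => hle q h0 h1 h μ hμ hμcell) fun q h0 h1 h => hge q h0 h1 h μ hμ hμcell hμpos

theorem lintegral_exp_mul_log_weightLaw (σ θ : ℝ) :
    ∫⁻ y, ENNReal.ofReal (Real.exp (θ * Real.log y)) ∂weightLaw σ =
      ENNReal.ofReal (Real.exp (σ ^ 2 / 2 * (θ ^ 2 - θ))) := by
  rw [weightLaw, lintegral_map (by fun_prop) (by fun_prop)]
  have e : ∀ y, ENNReal.ofReal (Real.exp (θ * Real.log (Real.exp (σ * y - σ ^ 2 / 2)))) =
      ENNReal.ofReal (Real.exp (-(θ * σ ^ 2 / 2))) * ENNReal.ofReal (Real.exp (θ * σ * y)) :=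
    fun y => by
      rw [Real.log_exp, ofReal_exp_mul]
      ring_nf
  rw [lintegral_congr e, lintegral_const_mul' _ _ ENNReal.ofReal_ne_top,
    ← ofReal_integral_eq_lintegral_ofReal (integrable_exp_mul_gaussianReal _)
      (Eventually.of_forall fun y => (Real.exp_pos _).le)]
  have h := congrFun (mgf_id_gaussianReal (μ := 0) (v := 1)) (θ * σ)
  simp only [mgf, id_eq] at h
  rw [h, ofReal_exp_mul]
  congr 2
  push_cast
  ring

/-- The weights are only almost everywhere measurable and positive, so measurable versions are taken
before the logarithm. -/
theorem exists_isGaussianField {σ : ℝ} {W : Dyadic → Ω → ℝ} (hWindep : iIndepFun W P)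
    (hWlaw : ∀ I, HasLaw (W I) (weightLaw σ) P) :
    ∃ G, IsGaussianField P (σ ^ 2 / 2) G ∧ ∀ I, ∀ᵐ ω ∂P, W I ω = Real.exp (G I ω) := by
  let V : Dyadic → Ω → ℝ := fun I => (hWlaw I).aemeasurable.mk
  have hV : ∀ I, Measurable (V I) := fun I => (hWlaw I).aemeasurable.measurable_mk
  have hWV : ∀ I, W I =ᵐ[P] V I := fun I => (hWlaw I).aemeasurable.ae_eq_mk
  have hVlaw : ∀ I, P.map (V I) = weightLaw σ := fun I => by
    rw [← Measure.map_congr (hWV I), (hWlaw I).map_eq]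
  refine ⟨fun I ω => Real.log (V I ω), ⟨fun I => (hV I).log, ?_, fun I θ => ?_⟩, fun I => ?_⟩
  · exact (hWindep.congr hWV).comp (fun _ => Real.log) fun _ => Real.measurable_log
  · rw [← lintegral_exp_mul_log_weightLaw, ← hVlaw I, lintegral_map (by fun_prop) (hV I)]
  · have hpos : ∀ᵐ y ∂weightLaw σ, 0 < y := by
      rw [weightLaw, ae_map_iff (by fun_prop) measurableSet_Ioi]
      exact Eventually.of_forall fun y => Real.exp_pos _
    rw [← hVlaw I] at hpos
    filter_upwards [hWV I, ae_of_ae_map (hV I).aemeasurable hpos] with ω h1 h2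
    rw [Real.exp_log h2, h1]

end Cascade

/-! ### The theorem for the random metric -/

theorem mainTheorem4 {Ω : Type*} [MeasurableSpace Ω] (P : Measure Ω) [IsProbabilityMeasure P]
    (σ : ℝ) (hσ : σ ^ 2 < Real.log 4)
    (W : Cascade.Dyadic → Ω → ℝ)
    (hWindep : iIndepFun W P)
    (hWlaw : ∀ I, HasLaw (W I) (Cascade.weightLaw σ) P)
    (K : Set unitInterval) (hK : AnalyticSet K) (hKne : K.Nonempty)
    (ζ₀ : ℝ) (hζ₀ : ζ₀ = (dimH K).toReal) :
    ∀ᵐ ω ∂P,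
      Tendsto (Cascade.approx fun I => W I ω) atTop
        (𝓝 (Cascade.limitMeasure fun I => W I ω)) ∧
      ∃ m : MetricSpace unitInterval,
        (∀ x y, m.dist x y = Cascade.rho (fun I => W I ω) x y) ∧
        ∃ ζ : ℝ, ζ ∈ Set.Icc (0 : ℝ) 1 ∧
          @dimH unitInterval m.toEMetricSpace K = ENNReal.ofReal ζ ∧
          ζ₀ - ζ = σ ^ 2 / Real.log 4 * ζ * (1 - ζ) ∧
          ∀ t ∈ Set.Icc (0 : ℝ) 1, ζ₀ - t = σ ^ 2 / Real.log 4 * t * (1 - t) → t = ζ := by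
  have hlog : Real.log 4 = 2 * Real.log 2 := by
    rw [show (4 : ℝ) = 2 ^ 2 by norm_num, Real.log_pow]
    norm_num
  have hφ : ∀ t, Cascade.kpzExponent (σ ^ 2 / 2) t = t + σ ^ 2 / Real.log 4 * t * (1 - t) :=
    fun t => by rw [Cascade.kpzExponent, hlog, div_div]
  have ha : 0 ≤ σ ^ 2 / 2 := by positivity
  have ha2 : σ ^ 2 / 2 < Real.log 2 := by linarith
  obtain ⟨G, hG, hWG⟩ := Cascade.exists_isGaussianField hWindep hWlaw
  filter_upwards [hG.ae_exists_measure ha ha2 hK, ae_all_iff.2 hWG] with ω hω hWω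
  have hw : Cascade.expWeight (σ ^ 2 / 2) G 1 ω = fun I => ENNReal.ofReal (W I ω) := by
    funext I
    rw [Cascade.expWeight_one, hWω]
  rw [hw] at hω
  obtain ⟨hlim, μ, hμ0, hμcell, hinj, hdim⟩ := hω
  have htend := Cascade.tendsto_approx hlim hμcell
  have hle := Cascade.dimH_real_le_one (Cascade.cdf (μ : Measure unitInterval) '' K)
  have hmem : (dimH (Cascade.cdf (μ : Measure unitInterval) '' K)).toReal ∈ Set.Icc (0 : ℝ) 1 :=
    ⟨ENNReal.toReal_nonneg, ENNReal.toReal_le_of_le_ofReal zero_le_one (by simpa using hle)⟩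
  refine ⟨by rw [Cascade.limitMeasure, htend.limUnder_eq]; exact htend,
    -- The metric is pulled back from the line by the distribution function, which is thereby an
    -- isometry and preserves the dimension of `K`.
    MetricSpace.induced (Cascade.cdf (μ : Measure unitInterval)) hinj inferInstance,
    fun x y => (Cascade.rho_eq_dist_cdf htend x y).symm,
    (dimH (Cascade.cdf (μ : Measure unitInterval) '' K)).toReal, hmem, ?_, ?_, fun t ht h => ?_⟩
  · rw [ENNReal.ofReal_toReal (ne_top_of_le_ne_top ENNReal.one_ne_top hle)]
    exact (@Isometry.dimH_image unitInterval ℝ (MetricSpace.induced (Cascade.cdf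
      (μ : Measure unitInterval)) hinj inferInstance).toEMetricSpace _ _ (fun _ _ => rfl) K).symm
  · rw [hζ₀, ← hdim, hφ]
    ring
  · refine Cascade.kpzExponent_injOn ha ha2 ht hmem ?_
    rw [hdim, ← hζ₀, hφ]
    linarith
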